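/- Let $N\in\mathbb N$, $\sigma\in(0,2)$ and $m>\max\{1,\sigma\}$; $B_\delta$ is the open ball of radius $\delta$ about $0$ in $\mathbb R^N$ and $B=B_1$. "Periodic" means $\mathbb Z^N$-periodic in $x$, and periodic functions are identified with functions on $\mathbb T^N=\mathbb R^N/\mathbb Z^N$. A modulus is a nondecreasing $\zeta:[0,\infty)\to[0,\infty)$ with $\zeta(0)=0$ and $\zeta(s)\to0$ as $s\to0$. **Data.** Let $\nu$ be a Borel measure on $\mathbb R^N$ such that (M1) for every $\alpha\in[0,2]$ there is $C>0$ with $\int_{B_\delta^c}\min\{1,|z|^\alpha\}\,\nu(dz)\le C\,h_{\alpha,\sigma}(\delta)$ for all $\delta>0$, where $h_{\alpha,\sigma}(\delta)=\delta^{\alpha-\sigma}$ if $\alpha<\sigma$, $|\ln\delta|+1$ if $\alpha=\sigma$, and $1$ if $\alpha>\sigma$; (M2) for every $\alpha\in(\sigma,2]$ there is $C>0$ with $\int_{B_\delta}|z|^\alpha\,\nu(dz)\le C\delta^{\alpha-\sigma}$ for all $\delta\in(0,1)$. Let $j:\mathbb R^N\times\mathbb R^N\to\mathbb R^N$ be such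 that $j(\cdot,z)$ is continuous and periodic for every $z$, and $j(x,\cdot)$ is Borel measurable on $\mathbb R^N$ and continuous on $\mathrm{supp}\,\nu$ for every $x$, and such that (J1) there is $C_j>0$ with $|j(x,z)|\le C_j|z|$ for all $x,z$; (J2) for each $\delta>0$ there is $C_\delta>0$ such that, for all $x,y$, $\int_{B_\delta}|j(x,z)-j(y,z)|^2\nu(dz)\le C_\delta|x-y|^2$ and $\int_{B\setminus B_\delta}|j(x,z)-j(y,z)|\,\nu(dz)\le C_\delta|x-y|$. Iterative covering property: with $X_0(x)=\{x\}$ and $X_{n+1}(x)=\bigcup_{\xi\in X_n(x)}\{\xi+j(\xi,z):z\in\mathrm{supp}\,\nu\}$, the image of $\bigcup_{n}X_n(x)$ in $\mathbb T^N$ is dense in $\mathbb T^N$ for every $x$. Let $H:\mathbb R^N\times\mathbb R^N\to\mathbb R$ be continuous, periodic in $x$, and such that (H0) $H(\cdot,0)$ is bounded; (H1) there are moduli $\zeta_1,\zeta_2$ with $H(y,p+q)-H(x,p)\le\zeta_1(|x-y|)(1+|p|^m)+\zeta_2(|q|)(1+|p|^{m-1})$ for all $x,y,p,q$, and $\zeta_2(s)\,s^{(1-m)/m}\to0$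 as $s\to0^+$; (H2) there are $A,b_0>0$ with $H(x,p)-\mu H(x,\mu^{-1}p)\le(1-\mu)\big(b_0(1-m)|p|^m+A\big)$ for all $\mu\in(0,1)$ and all $x,p$. Put $I_x^j(\phi,x)=\int_{\mathbb R^N}\big[\phi(x+j(x,z))-\phi(x)-\mathbf 1_B(z)\langle D\phi(x),j(x,z)\rangle\big]\,\nu(dz)$. **Solutions.** All equations are understood in the viscosity sense: whenever $\phi$ is a $C^2$ test function such that $u-\phi$ has a global maximum (for subsolutions) or minimum (for supersolutions) at a point, the corresponding inequality holds there for every $\delta>0$, where derivatives are those of $\phi$ and the nonlocal term is evaluated with $\phi$ for $z\in B_\delta$ and with $u$ for $z\in B_\delta^c$. **Theorem (large time behavior).** Let $u_0$ be continuous and periodic, and let $u$ be the solution, periodic in $x$ and continuous on $\mathbb R^N\times[0,\infty)$, of $$\partial_tu-I_x^j(u(\cdot,t),x)+H(x,Du)=0\ \text{ in }\mathbb T^N\times(0,\infty),\qquad u(\cdot,0)=u_0\ \text{ in }\mathbb T^N .$$ Then there exist $c\in\mathbb R$ and a continuous periodic function $w$ such that $w$ solves the ergodic problem $$-I_x^j(w,x)+H(x,Dw)=-c\quad\text{in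 }\mathbb T^N,$$ and $$u(x,t)-ct-w(x)\to0\quad\text{as }t\to+\infty,\ \text{uniformly in }x\in\mathbb T^N .$$ -/

import Mathlib

open Set Filter Topology MeasureTheory

noncomputable section

namespace LevyIto

/-- Euclidean space `ℝ^N`. -/
abbrev Space (N : ℕ) : Type := EuclideanSpace ℝ (Fin N)

variable {N : ℕ}

/-- The vector of `ℝ^N` with integer coordinates `k`; functions on the torus `ℝ^N / ℤ^N` are
functions on `ℝ^N` which are invariant under translations by all `lattice k`. -/
def lattice (k : Fin N → ℤ) : Space N := WithLp.toLp 2 (fun i => (k i : ℝ))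

/-- `ℤ^N`-periodicity of a map on `ℝ^N`. -/
def Periodic {β : Type*} (f : Space N → β) : Prop :=
  ∀ (k : Fin N → ℤ) (x : Space N), f (x + lattice k) = f x

/-- A modulus of continuity: a nondecreasing function on `[0, ∞)` that vanishes at `0` and is
continuous there. -/
def IsModulus (ζ : ℝ → ℝ) : Prop :=
  ζ 0 = 0 ∧ MonotoneOn ζ (Ici 0) ∧ Tendsto ζ (𝓝[≥] 0) (𝓝 0)

/-! ### The jump measure and the jump function -/

/-- The function `h_{α,σ}`. -/
def hFun (α σ δ : ℝ) : ℝ :=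
  if α < σ then δ ^ (α - σ) else if α = σ then |Real.log δ| + 1 else 1

/-- (M1) for a measure that does not depend on `x`. -/
def CondM1 (σ : ℝ) (ν : Measure (Space N)) : Prop :=
  ∀ α ∈ Icc (0 : ℝ) 2, ∃ C : ℝ, 0 < C ∧ ∀ δ : ℝ, 0 < δ →
    ∫⁻ z in (Metric.ball (0 : Space N) δ)ᶜ, ENNReal.ofReal (min 1 (‖z‖ ^ α)) ∂ν
      ≤ ENNReal.ofReal (C * hFun α σ δ)

/-- (M2) for a measure that does not depend on `x`. -/
def CondM2 (σ : ℝ) (ν : Measure (Space N)) : Prop :=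
  ∀ α ∈ Ioc σ 2, ∃ C : ℝ, 0 < C ∧ ∀ δ ∈ Ioo (0 : ℝ) 1,
    ∫⁻ z in Metric.ball (0 : Space N) δ, ENNReal.ofReal (‖z‖ ^ α) ∂ν
      ≤ ENNReal.ofReal (C * δ ^ (α - σ))

/-- (J1): the jumps are at most linear in `z`, uniformly in `x`. -/
def CondJ1 (j : Space N → Space N → Space N) : Prop :=
  ∃ C : ℝ, 0 < C ∧ ∀ x z, ‖j x z‖ ≤ C * ‖z‖

/-- (J2): compatibility between `j` and `ν`. -/
def CondJ2 (ν : Measure (Space N)) (j : Space N → Space N → Space N) : Prop :=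
  ∀ δ : ℝ, 0 < δ → ∃ C : ℝ, 0 < C ∧ ∀ x y : Space N,
    ∫⁻ z in Metric.ball (0 : Space N) δ, ENNReal.ofReal (‖j x z - j y z‖ ^ 2) ∂ν
        ≤ ENNReal.ofReal (C * ‖x - y‖ ^ 2) ∧
    ∫⁻ z in Metric.ball (0 : Space N) 1 \ Metric.ball (0 : Space N) δ,
        ENNReal.ofReal ‖j x z - j y z‖ ∂ν
        ≤ ENNReal.ofReal (C * ‖x - y‖)

/-- The sets `X_n(x)`: the points that can be reached from `x` by exactly `n` jumps `ξ ↦ ξ + j(ξ,z)`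
with `z` in the support of `ν`. -/
def reach (ν : Measure (Space N)) (j : Space N → Space N → Space N) (x : Space N) :
    ℕ → Set (Space N)
  | 0 => {x}
  | n + 1 => ⋃ ξ ∈ reach ν j x n, (fun z => ξ + j ξ z) '' ν.support

/-- The iterative covering property: for each `x`, the set `⋃ n, X_n(x)`, read on the torus, has
closure equal to the whole torus. On the level of `ℝ^N` this says that the `ℤ^N`-saturation of
`⋃ n, X_n(x)` has closure `ℝ^N`. -/
def IterativeCovering (ν : Measure (Space N)) (j : Space N → Space N → Space N) : Prop :=
  ∀ x : Space N,
    closure {y : Space N | ∃ (n : ℕ) (k : Fin N → ℤ), y + lattice k ∈ reach ν j x n} = univ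

/-! ### The Hamiltonian -/

/-- (H0) -/
def CondH0 (H : Space N → Space N → ℝ) : Prop :=
  ∃ H₀ : ℝ, 0 < H₀ ∧ ∀ x, |H x 0| ≤ H₀

/-- (H1) with exponent `m` and moduli `ζ₁`, `ζ₂`. -/
def CondH1 (m : ℝ) (ζ₁ ζ₂ : ℝ → ℝ) (H : Space N → Space N → ℝ) : Prop :=
  ∀ x y p q : Space N,
    H y (p + q) - H x p ≤ ζ₁ ‖x - y‖ * (1 + ‖p‖ ^ m) + ζ₂ ‖q‖ * (1 + ‖p‖ ^ (m - 1))

/-- (H2) with the exponent `m`. -/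
def CondH2 (m : ℝ) (H : Space N → Space N → ℝ) : Prop :=
  ∃ A b₀ : ℝ, 0 < A ∧ 0 < b₀ ∧ ∀ μ ∈ Ioo (0 : ℝ) 1, ∀ x p : Space N,
    H x p - μ * H x (μ⁻¹ • p) ≤ (1 - μ) * (b₀ * (1 - m) * ‖p‖ ^ m + A)

/-! ### The nonlocal operator and viscosity solutions -/

/-- The Lévy–Itô operator restricted to jumps with `z ∈ S`:
`I_x^j[S](φ, x, p) = ∫_S [φ(x + j(x,z)) - φ(x) - 1_B(z) ⟨p, j(x,z)⟩] ν(dz)`. -/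
def levyIto (ν : Measure (Space N)) (j : Space N → Space N → Space N) (S : Set (Space N))
    (φ : Space N → ℝ) (x p : Space N) : ℝ :=
  ∫ z in S, (φ (x + j x z) - φ x
    - (Metric.ball (0 : Space N) 1).indicator (fun z => inner ℝ p (j x z)) z) ∂ν

/-- The evaluation of the operator used in the viscosity inequalities: the small jumps `z ∈ B_δ` act
on the test function `φ`, the other ones on `u`, and the gradient is the one of `φ`. -/
def levyItoSplit (ν : Measure (Space N)) (j : Space N → Space N → Space N) (δ : ℝ)
    (φ u : Space N → ℝ) (x : Space N) : ℝ :=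
  levyIto ν j (Metric.ball 0 δ) φ x (gradient φ x)
    + levyIto ν j (Metric.ball 0 δ)ᶜ u x (gradient φ x)

/-- `u` is bounded on `ℝ^N × [0, T]` for each `T`. -/
def BoundedOnStrips (u : Space N → ℝ → ℝ) : Prop :=
  ∀ T : ℝ, ∃ C : ℝ, ∀ x : Space N, ∀ t ∈ Icc 0 T, |u x t| ≤ C

/-- `u` is a viscosity subsolution of `∂_t u - I_x^j(u(·,t), x) + H(x, Du) = 0` for `t > 0`. -/
def IsParabolicSubsolution (ν : Measure (Space N)) (j : Space N → Space N → Space N)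
    (H : Space N → Space N → ℝ) (u : Space N → ℝ → ℝ) : Prop :=
  BoundedOnStrips u ∧
  UpperSemicontinuousOn (fun q : Space N × ℝ => u q.1 q.2) (univ ×ˢ Ioi 0) ∧
  ∀ φ : Space N × ℝ → ℝ, ContDiff ℝ 2 φ →
    ∀ (x₀ : Space N) (t₀ : ℝ), 0 < t₀ →
      (∀ (x : Space N) (t : ℝ), 0 < t → u x t - φ (x, t) ≤ u x₀ t₀ - φ (x₀, t₀)) →
      ∀ δ : ℝ, 0 < δ →
        deriv (fun s => φ (x₀, s)) t₀
          - levyItoSplit ν j δ (fun x => φ (x, t₀)) (fun x => u x t₀) x₀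
          + H x₀ (gradient (fun x => φ (x, t₀)) x₀) ≤ 0

/-- `u` is a viscosity supersolution of `∂_t u - I_x^j(u(·,t), x) + H(x, Du) = 0` for `t > 0`. -/
def IsParabolicSupersolution (ν : Measure (Space N)) (j : Space N → Space N → Space N)
    (H : Space N → Space N → ℝ) (u : Space N → ℝ → ℝ) : Prop :=
  BoundedOnStrips u ∧
  LowerSemicontinuousOn (fun q : Space N × ℝ => u q.1 q.2) (univ ×ˢ Ioi 0) ∧
  ∀ φ : Space N × ℝ → ℝ, ContDiff ℝ 2 φ →
    ∀ (x₀ : Space N) (t₀ : ℝ), 0 < t₀ →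
      (∀ (x : Space N) (t : ℝ), 0 < t → u x₀ t₀ - φ (x₀, t₀) ≤ u x t - φ (x, t)) →
      ∀ δ : ℝ, 0 < δ →
        0 ≤ deriv (fun s => φ (x₀, s)) t₀
          - levyItoSplit ν j δ (fun x => φ (x, t₀)) (fun x => u x t₀) x₀
          + H x₀ (gradient (fun x => φ (x, t₀)) x₀)

/-- `u` is a viscosity solution, continuous up to `t = 0`, of the periodic Cauchy problem
`∂_t u - I_x^j(u(·,t), x) + H(x, Du) = 0`, `u(·,0) = u₀`. -/
structure IsCauchySolution (ν : Measure (Space N)) (j : Space N → Space N → Space N)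
    (H : Space N → Space N → ℝ) (u₀ : Space N → ℝ) (u : Space N → ℝ → ℝ) : Prop where
  periodic : ∀ t : ℝ, 0 ≤ t → Periodic (fun x => u x t)
  continuousOn : ContinuousOn (fun q : Space N × ℝ => u q.1 q.2) (univ ×ˢ Ici 0)
  subsolution : IsParabolicSubsolution ν j H u
  supersolution : IsParabolicSupersolution ν j H u
  initial : ∀ x, u x 0 = u₀ x

/-- `w` is a bounded viscosity subsolution of `- I_x^j(w, x) + H(x, Dw) = -c`. -/
def IsErgodicSubsolution (ν : Measure (Space N)) (j : Space N → Space N → Space N)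
    (H : Space N → Space N → ℝ) (w : Space N → ℝ) (c : ℝ) : Prop :=
  (∃ C : ℝ, ∀ x, |w x| ≤ C) ∧ UpperSemicontinuous w ∧
  ∀ φ : Space N → ℝ, ContDiff ℝ 2 φ →
    ∀ x₀ : Space N, (∀ x, w x - φ x ≤ w x₀ - φ x₀) →
      ∀ δ : ℝ, 0 < δ → - levyItoSplit ν j δ φ w x₀ + H x₀ (gradient φ x₀) ≤ -c

/-- `w` is a bounded viscosity supersolution of `- I_x^j(w, x) + H(x, Dw) = -c`. -/
def IsErgodicSupersolution (ν : Measure (Space N)) (j : Space N → Space N → Space N)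
    (H : Space N → Space N → ℝ) (w : Space N → ℝ) (c : ℝ) : Prop :=
  (∃ C : ℝ, ∀ x, |w x| ≤ C) ∧ LowerSemicontinuous w ∧
  ∀ φ : Space N → ℝ, ContDiff ℝ 2 φ →
    ∀ x₀ : Space N, (∀ x, w x₀ - φ x₀ ≤ w x - φ x) →
      ∀ δ : ℝ, 0 < δ → -c ≤ - levyItoSplit ν j δ φ w x₀ + H x₀ (gradient φ x₀)

/-- `(w, c)` is a solution pair of the periodic ergodic problem: `w` is a continuous periodic
viscosity solution of `- I_x^j(w, x) + H(x, Dw) = -c`. -/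
structure IsErgodicSolution (ν : Measure (Space N)) (j : Space N → Space N → Space N)
    (H : Space N → Space N → ℝ) (w : Space N → ℝ) (c : ℝ) : Prop where
  periodic : Periodic w
  continuous : Continuous w
  subsolution : IsErgodicSubsolution ν j H w c
  supersolution : IsErgodicSupersolution ν j H w c

end LevyIto

end

/-! The proof rests on a linearised inequality for the difference of two solutions. By (H2),
replacing `u` by `(1 - λ) u` in a doubling of variables gains a term of order `λ |P|^m`, and this
gain absorbs the errors that (H1) produces in the Hamiltonian. As `λ → 0` the Hamiltonian disappears
altogether (`doubling_step`, `exists_near_max`): if `u - v - θ(t)` has a maximum, then at a maximum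
point as close to it as desired, `θ'` is at most the integral of the increments of `u - v` over the
jumps with `|z| ≥ δ`, for small `δ`.

There are two consequences. If `θ` is strictly increasing, the inequality is absurd, because
increments at a maximum are nonpositive; this gives `comparison`, hence contraction in the sup norm.
If `θ = 0`, a nonpositive integrand has nonnegative integral, so it vanishes on the support of `ν`.
The value of the maximum therefore passes along jumps, and the covering property spreads it over the
torus (`strong_maximum`).

Compactness comes from coercivity, `H ≥ c |p|^m - C`. Comparison with the cone `K |y - x|^γ` shows
that `u(y,t)` lies below `u(x,s) + K |y - x|^γ` for some `s` near `t` (`holder_up_to_time_shift`),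
and contraction controls oscillation in time uniformly on `[0, ∞)`. Thus the spatial oscillation of
`u` is bounded, `t ↦ u(0,t)` is additive up to a bounded error, and Fekete's lemma gives `c` with `u
- ct` bounded.

Finally, along times `s_n → ∞` the functions `u(x, t + s_n) - c s_n` converge uniformly to a
solution `v`. By comparison the supremum over `x` of `u(x, t + h) - u(x, t)` is nonincreasing in
`t`. In the limit `v` this supremum is therefore independent of `t`; it is attained, and the strong
maximum principle makes the increment constant in `x`. Boundedness of `v - ct` forces the constant
to be `ch`, so `v = w + ct` and `w` solves the ergodic problem. Closeness at one large time persists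
by contraction, which turns convergence along a sequence into full convergence. -/

noncomputable section

namespace LevyIto

variable {N : ℕ}

/-! ### Moments of the jump measure and integrability of increments -/

/-- The quantitative information on the jump measure and the jump function used throughout. -/
structure Admissible (ν : Measure (Space N)) (j : Space N → Space N → Space N) (Cj α : ℝ) :
    Prop where
  pos : 0 < Cj
  one_lt : 1 < α
  lt_two : α < 2
  meas : ∀ x, Measurable (j x)
  cont : ∀ z, Continuous (fun x => j x z)
  bound : ∀ x z, ‖j x z‖ ≤ Cj * ‖z‖
  tail : ∀ δ : ℝ, 0 < δ → ν (Metric.ball (0 : Space N) δ)ᶜ < ⊤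
  core : IntegrableOn (fun z : Space N => ‖z‖ ^ α) (Metric.ball 0 1) ν
  lip : CondJ2 ν j

theorem integrableOn_of_lintegral_ofReal_le {X : Type*} [MeasurableSpace X] {μ : Measure X}
    {f : X → ℝ} {S : Set X} {c : ℝ} (hf : Measurable f) (h0 : ∀ x, 0 ≤ f x) (hc : 0 ≤ c)
    (h : ∫⁻ z in S, ENNReal.ofReal (f z) ∂μ ≤ ENNReal.ofReal c) :
    IntegrableOn f S μ ∧ ∫ z in S, f z ∂μ ≤ c := by
  have hint : IntegrableOn f S μ := by
    refine ⟨hf.aestronglyMeasurable, ?_⟩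
    rw [hasFiniteIntegral_iff_ofReal (Eventually.of_forall h0)]
    exact h.trans_lt ENNReal.ofReal_lt_top
  refine ⟨hint, ?_⟩
  rw [integral_eq_lintegral_of_nonneg_ae (Eventually.of_forall h0) hf.aestronglyMeasurable]
  exact ENNReal.toReal_le_of_le_ofReal hc h

/-- The exponent `α` is taken strictly between `max 1 σ` and `min m 2`. Exceeding `σ` makes the
`α`-moment near the origin finite by (M2), while `1 < α < m` puts the Hölder exponent `(m - α) / (m
- 1)` in `(0, 1)`. The tails have finite mass by (M1) with exponent `0`. Since (M2) covers only
radii below `1`, the unit ball is split at radius `1/2`. -/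
theorem admissible_of_cond {σ m : ℝ} (hσ : σ ∈ Ioo (0 : ℝ) 2) (hm : max 1 σ < m)
    {ν : Measure (Space N)} (hM1 : CondM1 σ ν) (hM2 : CondM2 σ ν)
    {j : Space N → Space N → Space N} (hj_meas : ∀ x, Measurable (j x))
    (hj_cont : ∀ z, Continuous (fun x => j x z)) (hJ1 : CondJ1 j) (hJ2 : CondJ2 ν j) :
    ∃ Cj α, Admissible ν j Cj α ∧ α < m := by
  obtain ⟨Cj, hCj, hb⟩ := hJ1
  obtain ⟨α, hα1, hα2⟩ := exists_between (show max 1 σ < min m 2 from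
    lt_min hm (max_lt one_lt_two hσ.2))
  have h1 : 1 < α := (le_max_left _ _).trans_lt hα1
  have h2 : σ < α := (le_max_right _ _).trans_lt hα1
  have h3 : α < m := hα2.trans_le (min_le_left _ _)
  have h4 : α < 2 := hα2.trans_le (min_le_right _ _)
  have htail : ∀ δ : ℝ, 0 < δ → ν (Metric.ball (0 : Space N) δ)ᶜ < ⊤ := by
    intro δ hδ
    obtain ⟨C, -, hC⟩ := hM1 0 ⟨le_rfl, zero_le_two⟩
    have := hC δ hδ
    simp only [Real.rpow_zero, min_self, ENNReal.ofReal_one, lintegral_one,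
      Measure.restrict_apply MeasurableSet.univ, univ_inter] at this
    exact this.trans_lt ENNReal.ofReal_lt_top
  refine ⟨Cj, α, ⟨hCj, h1, h4, hj_meas, hj_cont, hb, htail, ?_, hJ2⟩, h3⟩
  have hmeas : Measurable (fun z : Space N => ‖z‖ ^ α) := by fun_prop
  have hA : IntegrableOn (fun z : Space N => ‖z‖ ^ α) (Metric.ball 0 (1 / 2)) ν := by
    obtain ⟨C, hC0, hC⟩ := hM2 α ⟨h2, h4.le⟩
    exact (integrableOn_of_lintegral_ofReal_le hmeas (fun z => by positivity) (by positivity)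
      (hC (1 / 2) ⟨by norm_num, by norm_num⟩)).1
  have hB : IntegrableOn (fun z : Space N => ‖z‖ ^ α)
      (Metric.ball 0 1 \ Metric.ball 0 (1 / 2)) ν := by
    refine Measure.integrableOn_of_bounded (M := 1) ?_ hmeas.aestronglyMeasurable ?_
    · exact ((measure_mono fun z hz => hz.2).trans_lt (htail (1 / 2) (by norm_num))).ne
    · filter_upwards [ae_restrict_mem (measurableSet_ball.diff measurableSet_ball)] with z hz
      have : ‖z‖ < 1 := by simpa using hz.1
      rw [Real.norm_of_nonneg (by positivity)]
      exact Real.rpow_le_one (norm_nonneg _) this.le (by linarith)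
  refine (hA.union hB).mono_set fun z hz => ?_
  by_cases h : z ∈ Metric.ball (0 : Space N) (1 / 2)
  · exact Or.inl h
  · exact Or.inr ⟨hz, h⟩

/-- The integrand of the Lévy–Itô operator. -/
def incr (j : Space N → Space N → Space N) (φ : Space N → ℝ) (x p z : Space N) : ℝ :=
  φ (x + j x z) - φ x - (Metric.ball (0 : Space N) 1).indicator (fun z => inner ℝ p (j x z)) z

theorem levyIto_eq_incr (ν : Measure (Space N)) (j : Space N → Space N → Space N)
    (S : Set (Space N)) (φ : Space N → ℝ) (x p : Space N) :
    levyIto ν j S φ x p = ∫ z in S, incr j φ x p z ∂ν := rfl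

/-- The contribution of the jumps of size at most `δ` to the operator at a quadratic function. -/
def smallMass (ν : Measure (Space N)) (Cj δ : ℝ) : ℝ :=
  Cj ^ 2 * ∫ z in Metric.ball (0 : Space N) δ, ‖z‖ ^ 2 ∂ν

theorem smallMass_nonneg (ν : Measure (Space N)) (Cj δ : ℝ) : 0 ≤ smallMass ν Cj δ :=
  mul_nonneg (sq_nonneg _) (integral_nonneg fun _ => by positivity)

namespace Admissible

variable {ν : Measure (Space N)} {j : Space N → Space N → Space N} {Cj α : ℝ}

theorem zero (h : Admissible ν j Cj α) (x : Space N) : j x 0 = 0 := by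
  have := h.bound x 0
  simpa using this

theorem norm_lt (h : Admissible ν j Cj α) {δ : ℝ} {z : Space N}
    (hz : z ∈ Metric.ball (0 : Space N) δ) (x : Space N) : ‖j x z‖ ≤ Cj * δ :=
  (h.bound x z).trans (mul_le_mul_of_nonneg_left (by simpa using (mem_ball_zero_iff.1 hz).le)
    h.pos.le)

theorem sq_le (h : Admissible ν j Cj α) {δ : ℝ} {z : Space N}
    (hz : z ∈ Metric.ball (0 : Space N) δ) (hδ : 0 < δ) :
    ‖z‖ ^ 2 ≤ δ ^ (2 - α) * ‖z‖ ^ α := by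
  have hz' : ‖z‖ < δ := by simpa using hz
  rcases (norm_nonneg z).eq_or_lt with h0 | h0
  · rw [← h0]; simp; positivity
  · calc ‖z‖ ^ 2 = ‖z‖ ^ (2 - α) * ‖z‖ ^ α := by
          rw [← Real.rpow_add h0]; norm_num
      _ ≤ _ := mul_le_mul_of_nonneg_right
        (Real.rpow_le_rpow h0.le hz'.le (by linarith [h.lt_two])) (by positivity)

theorem integrableOn_sq (h : Admissible ν j Cj α) {δ : ℝ} (hδ1 : δ ≤ 1) :
    IntegrableOn (fun z : Space N => ‖z‖ ^ 2) (Metric.ball 0 δ) ν := by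
  refine IntegrableOn.mono_set ?_ (Metric.ball_subset_ball hδ1)
  refine Integrable.mono' h.core (by fun_prop) ?_
  filter_upwards [ae_restrict_mem measurableSet_ball] with z hz
  rw [Real.norm_of_nonneg (by positivity)]
  simpa using h.sq_le hz one_pos

/-- On `B_δ` one has `|z|² ≤ δ^(2-α) |z|^α`, and `α < 2`. This is what removes the contribution of
the small jumps in every limit below. -/
theorem tendsto_smallMass (h : Admissible ν j Cj α) :
    Tendsto (smallMass ν Cj) (𝓝[>] 0) (𝓝 0) := by
  set S := ∫ z in Metric.ball (0 : Space N) 1, ‖z‖ ^ α ∂ν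
  have hlim : Tendsto (fun δ : ℝ => Cj ^ 2 * (δ ^ (2 - α) * S)) (𝓝[>] 0) (𝓝 0) := by
    have h1 : Tendsto (fun δ : ℝ => δ ^ (2 - α)) (𝓝[>] 0) (𝓝 (0 ^ (2 - α))) :=
      ((Real.continuousAt_rpow_const 0 (2 - α) (Or.inr (by linarith [h.lt_two]))).tendsto).mono_left
        nhdsWithin_le_nhds
    rw [Real.zero_rpow (by linarith [h.lt_two])] at h1
    simpa using (h1.mul_const S).const_mul (Cj ^ 2)
  refine tendsto_of_tendsto_of_tendsto_of_le_of_le' tendsto_const_nhds hlim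
    (Eventually.of_forall fun δ => smallMass_nonneg _ _ _) ?_
  filter_upwards [Ioo_mem_nhdsGT one_pos] with δ hδ
  refine mul_le_mul_of_nonneg_left ?_ (sq_nonneg _)
  calc ∫ z in Metric.ball (0 : Space N) δ, ‖z‖ ^ 2 ∂ν
      ≤ ∫ z in Metric.ball (0 : Space N) δ, δ ^ (2 - α) * ‖z‖ ^ α ∂ν :=
        setIntegral_mono_on (h.integrableOn_sq hδ.2.le)
          ((h.core.mono_set (Metric.ball_subset_ball hδ.2.le)).const_mul _) measurableSet_ball
          fun z hz => h.sq_le hz hδ.1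
    _ = δ ^ (2 - α) * ∫ z in Metric.ball (0 : Space N) δ, ‖z‖ ^ α ∂ν := integral_const_mul _ _
    _ ≤ δ ^ (2 - α) * S := by
        refine mul_le_mul_of_nonneg_left ?_ (Real.rpow_nonneg hδ.1.le _)
        exact setIntegral_mono_set h.core (Eventually.of_forall fun z => by positivity)
          (Metric.ball_subset_ball hδ.2.le).eventuallyLE

theorem jump_sq_le (h : Admissible ν j Cj α) (x z : Space N) :
    ‖j x z‖ ^ 2 ≤ Cj ^ 2 * ‖z‖ ^ 2 := by
  rw [← mul_pow]
  exact pow_le_pow_left₀ (norm_nonneg _) (h.bound x z) 2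

theorem integrableOn_jump_sq (h : Admissible ν j Cj α) (x : Space N) {δ : ℝ} (hδ1 : δ ≤ 1) :
    IntegrableOn (fun z : Space N => ‖j x z‖ ^ 2) (Metric.ball 0 δ) ν := by
  refine Integrable.mono' ((h.integrableOn_sq hδ1).const_mul (Cj ^ 2))
    ((h.meas x).norm.pow_const 2).aestronglyMeasurable (Eventually.of_forall fun z => ?_)
  rw [Real.norm_of_nonneg (by positivity)]
  exact h.jump_sq_le x z

theorem integral_jump_sq_le (h : Admissible ν j Cj α) (x : Space N) {δ : ℝ} (hδ1 : δ ≤ 1)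
    {S : Set (Space N)} (hS : S ⊆ Metric.ball 0 δ) :
    ∫ z in S, ‖j x z‖ ^ 2 ∂ν ≤ smallMass ν Cj δ := by
  calc ∫ z in S, ‖j x z‖ ^ 2 ∂ν ≤ ∫ z in Metric.ball 0 δ, ‖j x z‖ ^ 2 ∂ν :=
        setIntegral_mono_set (h.integrableOn_jump_sq x hδ1)
          (Eventually.of_forall fun z => by positivity) hS.eventuallyLE
    _ ≤ ∫ z in Metric.ball 0 δ, Cj ^ 2 * ‖z‖ ^ 2 ∂ν :=
        setIntegral_mono (h.integrableOn_jump_sq x hδ1)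
          ((h.integrableOn_sq hδ1).const_mul _) fun z => h.jump_sq_le x z
    _ = smallMass ν Cj δ := integral_const_mul _ _

theorem measurable_incr (h : Admissible ν j Cj α) {φ : Space N → ℝ} (hφ : Continuous φ)
    (x p : Space N) : Measurable (incr j φ x p) := by
  have := h.meas x
  refine ((hφ.measurable.comp (measurable_const.add this)).sub measurable_const).sub ?_
  exact Measurable.indicator (by fun_prop) measurableSet_ball

theorem abs_incr_le (h : Admissible ν j Cj α) {φ : Space N → ℝ} {U : ℝ}
    (hU : ∀ x, |φ x| ≤ U) (x p z : Space N) : |incr j φ x p z| ≤ 2 * U + ‖p‖ * Cj := by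
  have h1 := abs_le.1 (hU (x + j x z))
  have h2 := abs_le.1 (hU x)
  have h3 : |(Metric.ball (0 : Space N) 1).indicator (fun z => inner ℝ p (j x z)) z|
      ≤ ‖p‖ * Cj := by
    by_cases hz : z ∈ Metric.ball (0 : Space N) 1
    · rw [indicator_of_mem hz]
      refine (abs_real_inner_le_norm _ _).trans (mul_le_mul_of_nonneg_left ?_ (norm_nonneg _))
      simpa using h.norm_lt hz x
    · rw [indicator_of_notMem hz, abs_zero]
      exact mul_nonneg (norm_nonneg _) h.pos.le
  have h3 := abs_le.1 h3
  unfold incr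
  rw [abs_le]
  constructor <;> linarith

theorem integrableOn_incr (h : Admissible ν j Cj α) {φ : Space N → ℝ} (hφ : Continuous φ) {U : ℝ}
    (hU : ∀ x, |φ x| ≤ U) (x p : Space N) {δ : ℝ} (hδ : 0 < δ) :
    IntegrableOn (incr j φ x p) (Metric.ball 0 δ)ᶜ ν :=
  Measure.integrableOn_of_bounded (M := 2 * U + ‖p‖ * Cj) (h.tail δ hδ).ne
    (h.measurable_incr hφ x p).aestronglyMeasurable
    (Eventually.of_forall fun z => h.abs_incr_le hU x p z)

theorem compl_ball_eq_union {δ δ' : ℝ} (hδ : δ' ≤ δ) :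
    (Metric.ball (0 : Space N) δ')ᶜ
      = (Metric.ball 0 δ \ Metric.ball 0 δ') ∪ (Metric.ball 0 δ)ᶜ := by
  ext z
  by_cases h1 : z ∈ Metric.ball (0 : Space N) δ'
  · simp [h1, Metric.ball_subset_ball hδ h1]
  · by_cases h2 : z ∈ Metric.ball (0 : Space N) δ <;> simp [h1, h2]

theorem integral_compl_ball_split {f : Space N → ℝ} {δ δ' : ℝ} (hδ : δ' ≤ δ)
    (hf : IntegrableOn f (Metric.ball 0 δ')ᶜ ν) :
    ∫ z in (Metric.ball 0 δ')ᶜ, f z ∂ν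
      = ∫ z in Metric.ball 0 δ \ Metric.ball 0 δ', f z ∂ν + ∫ z in (Metric.ball 0 δ)ᶜ, f z ∂ν := by
  rw [compl_ball_eq_union hδ] at hf ⊢
  exact setIntegral_union (disjoint_left.2 fun z h1 h2 => h2 h1.1) measurableSet_ball.compl
    hf.left_of_union hf.right_of_union

end Admissible

/-! ### Viscosity inequalities through quadratic expansions -/

/-- Viscosity subsolutions in terms of one-sided quadratic expansions: the jumps in `B_δ` are
estimated by the quadratic term. -/
def JetSub (ν : Measure (Space N)) (j : Space N → Space N → Space N) (Cj : ℝ)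
    (H : Space N → Space N → ℝ) (u : Space N → ℝ → ℝ) : Prop :=
  ∀ (x₀ p : Space N) (t₀ a C D ρ : ℝ), 0 ≤ C → 0 ≤ D → 0 < ρ → ρ < t₀ →
    (∀ x t, ‖x - x₀‖ ≤ ρ → |t - t₀| ≤ ρ →
      u x t ≤ u x₀ t₀ + inner ℝ p (x - x₀) + a * (t - t₀) + C * ‖x - x₀‖ ^ 2 + D * (t - t₀) ^ 2) →
    ∀ δ : ℝ, 0 < δ → δ ≤ 1 → Cj * δ ≤ ρ / 2 →
      a + H x₀ p ≤ levyIto ν j (Metric.ball 0 δ)ᶜ (fun x => u x t₀) x₀ p + C * smallMass ν Cj δ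

/-- The Hamiltonian of the equation satisfied by `-u`. -/
def negHam (H : Space N → Space N → ℝ) (x p : Space N) : ℝ := -H x (-p)

variable {ν : Measure (Space N)} {j : Space N → Space N → Space N} {Cj α : ℝ}
  {H : Space N → Space N → ℝ}

theorem gradient_fun_neg (φ : Space N → ℝ) (x : Space N) :
    gradient (fun y => -φ y) x = -gradient φ x := by
  unfold gradient
  rw [fderiv_fun_neg, map_neg]

theorem levyIto_neg (ν : Measure (Space N)) (j : Space N → Space N → Space N)
    (S : Set (Space N)) (φ : Space N → ℝ) (x p : Space N) :
    levyIto ν j S (fun y => -φ y) x (-p) = -levyIto ν j S φ x p := by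
  unfold levyIto
  rw [← integral_neg]
  congr 1
  funext z
  by_cases hz : z ∈ Metric.ball (0 : Space N) 1
  · simp only [indicator_of_mem hz, inner_neg_left]; ring
  · simp only [indicator_of_notMem hz]; ring

theorem levyItoSplit_neg (ν : Measure (Space N)) (j : Space N → Space N → Space N)
    (δ : ℝ) (φ u : Space N → ℝ) (x : Space N) :
    levyItoSplit ν j δ (fun y => -φ y) (fun y => -u y) x = -levyItoSplit ν j δ φ u x := by
  unfold levyItoSplit
  rw [gradient_fun_neg, levyIto_neg, levyIto_neg, neg_add]

/-- Negation turns supersolutions into subsolutions for `negHam`, so results on expansions need only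
be proved for subsolutions. -/
theorem IsParabolicSupersolution.neg {u : Space N → ℝ → ℝ}
    (h : IsParabolicSupersolution ν j H u) :
    IsParabolicSubsolution ν j (negHam H) (fun x t => -u x t) := by
  obtain ⟨hb, hs, hv⟩ := h
  refine ⟨fun T => ?_, ?_, ?_⟩
  · obtain ⟨C, hC⟩ := hb T
    exact ⟨C, fun x t ht => by rw [abs_neg]; exact hC x t ht⟩
  · intro q hq y hy
    have := hs q hq (-y) (by simpa using neg_lt.1 hy)
    filter_upwards [this] with q' hq'
    linarith
  · intro φ hφ x₀ t₀ ht₀ hmax δ hδ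
    have := hv (fun q => -φ q) hφ.neg x₀ t₀ ht₀ (fun x t ht => by
      have := hmax x t ht; linarith) δ hδ
    have e1 := levyItoSplit_neg ν j δ (fun x => φ (x, t₀)) (fun x => -u x t₀) x₀
    simp only [neg_neg] at e1
    rw [e1, gradient_fun_neg, deriv.fun_neg] at this
    unfold negHam
    linarith

/-- A function bounded above on strips has a smooth majorant that depends on time only. -/
theorem exists_smooth_majorant {u : Space N → ℝ → ℝ} (hu : BoundedOnStrips u) :
    ∃ G : ℝ → ℝ, ContDiff ℝ 2 G ∧ ∀ x t, 0 ≤ t → u x t ≤ G t := by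
  obtain ⟨g, hg⟩ := exists_contMDiffMap_forall_mem_convex_of_local_const (n := 2)
    (modelWithCornersSelf ℝ ℝ) (t := fun t : ℝ => {y : ℝ | ∀ x, 0 ≤ t → u x t ≤ y}) (by
      intro t a ha b hb r s hr hs hrs x ht
      have h1 := ha x ht
      have h2 := hb x ht
      calc u x t = r * u x t + s * u x t := by rw [← add_mul, hrs, one_mul]
        _ ≤ r * a + s * b := by gcongr) (by
      intro t
      obtain ⟨C, hC⟩ := hu (t + 1)
      refine ⟨C, ?_⟩
      filter_upwards [Iio_mem_nhds (lt_add_one t)] with s hs x hs0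
      exact (le_abs_self _).trans (hC x s ⟨hs0, (mem_Iio.1 hs).le⟩))
  exact ⟨g, g.contMDiff.contDiff, fun x t ht => hg t x ht⟩

theorem hasGradientAt_quadratic (x₀ p : Space N) (c C : ℝ) :
    HasGradientAt (fun x => c + inner ℝ p (x - x₀) + C * ‖x - x₀‖ ^ 2) p x₀ := by
  rw [hasGradientAt_iff_hasFDerivAt]
  have h1 : HasFDerivAt (fun x : Space N => x - x₀) (ContinuousLinearMap.id ℝ (Space N)) x₀ :=
    (hasFDerivAt_id x₀).sub_const x₀
  have h2 := ((innerSL ℝ p).hasFDerivAt.comp x₀ h1).const_add c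
  have h3 := (h1.norm_sq).const_mul C
  have h4 := h2.add h3
  have h5 : InnerProductSpace.toDual ℝ (Space N) p
      = innerSL ℝ p ∘SL ContinuousLinearMap.id ℝ (Space N)
        + C • 2 • innerSL ℝ (x₀ - x₀) ∘SL ContinuousLinearMap.id ℝ (Space N) := by
    ext y
    simp
  rw [h5]
  exact h4

/-- A quadratic expansion touches `u` only locally, whereas the definition asks for a global
maximum. The test function is the quadratic near the point, glued by cut-offs to a smooth function
of time that dominates `u` everywhere. -/
theorem IsParabolicSubsolution.jetSub (hA : Admissible ν j Cj α) {u : Space N → ℝ → ℝ}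
    (h : IsParabolicSubsolution ν j H u) : JetSub ν j Cj H u := by
  intro x₀ p t₀ a C D ρ hC hD hρ hρt hjet δ hδ hδ1 hδρ
  obtain ⟨hb, -, hv⟩ := h
  have ht₀ : 0 < t₀ := hρ.trans hρt
  obtain ⟨G, hG, hGu⟩ := exists_smooth_majorant hb
  -- The cut-offs equal `1` up to radius `ρ / 2`. This is why `Cj * δ ≤ ρ / 2` is required: jumps
  -- from `B_δ` then land where the test function is the quadratic.
  let χ₁ : ContDiffBump x₀ := ⟨ρ / 2, ρ, by linarith, by linarith⟩
  let χ₂ : ContDiffBump t₀ := ⟨ρ / 2, ρ, by linarith, by linarith⟩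
  let q : Space N → ℝ → ℝ := fun x t =>
    u x₀ t₀ + inner ℝ p (x - x₀) + a * (t - t₀) + C * ‖x - x₀‖ ^ 2 + D * (t - t₀) ^ 2
  let φ : Space N × ℝ → ℝ := fun X =>
    χ₁ X.1 * χ₂ X.2 * q X.1 X.2 + (1 - χ₁ X.1 * χ₂ X.2) * G X.2
  have hφ : ContDiff ℝ 2 φ := by
    have e1 : ContDiff ℝ 2 (fun X : Space N × ℝ => χ₁ X.1) := χ₁.contDiff.comp contDiff_fst
    have e2 : ContDiff ℝ 2 (fun X : Space N × ℝ => χ₂ X.2) := χ₂.contDiff.comp contDiff_snd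
    have e3 : ContDiff ℝ 2 (fun X : Space N × ℝ => G X.2) := hG.comp contDiff_snd
    have e4 : ContDiff ℝ 2 (fun X : Space N × ℝ => ‖X.1 - x₀‖ ^ 2) :=
      (contDiff_fst.sub contDiff_const).norm_sq ℝ
    have e5 : ContDiff ℝ 2 (fun X : Space N × ℝ => inner ℝ p (X.1 - x₀)) :=
      contDiff_const.inner ℝ (contDiff_fst.sub contDiff_const)
    have e6 : ContDiff ℝ 2 (fun X : Space N × ℝ => q X.1 X.2) := by
      have e7 : ContDiff ℝ 2 (fun X : Space N × ℝ => X.2 - t₀) := contDiff_snd.sub contDiff_const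
      exact (((contDiff_const.add e5).add (contDiff_const.mul e7)).add
        (contDiff_const.mul e4)).add (contDiff_const.mul (e7.pow 2))
    exact ((e1.mul e2).mul e6).add ((contDiff_const.sub (e1.mul e2)).mul e3)
  have hone₁ : ∀ x, ‖x - x₀‖ ≤ ρ / 2 → χ₁ x = 1 := fun x hx =>
    χ₁.one_of_mem_closedBall (by simpa [dist_eq_norm] using hx)
  have hone₂ : ∀ t, |t - t₀| ≤ ρ / 2 → χ₂ t = 1 := fun t ht =>
    χ₂.one_of_mem_closedBall (by simpa [Real.dist_eq] using ht)
  have hφq : ∀ x t, ‖x - x₀‖ ≤ ρ / 2 → |t - t₀| ≤ ρ / 2 → φ (x, t) = q x t := by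
    intro x t hx ht
    simp only [φ, hone₁ x hx, hone₂ t ht]; ring
  have hq0 : φ (x₀, t₀) = u x₀ t₀ := by
    rw [hφq x₀ t₀ (by simp; linarith) (by simp; linarith)]; simp [q]
  have huφ : ∀ x t, 0 < t → u x t ≤ φ (x, t) := by
    intro x t ht
    have hg := hGu x t ht.le
    have n1 : 0 ≤ χ₁ x * χ₂ t := mul_nonneg χ₁.nonneg χ₂.nonneg
    have n2 : χ₁ x * χ₂ t ≤ 1 := mul_le_one₀ χ₁.le_one χ₂.nonneg χ₂.le_one
    by_cases hx : ‖x - x₀‖ ≤ ρ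
    · by_cases ht' : |t - t₀| ≤ ρ
      · have h1 : u x t ≤ q x t := hjet x t hx ht'
        calc u x t = χ₁ x * χ₂ t * u x t + (1 - χ₁ x * χ₂ t) * u x t := by ring
          _ ≤ χ₁ x * χ₂ t * q x t + (1 - χ₁ x * χ₂ t) * G t :=
            add_le_add (mul_le_mul_of_nonneg_left h1 n1)
              (mul_le_mul_of_nonneg_left hg (by linarith))
      · have : χ₂ t = 0 := χ₂.zero_of_le_dist (by rw [Real.dist_eq]; exact (not_le.1 ht').le)
        simpa [φ, this] using hg
    · have : χ₁ x = 0 := χ₁.zero_of_le_dist (by rw [dist_eq_norm]; exact (not_le.1 hx).le)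
      simpa [φ, this] using hg
  have key := hv φ hφ x₀ t₀ ht₀ (fun x t ht => by
    rw [hq0, sub_self]; have := huφ x t ht; linarith) δ hδ
  have hgrad : gradient (fun x => φ (x, t₀)) x₀ = p := by
    have hg := hasGradientAt_quadratic x₀ p (u x₀ t₀) C
    refine HasGradientAt.gradient ?_
    rw [hasGradientAt_iff_hasFDerivAt] at hg ⊢
    refine hg.congr_of_eventuallyEq ?_
    filter_upwards [Metric.closedBall_mem_nhds x₀ (half_pos hρ)] with x hx
    rw [hφq x t₀ (by simpa [dist_eq_norm] using hx) (by simp; linarith)]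
    simp [q]
  have hder : deriv (fun s => φ (x₀, s)) t₀ = a := by
    have h1 : HasDerivAt (fun t : ℝ => t - t₀) 1 t₀ := (hasDerivAt_id t₀).sub_const t₀
    have h2 : HasDerivAt (fun t : ℝ => u x₀ t₀ + a * (t - t₀) + D * (t - t₀) ^ 2) a t₀ := by
      refine (((h1.const_mul a).const_add (u x₀ t₀)).add
        ((h1.pow 2).const_mul D)).congr_deriv ?_
      simp
    refine (h2.congr_of_eventuallyEq ?_).deriv
    filter_upwards [Metric.closedBall_mem_nhds t₀ (half_pos hρ)] with t ht
    rw [hφq x₀ t (by simp; linarith) (by simpa [Real.dist_eq] using ht)]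
    simp [q]
  have hsmall : levyIto ν j (Metric.ball 0 δ) (fun x => φ (x, t₀)) x₀ p ≤ C * smallMass ν Cj δ := by
    -- The compensator cancels the linear part of the quadratic, and only the square of the jump
    -- remains.
    have : levyIto ν j (Metric.ball 0 δ) (fun x => φ (x, t₀)) x₀ p
        = ∫ z in Metric.ball 0 δ, C * ‖j x₀ z‖ ^ 2 ∂ν := by
      refine setIntegral_congr_fun measurableSet_ball fun z hz => ?_
      have hz1 : z ∈ Metric.ball (0 : Space N) 1 := Metric.ball_subset_ball hδ1 hz
      have hj : ‖x₀ + j x₀ z - x₀‖ ≤ ρ / 2 := by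
        rw [add_sub_cancel_left]; exact (hA.norm_lt hz x₀).trans hδρ
      simp only [indicator_of_mem hz1, hq0]
      rw [hφq _ _ hj (by simp; linarith)]
      simp only [q, add_sub_cancel_left, sub_self]
      ring
    rw [this, integral_const_mul]
    exact mul_le_mul_of_nonneg_left (hA.integral_jump_sq_le x₀ hδ1 Subset.rfl) hC
  unfold levyItoSplit at key
  rw [hgrad, hder] at key
  linarith

/-! ### Doubling of variables: Hamiltonian and nonlocal estimates -/

theorem IsModulus.nonneg {ζ : ℝ → ℝ} (h : IsModulus ζ) {s : ℝ} (hs : 0 ≤ s) : 0 ≤ ζ s := by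
  rw [← h.1]
  exact h.2.1 (mem_Ici.2 le_rfl) hs hs

theorem IsModulus.mono {ζ : ℝ → ℝ} (h : IsModulus ζ) {s t : ℝ} (hs : 0 ≤ s) (hst : s ≤ t) :
    ζ s ≤ ζ t :=
  h.2.1 (mem_Ici.2 hs) (mem_Ici.2 (hs.trans hst)) hst

/-- Young's inequality in the form `ζ X^{m-1} ≤ (b/2) λ X^m + (2/b)^{m-1} ζ (ζ/λ)^{m-1}`. -/
theorem mul_rpow_sub_one_le {b m lam ζ X : ℝ} (hb : 0 < b) (hm : 1 < m) (hlam : 0 < lam)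
    (hζ : 0 ≤ ζ) (hX : 0 ≤ X) :
    ζ * X ^ (m - 1) ≤ lam * (b / 2) * X ^ m + (2 / b) ^ (m - 1) * (ζ * (ζ / lam) ^ (m - 1)) := by
  have hm1 : 0 < m - 1 := by linarith
  -- The threshold is the value of `X` at which `ζ X^(m-1)` equals `λ (b/2) X^m`.
  rcases le_total X (2 / b * (ζ / lam)) with h | h
  · have h1 : X ^ (m - 1) ≤ (2 / b) ^ (m - 1) * (ζ / lam) ^ (m - 1) := by
      rw [← Real.mul_rpow (by positivity) (by positivity)]
      exact Real.rpow_le_rpow hX h hm1.le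
    have h2 : 0 ≤ lam * (b / 2) * X ^ m := by positivity
    have h3 := mul_le_mul_of_nonneg_left h1 hζ
    linarith [show ζ * ((2 / b) ^ (m - 1) * (ζ / lam) ^ (m - 1))
      = (2 / b) ^ (m - 1) * (ζ * (ζ / lam) ^ (m - 1)) by ring]
  · have h1 : ζ ≤ lam * (b / 2) * X := by
      calc ζ = lam * (b / 2) * (2 / b * (ζ / lam)) := by field_simp
        _ ≤ _ := by gcongr
    have h2 : X ^ m = X * X ^ (m - 1) := by
      rcases hX.eq_or_lt with h0 | h0
      · rw [← h0, Real.zero_rpow (by linarith), zero_mul]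
      · rw [← Real.rpow_one_add' hX (by linarith)]; ring_nf
    have h3 : 0 ≤ (2 / b) ^ (m - 1) * (ζ * (ζ / lam) ^ (m - 1)) := by positivity
    have h4 := mul_le_mul_of_nonneg_right h1 (Real.rpow_nonneg hX (m - 1))
    rw [h2]
    linarith

/-- (H2) with `μ = 1 - λ` leaves the good term `-λ b₀ (m-1) |P|^m`. One half absorbs the `ζ₁` error
of (H1), the other half absorbs `ζ₂(|q|) |P|^(m-1)` through Young's inequality. No power of the
large doubling gradient `P` survives. -/
theorem hamiltonian_doubling {m A b₀ : ℝ} {ζ₁ ζ₂ : ℝ → ℝ} (hm : 1 < m) (hb₀ : 0 < b₀)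
    (hζ₂ : IsModulus ζ₂) (hH1 : CondH1 m ζ₁ ζ₂ H)
    (hH2 : ∀ μ ∈ Ioo (0 : ℝ) 1, ∀ x p : Space N,
      H x p - μ * H x (μ⁻¹ • p) ≤ (1 - μ) * (b₀ * (1 - m) * ‖p‖ ^ m + A))
    {lam : ℝ} (hlam : lam ∈ Ioo (0 : ℝ) 1) {x y P q : Space N}
    (h1 : ζ₁ ‖x - y‖ ≤ lam) (h2 : ζ₁ ‖x - y‖ ≤ lam * (b₀ * (m - 1) / 2)) :
    H y (P - q) ≤ (1 - lam) * H x ((1 - lam)⁻¹ • P) + lam * (A + 1) + ζ₂ ‖q‖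
      + (2 / (b₀ * (m - 1))) ^ (m - 1) * (ζ₂ ‖q‖ * (ζ₂ ‖q‖ / lam) ^ (m - 1)) := by
  have hb : 0 < b₀ * (m - 1) := mul_pos hb₀ (by linarith)
  have e1 := hH1 x y P (-q)
  rw [norm_neg, ← sub_eq_add_neg] at e1
  have e2 := hH2 (1 - lam) ⟨by linarith [hlam.2], by linarith [hlam.1]⟩ x P
  have e3 := mul_rpow_sub_one_le hb hm hlam.1 (hζ₂.nonneg (norm_nonneg q)) (norm_nonneg P)
  have e4 : ζ₁ ‖x - y‖ * ‖P‖ ^ m ≤ lam * (b₀ * (m - 1) / 2) * ‖P‖ ^ m :=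
    mul_le_mul_of_nonneg_right h2 (by positivity)
  nlinarith

/-- The penalty is bounded by `v X - v Y`, hence by `2 V`; a large `k` then makes `X` and `Y` close,
and uniform continuity of `v` makes the penalty itself small. -/
theorem exists_doubling_max {K : Set (Space N × ℝ)} (hK : IsCompact K) (hne : K.Nonempty)
    {g v : Space N × ℝ → ℝ} (hg : ContinuousOn g K) (hv : ContinuousOn v K) {d : ℝ} (hd : 0 < d) :
    ∃ k : ℝ, 0 < k ∧ ∃ X ∈ K, ∃ Y ∈ K,
      (∀ X' ∈ K, ∀ Y' ∈ K, g X' - v Y' - k * (‖X'.1 - Y'.1‖ ^ 2 + (X'.2 - Y'.2) ^ 2)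
        ≤ g X - v Y - k * (‖X.1 - Y.1‖ ^ 2 + (X.2 - Y.2) ^ 2)) ∧
      ‖X.1 - Y.1‖ ≤ d ∧ |X.2 - Y.2| ≤ d ∧
      k * (‖X.1 - Y.1‖ ^ 2 + (X.2 - Y.2) ^ 2) ≤ v X - v Y ∧ v X - v Y ≤ d := by
  have huc := hK.uniformContinuousOn_of_continuous hv
  obtain ⟨d₁, hd₁, hd₁'⟩ := Metric.uniformContinuousOn_iff.1 huc d hd
  obtain ⟨V, hV⟩ := hK.exists_bound_of_continuousOn hv
  have hV0 : 0 ≤ V := (norm_nonneg _).trans (hV _ hne.some_mem)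
  set e := min d d₁ / 2 with he
  have hmin : 0 < min d d₁ := lt_min hd hd₁
  have he0 : 0 < e := by positivity
  have hk : 0 < (2 * V + 1) / e ^ 2 := by positivity
  refine ⟨(2 * V + 1) / e ^ 2, hk, ?_⟩
  set k := (2 * V + 1) / e ^ 2
  obtain ⟨⟨X, Y⟩, ⟨hX, hY⟩, hmax⟩ := (hK.prod hK).exists_isMaxOn (hne.prod hne)
    (f := fun Z : (Space N × ℝ) × (Space N × ℝ) =>
      g Z.1 - v Z.2 - k * (‖Z.1.1 - Z.2.1‖ ^ 2 + (Z.1.2 - Z.2.2) ^ 2)) (by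
    refine ((hg.comp continuousOn_fst fun Z hZ => hZ.1).sub
      (hv.comp continuousOn_snd fun Z hZ => hZ.2)).sub (Continuous.continuousOn ?_)
    fun_prop)
  have hmax' : ∀ X' ∈ K, ∀ Y' ∈ K, g X' - v Y' - k * (‖X'.1 - Y'.1‖ ^ 2 + (X'.2 - Y'.2) ^ 2)
        ≤ g X - v Y - k * (‖X.1 - Y.1‖ ^ 2 + (X.2 - Y.2) ^ 2) :=
    fun X' hX' Y' hY' => hmax (mk_mem_prod hX' hY')
  -- Testing against the diagonal pair `(X, X)` eliminates `g`.
  have h1 : k * (‖X.1 - Y.1‖ ^ 2 + (X.2 - Y.2) ^ 2) ≤ v X - v Y := by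
    have := hmax' X hX X hX
    simp only [sub_self, norm_zero] at this
    norm_num at this
    linarith
  have h2 : v X - v Y ≤ 2 * V := by
    have a1 := abs_le.1 (hV X hX)
    have a2 := abs_le.1 (hV Y hY)
    linarith
  have h3 : ‖X.1 - Y.1‖ ^ 2 + (X.2 - Y.2) ^ 2 ≤ e ^ 2 := by
    have : k * (‖X.1 - Y.1‖ ^ 2 + (X.2 - Y.2) ^ 2) ≤ k * e ^ 2 := by
      have : k * e ^ 2 = 2 * V + 1 := by simp only [k]; field_simp
      linarith
    exact le_of_mul_le_mul_left this hk
  have h4 : ‖X.1 - Y.1‖ ≤ e := abs_le_of_sq_le_sq' (by linarith [sq_nonneg (X.2 - Y.2)]) he0.le |>.2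
  have h5 : |X.2 - Y.2| ≤ e := abs_le_of_sq_le_sq (by linarith [sq_nonneg ‖X.1 - Y.1‖]) he0.le
  have he1 : e < d := by have := min_le_left d d₁; linarith
  have he2 : e < d₁ := by have := min_le_right d d₁; linarith
  refine ⟨X, hX, Y, hY, hmax', h4.trans he1.le, h5.trans he1.le, h1, ?_⟩
  have := hd₁' X hX Y hY (by
    rw [Prod.dist_eq, dist_eq_norm, Real.dist_eq]
    exact max_lt (h4.trans_lt he2) (h5.trans_lt he2))
  rw [Real.dist_eq] at this
  exact (le_abs_self _).trans this.le

theorem Admissible.jump_sub_sq (hA : Admissible ν j Cj α) :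
    ∃ C : ℝ, 0 ≤ C ∧ ∀ x y, IntegrableOn (fun z => ‖j x z - j y z‖ ^ 2) (Metric.ball 0 1) ν ∧
      ∫ z in Metric.ball 0 1, ‖j x z - j y z‖ ^ 2 ∂ν ≤ C * ‖x - y‖ ^ 2 := by
  obtain ⟨C, hC, h⟩ := hA.lip 1 one_pos
  exact ⟨C, hC.le, fun x y => integrableOn_of_lintegral_ofReal_le
    (((hA.meas x).sub (hA.meas y)).norm.pow_const 2) (fun z => by positivity) (by positivity)
    (h x y).1⟩

theorem Admissible.jump_sub (hA : Admissible ν j Cj α) {δ : ℝ} (hδ : 0 < δ) :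
    ∃ C : ℝ, 0 ≤ C ∧ ∀ x y,
      IntegrableOn (fun z => ‖j x z - j y z‖) (Metric.ball 0 1 \ Metric.ball 0 δ) ν ∧
      ∫ z in Metric.ball 0 1 \ Metric.ball 0 δ, ‖j x z - j y z‖ ∂ν ≤ C * ‖x - y‖ := by
  obtain ⟨C, hC, h⟩ := hA.lip δ hδ
  exact ⟨C, hC.le, fun x y => integrableOn_of_lintegral_ofReal_le
    ((hA.meas x).sub (hA.meas y)).norm (fun z => by positivity) (by positivity)
    (h x y).2⟩

/-- The increment of the doubled function `μ u(x) - v(y)` under the jump `z`. -/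
def dblIncr (j : Space N → Space N → Space N) (μ : ℝ) (u v : Space N → ℝ) (x y z : Space N) : ℝ :=
  μ * (u (x + j x z) - u x) - (v (y + j y z) - v y)

/-- For jumps in `B_δ` beyond `B_δ'`, maximality bounds the compensated increments by `k |j(x,z) -
j(y,z)|² + κ |j(x,z)|²`. For larger jumps the increments are kept, and only the compensators in the
unit ball are estimated. By (J2) the errors due to doubling are multiples of `k |x - y|²`, the
quantity that the penalisation makes small; no bound depends on `δ'`. -/
theorem doubled_levyIto_le (hA : Admissible ν j Cj α) {u v : Space N → ℝ} (hu : Continuous u)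
    (hv : Continuous v) {U : ℝ} (hU : ∀ x, |u x| ≤ U) (hV : ∀ x, |v x| ≤ U)
    {μ k κ ρ δ δ' C₁ C₂ : ℝ} {x y xb : Space N} (hμ : 0 < μ) (hk : 0 ≤ k) (hκ : 0 ≤ κ)
    (hδ' : 0 < δ') (hδδ : δ' ≤ δ) (hδ1 : δ ≤ 1) (hδρ : Cj * δ ≤ ρ)
    (hmax : ∀ x' y', ‖x' - x‖ ≤ ρ → ‖y' - y‖ ≤ ρ →
      μ * u x' - v y' - κ * ‖x' - xb‖ ^ 2 - k * ‖x' - y'‖ ^ 2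
        ≤ μ * u x - v y - κ * ‖x - xb‖ ^ 2 - k * ‖x - y‖ ^ 2)
    (hC₁ : IntegrableOn (fun z => ‖j x z - j y z‖ ^ 2) (Metric.ball 0 1) ν ∧
      ∫ z in Metric.ball 0 1, ‖j x z - j y z‖ ^ 2 ∂ν ≤ C₁ * ‖x - y‖ ^ 2)
    (hC₂ : IntegrableOn (fun z => ‖j x z - j y z‖) (Metric.ball 0 1 \ Metric.ball 0 δ) ν ∧
      ∫ z in Metric.ball 0 1 \ Metric.ball 0 δ, ‖j x z - j y z‖ ∂ν ≤ C₂ * ‖x - y‖) :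
    μ * levyIto ν j (Metric.ball 0 δ')ᶜ u x (μ⁻¹ • ((2 * k) • (x - y) + (2 * κ) • (x - xb)))
      - levyIto ν j (Metric.ball 0 δ')ᶜ v y ((2 * k) • (x - y))
    ≤ ∫ z in (Metric.ball 0 δ)ᶜ, dblIncr j μ u v x y z ∂ν
      + C₁ * (k * ‖x - y‖ ^ 2) + κ * smallMass ν Cj 1 + 2 * C₂ * (k * ‖x - y‖ ^ 2)
      + 2 * κ * ‖x - xb‖ * Cj * (ν (Metric.ball 0 δ)ᶜ).toReal := by
  have hδ : 0 < δ := hδ'.trans_le hδδ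
  set p := (2 * k) • (x - y) with hp
  set q := (2 * κ) • (x - xb) with hq
  have hiu := hA.integrableOn_incr hu hU x (μ⁻¹ • (p + q)) hδ'
  have hiv := hA.integrableOn_incr hv hV y p hδ'
  have hi : IntegrableOn (fun z => μ * incr j u x (μ⁻¹ • (p + q)) z - incr j v y p z)
      (Metric.ball 0 δ')ᶜ ν := (hiu.const_mul μ).sub hiv
  have e1 : μ * levyIto ν j (Metric.ball 0 δ')ᶜ u x (μ⁻¹ • (p + q))
      - levyIto ν j (Metric.ball 0 δ')ᶜ v y p
      = ∫ z in (Metric.ball 0 δ')ᶜ, (μ * incr j u x (μ⁻¹ • (p + q)) z - incr j v y p z) ∂ν := by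
    rw [levyIto_eq_incr, levyIto_eq_incr, integral_sub (hiu.const_mul μ) hiv, integral_const_mul]
  rw [e1, Admissible.integral_compl_ball_split hδδ hi]
  have hpt : ∀ z, μ * incr j u x (μ⁻¹ • (p + q)) z - incr j v y p z = dblIncr j μ u v x y z
      - (Metric.ball (0 : Space N) 1).indicator
        (fun z => inner ℝ p (j x z - j y z) + inner ℝ q (j x z)) z := by
    intro z
    unfold incr dblIncr
    by_cases hz : z ∈ Metric.ball (0 : Space N) 1
    · simp only [indicator_of_mem hz, inner_smul_left, inner_add_left, inner_sub_right]
      simp only [map_inv₀, conj_trivial]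
      field_simp
      ring
    · simp only [indicator_of_notMem hz]; ring
  have hann : ∫ z in Metric.ball 0 δ \ Metric.ball 0 δ',
      (μ * incr j u x (μ⁻¹ • (p + q)) z - incr j v y p z) ∂ν
      ≤ C₁ * (k * ‖x - y‖ ^ 2) + κ * smallMass ν Cj 1 := by
    have hsub : Metric.ball (0 : Space N) δ \ Metric.ball 0 δ' ⊆ Metric.ball 0 1 :=
      sdiff_subset.trans (Metric.ball_subset_ball hδ1)
    have i1 := (hC₁.1.mono_set hsub).const_mul k
    have i2 := ((hA.integrableOn_jump_sq x le_rfl).mono_set hsub).const_mul κ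
    calc ∫ z in Metric.ball 0 δ \ Metric.ball 0 δ',
          (μ * incr j u x (μ⁻¹ • (p + q)) z - incr j v y p z) ∂ν
        ≤ ∫ z in Metric.ball 0 δ \ Metric.ball 0 δ',
          (k * ‖j x z - j y z‖ ^ 2 + κ * ‖j x z‖ ^ 2) ∂ν := by
          refine setIntegral_mono_on (hi.mono_set fun z hz => hz.2) (i1.add i2)
            (measurableSet_ball.diff measurableSet_ball) fun z hz => ?_
          rw [hpt, indicator_of_mem (hsub hz)]
          have hj1 : ‖x + j x z - x‖ ≤ ρ := by
            rw [add_sub_cancel_left]; exact (hA.norm_lt hz.1 x).trans hδρ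
          have hj2 : ‖y + j y z - y‖ ≤ ρ := by
            rw [add_sub_cancel_left]; exact (hA.norm_lt hz.1 y).trans hδρ
          -- After both squares are expanded, the first-order terms are exactly the compensators
          -- with gradients `p` and `q`.
          have hm := hmax _ _ hj1 hj2
          have n1 : ‖x + j x z - (y + j y z)‖ ^ 2
              = ‖x - y‖ ^ 2 + 2 * inner ℝ (x - y) (j x z - j y z) + ‖j x z - j y z‖ ^ 2 := by
            rw [← norm_add_sq_real]; congr 2; abel
          have n2 : ‖x + j x z - xb‖ ^ 2
              = ‖x - xb‖ ^ 2 + 2 * inner ℝ (x - xb) (j x z) + ‖j x z‖ ^ 2 := by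
            rw [← norm_add_sq_real]; congr 2; abel
          rw [n1, n2] at hm
          simp only [hp, hq, inner_smul_left, conj_trivial]
          unfold dblIncr
          linarith
      _ = k * ∫ z in Metric.ball 0 δ \ Metric.ball 0 δ', ‖j x z - j y z‖ ^ 2 ∂ν
          + κ * ∫ z in Metric.ball 0 δ \ Metric.ball 0 δ', ‖j x z‖ ^ 2 ∂ν := by
          rw [integral_add i1 i2, integral_const_mul, integral_const_mul]
      _ ≤ k * (C₁ * ‖x - y‖ ^ 2) + κ * smallMass ν Cj 1 := by
          gcongr
          · exact (setIntegral_mono_set hC₁.1 (Eventually.of_forall fun z => by positivity)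
              hsub.eventuallyLE).trans hC₁.2
          · exact hA.integral_jump_sq_le x le_rfl hsub
      _ = _ := by ring
  have hout : ∫ z in (Metric.ball 0 δ)ᶜ,
      (μ * incr j u x (μ⁻¹ • (p + q)) z - incr j v y p z) ∂ν
      ≤ ∫ z in (Metric.ball 0 δ)ᶜ, dblIncr j μ u v x y z ∂ν + 2 * C₂ * (k * ‖x - y‖ ^ 2)
        + 2 * κ * ‖x - xb‖ * Cj * (ν (Metric.ball 0 δ)ᶜ).toReal := by
    have hfin : ν (Metric.ball (0 : Space N) δ)ᶜ ≠ ⊤ := (hA.tail δ hδ).ne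
    have hdbl : IntegrableOn (dblIncr j μ u v x y) (Metric.ball 0 δ)ᶜ ν := by
      refine Measure.integrableOn_of_bounded (M := μ * (2 * U) + 2 * U) hfin ?_
        (Eventually.of_forall fun z => ?_)
      · have := hA.meas x
        have := hA.meas y
        have := hu.measurable
        have := hv.measurable
        refine Measurable.aestronglyMeasurable ?_
        unfold dblIncr
        fun_prop
      · have a1 := abs_le.1 (hU (x + j x z))
        have a2 := abs_le.1 (hU x)
        have a3 := abs_le.1 (hV (y + j y z))
        have a4 := abs_le.1 (hV y)
        have a5 : |u (x + j x z) - u x| ≤ 2 * U := by rw [abs_le]; constructor <;> linarith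
        have a6 : |v (y + j y z) - v y| ≤ 2 * U := by rw [abs_le]; constructor <;> linarith
        refine (norm_sub_le _ _).trans ?_
        rw [norm_mul, Real.norm_of_nonneg hμ.le]
        exact add_le_add (mul_le_mul_of_nonneg_left a5 hμ.le) a6
    have hset : (Metric.ball (0 : Space N) δ)ᶜ ∩ Metric.ball 0 1
        = Metric.ball 0 1 \ Metric.ball 0 δ := by
      ext z; simp [and_comm]
    have i3 : IntegrableOn ((Metric.ball (0 : Space N) 1).indicator
        fun z => ‖p‖ * ‖j x z - j y z‖) (Metric.ball 0 δ)ᶜ ν := by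
      rw [integrableOn_indicator_iff measurableSet_ball, inter_comm, hset]
      exact hC₂.1.const_mul _
    have i4 : IntegrableOn (fun _ : Space N => ‖q‖ * Cj) (Metric.ball 0 δ)ᶜ ν :=
      integrableOn_const hfin
    have i5 : IntegrableOn (fun z => dblIncr j μ u v x y z + (Metric.ball (0 : Space N) 1).indicator
        (fun z => ‖p‖ * ‖j x z - j y z‖) z) (Metric.ball 0 δ)ᶜ ν := hdbl.add i3
    calc ∫ z in (Metric.ball 0 δ)ᶜ, (μ * incr j u x (μ⁻¹ • (p + q)) z - incr j v y p z) ∂ν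
        ≤ ∫ z in (Metric.ball 0 δ)ᶜ, (dblIncr j μ u v x y z + (Metric.ball (0 : Space N) 1).indicator
            (fun z => ‖p‖ * ‖j x z - j y z‖) z + ‖q‖ * Cj) ∂ν := by
          refine setIntegral_mono (hi.mono_set (compl_subset_compl.2
            (Metric.ball_subset_ball hδδ))) (i5.add i4) fun z => ?_
          simp only [hpt]
          by_cases hz : z ∈ Metric.ball (0 : Space N) 1
          · simp only [indicator_of_mem hz]
            have b1 := (abs_le.1 (abs_real_inner_le_norm p (j x z - j y z))).1
            have b2 := (abs_le.1 (abs_real_inner_le_norm q (j x z))).1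
            have b3 : ‖q‖ * ‖j x z‖ ≤ ‖q‖ * Cj :=
              mul_le_mul_of_nonneg_left (by simpa using hA.norm_lt hz x) (norm_nonneg _)
            linarith
          · simp only [indicator_of_notMem hz]
            have : 0 ≤ ‖q‖ * Cj := mul_nonneg (norm_nonneg _) hA.pos.le
            linarith
      _ = ∫ z in (Metric.ball 0 δ)ᶜ, dblIncr j μ u v x y z ∂ν
          + ‖p‖ * ∫ z in Metric.ball 0 1 \ Metric.ball 0 δ, ‖j x z - j y z‖ ∂ν
          + ‖q‖ * Cj * (ν (Metric.ball 0 δ)ᶜ).toReal := by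
          rw [integral_add i5 i4, integral_add hdbl i3,
            setIntegral_indicator measurableSet_ball, hset, integral_const_mul, setIntegral_const,
            smul_eq_mul, mul_comm (‖q‖ * Cj)]
          rfl
      _ ≤ ∫ z in (Metric.ball 0 δ)ᶜ, dblIncr j μ u v x y z ∂ν
          + ‖p‖ * (C₂ * ‖x - y‖) + ‖q‖ * Cj * (ν (Metric.ball 0 δ)ᶜ).toReal := by
          gcongr
          exact hC₂.2
      _ = _ := by
          rw [hp, hq, norm_smul, norm_smul, Real.norm_of_nonneg (by positivity : 0 ≤ 2 * k),
            Real.norm_of_nonneg (by positivity : 0 ≤ 2 * κ)]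
          ring
  linarith

/-- The structural conditions on the Hamiltonian, with named constants. -/
structure HamCond (H : Space N → Space N → ℝ) (m A b₀ : ℝ) (ζ₁ ζ₂ : ℝ → ℝ) : Prop where
  one_lt : 1 < m
  A_pos : 0 < A
  b_pos : 0 < b₀
  mod₁ : IsModulus ζ₁
  mod₂ : IsModulus ζ₂
  mod₂' : Tendsto (fun s : ℝ => ζ₂ s * s ^ ((1 - m) / m)) (𝓝[>] 0) (𝓝 0)
  cont : Continuous (fun q : Space N × Space N => H q.1 q.2)
  h0 : CondH0 H
  h1 : CondH1 m ζ₁ ζ₂ H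
  h2 : ∀ μ ∈ Ioo (0 : ℝ) 1, ∀ x p : Space N,
    H x p - μ * H x (μ⁻¹ • p) ≤ (1 - μ) * (b₀ * (1 - m) * ‖p‖ ^ m + A)

/-- Periodic solutions, continuous on `ℝ^N × [0, ∞)`, in terms of quadratic expansions. -/
structure Sol (ν : Measure (Space N)) (j : Space N → Space N → Space N) (Cj : ℝ)
    (H : Space N → Space N → ℝ) (u : Space N → ℝ → ℝ) : Prop where
  periodic : ∀ t : ℝ, 0 ≤ t → Periodic (fun x => u x t)
  cont : ContinuousOn (fun q : Space N × ℝ => u q.1 q.2) (univ ×ˢ Ici 0)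
  sub : JetSub ν j Cj H u
  sup : JetSub ν j Cj (negHam H) (fun x t => -u x t)

/-- Every lattice orbit meets every ball of radius `D`. Suprema of periodic functions are thereby
reduced to compact balls. -/
theorem exists_lattice_norm_le (N : ℕ) :
    ∃ D : ℝ, 0 < D ∧ ∀ x y : Space N, ∃ k : Fin N → ℤ, ‖y + lattice k - x‖ ≤ D := by
  refine ⟨Real.sqrt N + 1, by positivity, fun x y => ⟨fun i => -⌊y i - x i⌋, ?_⟩⟩
  have h1 : ‖y + lattice (fun i => -⌊y i - x i⌋) - x‖ ≤ Real.sqrt N := by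
    rw [EuclideanSpace.norm_eq]
    refine Real.sqrt_le_sqrt ?_
    calc ∑ i, ‖(y + lattice (fun i => -⌊y i - x i⌋) - x) i‖ ^ 2 ≤ ∑ _i : Fin N, (1 : ℝ) := by
          refine Finset.sum_le_sum fun i _ => ?_
          have e : (y + lattice (fun i => -⌊y i - x i⌋) - x) i = Int.fract (y i - x i) := by
            simp only [lattice, PiLp.sub_apply, PiLp.add_apply, Int.cast_neg, Int.fract]
            ring
          rw [e, Real.norm_of_nonneg (Int.fract_nonneg _)]
          have := Int.fract_lt_one (y i - x i)
          have := Int.fract_nonneg (y i - x i)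
          nlinarith
      _ = N := by simp
  linarith

theorem Sol.cont_slice {u : Space N → ℝ → ℝ} (hu : Sol ν j Cj H u) {t : ℝ} (ht : 0 ≤ t) :
    Continuous (fun x => u x t) := by
  rw [← continuousOn_univ]
  exact hu.cont.comp (f := fun x : Space N => (x, t)) (by fun_prop) fun x _ => ⟨mem_univ _, ht⟩

theorem Sol.bounded {u : Space N → ℝ → ℝ} (hu : Sol ν j Cj H u) (T : ℝ) :
    ∃ U, 0 ≤ U ∧ ∀ x, ∀ t ∈ Icc 0 T, |u x t| ≤ U := by
  obtain ⟨D, hD, hlat⟩ := exists_lattice_norm_le N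
  obtain ⟨C, hC⟩ := ((isCompact_closedBall (0 : Space N) D).prod
    (isCompact_Icc (a := (0 : ℝ)) (b := T))).exists_bound_of_continuousOn
    (hu.cont.mono fun q hq => ⟨mem_univ _, hq.2.1⟩)
  refine ⟨max C 0, le_max_right _ _, fun x t ht => ?_⟩
  obtain ⟨k, hk⟩ := hlat 0 x
  have h1 := hC (x + lattice k, t) ⟨by simpa using hk, ht⟩
  have h2 := hu.periodic t ht.1 k x
  simp only at h1 h2
  rw [h2] at h1
  exact h1.trans (le_max_left _ _)

/-- With `s = c λ` the expression equals `c^(m-1) (ζ(s) s^((1-m)/m))^m`, so the decay assumed of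
`ζ₂` at `0` is exactly what makes the Young remainder vanish. -/
theorem tendsto_young_term {m c : ℝ} {ζ : ℝ → ℝ} (hm : 1 < m) (hc : 0 < c) (hζ : IsModulus ζ)
    (h : Tendsto (fun s : ℝ => ζ s * s ^ ((1 - m) / m)) (𝓝[>] 0) (𝓝 0)) :
    Tendsto (fun lam : ℝ => ζ (c * lam) * (ζ (c * lam) / lam) ^ (m - 1)) (𝓝[>] 0) (𝓝 0) := by
  have hm0 : 0 < m := by linarith
  have h1 : Tendsto (fun lam : ℝ => c * lam) (𝓝[>] 0) (𝓝[>] 0) := by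
    refine tendsto_nhdsWithin_iff.2 ⟨?_, ?_⟩
    · simpa using ((continuous_const_mul c).tendsto 0).mono_left
        (nhdsWithin_le_nhds (s := Ioi (0 : ℝ)))
    · filter_upwards [self_mem_nhdsWithin] with x hx using mul_pos hc hx
  have h2 := ((h.comp h1).rpow_const (p := m) (Or.inr hm0.le)).mul_const (c ^ (m - 1))
  rw [Real.zero_rpow hm0.ne', zero_mul] at h2
  refine h2.congr' ?_
  filter_upwards [self_mem_nhdsWithin] with lam hlam
  have hlam : 0 < lam := hlam
  have hz : 0 ≤ ζ (c * lam) := hζ.nonneg (by positivity)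
  simp only [Function.comp]
  rw [Real.mul_rpow hz (by positivity), ← Real.rpow_mul (by positivity),
    div_mul_cancel₀ _ hm0.ne', Real.div_rpow hz hlam.le, Real.mul_rpow hc.le hlam.le]
  have e1 : ζ (c * lam) ^ m = ζ (c * lam) * ζ (c * lam) ^ (m - 1) := by
    rw [← Real.rpow_one_add' hz (by linarith)]; ring_nf
  have e2 : c ^ (1 - m) * c ^ (m - 1) = 1 := by
    rw [← Real.rpow_add hc]; simp
  have e3 : lam ^ (1 - m) = (lam ^ (m - 1))⁻¹ := by
    rw [← Real.rpow_neg hlam.le]; ring_nf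
  rw [e1, e3, div_eq_mul_inv]
  linear_combination (ζ (c * lam) * ζ (c * lam) ^ (m - 1) * (lam ^ (m - 1))⁻¹) * e2

theorem IsModulus.tendsto_mul {ζ : ℝ → ℝ} (hζ : IsModulus ζ) {c : ℝ} (hc : 0 ≤ c) :
    Tendsto (fun lam : ℝ => ζ (c * lam)) (𝓝[>] 0) (𝓝 0) := by
  refine hζ.2.2.comp (tendsto_nhdsWithin_iff.2 ⟨?_, ?_⟩)
  · simpa using ((continuous_const_mul c).tendsto 0).mono_left
      (nhdsWithin_le_nhds (s := Ioi (0 : ℝ)))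
  · filter_upwards [self_mem_nhdsWithin] with x hx using mul_nonneg hc (le_of_lt hx)

/-- The two viscosity inequalities at a maximum point of the doubled function. -/
theorem doubled_viscosity {u v : Space N → ℝ → ℝ} (hu : JetSub ν j Cj H u)
    (hv : JetSub ν j Cj (negHam H) (fun x t => -v x t)) {θ θ' : ℝ → ℝ} {Cθ : ℝ} (hCθ : 0 ≤ Cθ)
    (hθ : ∀ s t, θ t ≤ θ s + θ' s * (t - s) + Cθ * (t - s) ^ 2)
    {μ k κ ρ t s tb : ℝ} {x y xb : Space N} (hμ : 0 < μ) (hk : 0 < k) (hκ : 0 < κ) (hρ : 0 < ρ)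
    (ht : ρ < t) (hs : ρ < s)
    (hPhi : ∀ x' y' t' s', ‖x' - x‖ ≤ ρ → ‖y' - y‖ ≤ ρ → |t' - t| ≤ ρ → |s' - s| ≤ ρ →
      μ * u x' t' - θ t' - κ * (‖x' - xb‖ ^ 2 + (t' - tb) ^ 2) - v y' s'
        - k * (‖x' - y'‖ ^ 2 + (t' - s') ^ 2) ≤
      μ * u x t - θ t - κ * (‖x - xb‖ ^ 2 + (t - tb) ^ 2) - v y s
        - k * (‖x - y‖ ^ 2 + (t - s) ^ 2))
    {δ : ℝ} (hδ : 0 < δ) (hδ1 : δ ≤ 1) (hδρ : Cj * δ ≤ ρ / 2) :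
    θ' t + 2 * κ * (t - tb) + μ * H x (μ⁻¹ • ((2 * k) • (x - y) + (2 * κ) • (x - xb)))
      ≤ μ * levyIto ν j (Metric.ball 0 δ)ᶜ (fun x => u x t) x
          (μ⁻¹ • ((2 * k) • (x - y) + (2 * κ) • (x - xb)))
        - levyIto ν j (Metric.ball 0 δ)ᶜ (fun x => v x s) y ((2 * k) • (x - y))
        + H y ((2 * k) • (x - y)) + (κ + 2 * k) * smallMass ν Cj δ := by
  have e0x : ‖x - x‖ ≤ ρ := by simpa using hρ.le
  have e0y : ‖y - y‖ ≤ ρ := by simpa using hρ.le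
  have e0t : |t - t| ≤ ρ := by simpa using hρ.le
  have e0s : |s - s| ≤ ρ := by simpa using hρ.le
  have hμi : 0 < μ⁻¹ := inv_pos.2 hμ
  -- Freezing `(y, s)` gives an expansion of `u` at `(x, t)`; freezing `(x, t)` gives one of `-v` at
  -- `(y, s)`. The time slopes `± 2k (t - s)` cancel when the two inequalities are added.
  have hjetu := hu x (μ⁻¹ • ((2 * k) • (x - y) + (2 * κ) • (x - xb))) t
    (μ⁻¹ * (θ' t + 2 * κ * (t - tb) + 2 * k * (t - s)))
    (μ⁻¹ * (κ + k)) (μ⁻¹ * (Cθ + κ + k)) ρ (by positivity) (by positivity) hρ ht (by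
      intro x' t' hx' ht'
      have h1 := hPhi x' y t' s hx' e0y ht' e0s
      have h2 := hθ t t'
      have n1 : ‖x' - xb‖ ^ 2
          = ‖x - xb‖ ^ 2 + 2 * inner ℝ (x - xb) (x' - x) + ‖x' - x‖ ^ 2 := by
        rw [← norm_add_sq_real]; congr 2; abel
      have n2 : ‖x' - y‖ ^ 2
          = ‖x - y‖ ^ 2 + 2 * inner ℝ (x - y) (x' - x) + ‖x' - x‖ ^ 2 := by
        rw [← norm_add_sq_real]; congr 2; abel
      have n3 : (t' - tb) ^ 2 = (t - tb) ^ 2 + 2 * (t - tb) * (t' - t) + (t' - t) ^ 2 := by ring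
      have n4 : (t' - s) ^ 2 = (t - s) ^ 2 + 2 * (t - s) * (t' - t) + (t' - t) ^ 2 := by ring
      rw [n1, n2, n3, n4] at h1
      simp only [inner_add_left, inner_smul_left, conj_trivial]
      rw [← mul_le_mul_iff_right₀ hμ]
      have e : ∀ a b c d e f : ℝ, μ * (a + μ⁻¹ * b + μ⁻¹ * c * d + μ⁻¹ * e * f
          + μ⁻¹ * (Cθ + κ + k) * d ^ 2) = μ * a + b + c * d + e * f + (Cθ + κ + k) * d ^ 2 := by
        intro a b c d e f; field_simp
      rw [e]
      linarith)
  have hjetv := hv y (-((2 * k) • (x - y))) s (-(2 * k * (t - s))) k k ρ hk.le hk.le hρ hs (by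
      intro y' s' hy' hs'
      have h1 := hPhi x y' t s' e0x hy' e0t hs'
      have n2 : ‖x - y'‖ ^ 2
          = ‖x - y‖ ^ 2 - 2 * inner ℝ (x - y) (y' - y) + ‖y' - y‖ ^ 2 := by
        rw [← norm_sub_sq_real]; congr 2; abel
      have n4 : (t - s') ^ 2 = (t - s) ^ 2 - 2 * (t - s) * (s' - s) + (s' - s) ^ 2 := by ring
      rw [n2, n4] at h1
      simp only [inner_neg_left, inner_smul_left, conj_trivial]
      linarith)
  have h1 := mul_le_mul_of_nonneg_left (hjetu δ hδ hδ1 hδρ) hμ.le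
  have h2 := hjetv δ hδ hδ1 hδρ
  rw [levyIto_neg, negHam, neg_neg] at h2
  have e : ∀ a h I σ : ℝ, μ * (μ⁻¹ * a + h) ≤ μ * (I + μ⁻¹ * (κ + k) * σ) →
      a + μ * h ≤ μ * I + (κ + k) * σ := by
    intro a h I σ hh
    have e1 : μ * (μ⁻¹ * a + h) = a + μ * h := by field_simp
    have e2 : μ * (I + μ⁻¹ * (κ + k) * σ) = μ * I + (κ + k) * σ := by field_simp
    rwa [e1, e2] at hh
  have h3 := e _ _ _ _ h1
  linarith

/-- The inequality at a maximum point of the doubled function `(1 - λ) u(x,t) - v(y,s) - …`. -/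
theorem doubled_estimate {m A b₀ : ℝ} {ζ₁ ζ₂ : ℝ → ℝ} (hA : Admissible ν j Cj α)
    (hH : HamCond H m A b₀ ζ₁ ζ₂) {u v : Space N → ℝ → ℝ} (hu : JetSub ν j Cj H u)
    (hv : JetSub ν j Cj (negHam H) (fun x t => -v x t)) {θ θ' : ℝ → ℝ} {Cθ : ℝ} (hCθ : 0 ≤ Cθ)
    (hθ : ∀ s t, θ t ≤ θ s + θ' s * (t - s) + Cθ * (t - s) ^ 2)
    {lam k κ r t s tb U δ C₁ C₂ : ℝ} {x y xb : Space N} (hlam : lam ∈ Ioo (0 : ℝ) 1) (hk : 0 < k)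
    (hκ : 0 < κ) (hr : 0 < r) (ht : r / 2 < t) (hs : r / 2 < s)
    (hPhi : ∀ x' y' t' s', ‖x' - x‖ ≤ r / 2 → ‖y' - y‖ ≤ r / 2 → |t' - t| ≤ r / 2 →
      |s' - s| ≤ r / 2 →
      (1 - lam) * u x' t' - θ t' - κ * (‖x' - xb‖ ^ 2 + (t' - tb) ^ 2) - v y' s'
        - k * (‖x' - y'‖ ^ 2 + (t' - s') ^ 2) ≤
      (1 - lam) * u x t - θ t - κ * (‖x - xb‖ ^ 2 + (t - tb) ^ 2) - v y s
        - k * (‖x - y‖ ^ 2 + (t - s) ^ 2))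
    (huc : Continuous fun x => u x t) (hvc : Continuous fun x => v x s)
    (hUu : ∀ x, |u x t| ≤ U) (hUv : ∀ x, |v x s| ≤ U)
    (hδ : 0 < δ) (hδ1 : δ ≤ 1) (hδr : Cj * δ ≤ r / 4) (hC₁0 : 0 ≤ C₁) (hC₂0 : 0 ≤ C₂)
    (hC₁ : IntegrableOn (fun z => ‖j x z - j y z‖ ^ 2) (Metric.ball 0 1) ν ∧
      ∫ z in Metric.ball 0 1, ‖j x z - j y z‖ ^ 2 ∂ν ≤ C₁ * ‖x - y‖ ^ 2)
    (hC₂ : IntegrableOn (fun z => ‖j x z - j y z‖) (Metric.ball 0 1 \ Metric.ball 0 δ) ν ∧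
      ∫ z in Metric.ball 0 1 \ Metric.ball 0 δ, ‖j x z - j y z‖ ∂ν ≤ C₂ * ‖x - y‖)
    (hz₁ : ζ₁ ‖x - y‖ ≤ lam) (hz₂ : ζ₁ ‖x - y‖ ≤ lam * (b₀ * (m - 1) / 2))
    (hxr : ‖x - xb‖ ≤ r) (hpen : k * ‖x - y‖ ^ 2 ≤ lam) :
    θ' t + 2 * κ * (t - tb) ≤
      ∫ z in (Metric.ball 0 δ)ᶜ, dblIncr j (1 - lam) (fun x => u x t) (fun x => v x s) x y z ∂ν
      + C₁ * lam + κ * smallMass ν Cj 1 + 2 * C₂ * lam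
      + 2 * κ * r * Cj * (ν (Metric.ball (0 : Space N) δ)ᶜ).toReal + lam * (A + 1) + ζ₂ (2 * κ * r)
      + (2 / (b₀ * (m - 1))) ^ (m - 1)
        * (ζ₂ (2 * κ * r) * (ζ₂ (2 * κ * r) / lam) ^ (m - 1)) := by
  have hm := hH.one_lt
  have hb : 0 < b₀ * (m - 1) := mul_pos hH.b_pos (by linarith)
  have hμ0 : 0 < 1 - lam := by linarith [hlam.2]
  have hmaxx : ∀ x' y', ‖x' - x‖ ≤ r / 4 → ‖y' - y‖ ≤ r / 4 →
      (1 - lam) * u x' t - v y' s - κ * ‖x' - xb‖ ^ 2 - k * ‖x' - y'‖ ^ 2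
        ≤ (1 - lam) * u x t - v y s - κ * ‖x - xb‖ ^ 2 - k * ‖x - y‖ ^ 2 := by
    intro x' y' hx' hy'
    have := hPhi x' y' t s (by linarith) (by linarith) (by simp; linarith) (by simp; linarith)
    simp only [mul_add] at this
    linarith
  have hham := hamiltonian_doubling hm hH.b_pos hH.mod₂ hH.h1 hH.h2 (x := x) (y := y)
    (P := (2 * k) • (x - y) + (2 * κ) • (x - xb)) (q := (2 * κ) • (x - xb)) hlam hz₁ hz₂
  rw [add_sub_cancel_right] at hham
  have hqn : ‖(2 * κ) • (x - xb)‖ ≤ 2 * κ * r := by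
    rw [norm_smul, Real.norm_of_nonneg (by positivity)]
    gcongr
  have hζq := hH.mod₂.mono (norm_nonneg _) hqn
  have hζq0 := hH.mod₂.nonneg (norm_nonneg ((2 * κ) • (x - xb)))
  have hYq : (2 / (b₀ * (m - 1))) ^ (m - 1)
        * (ζ₂ ‖(2 * κ) • (x - xb)‖ * (ζ₂ ‖(2 * κ) • (x - xb)‖ / lam) ^ (m - 1))
      ≤ (2 / (b₀ * (m - 1))) ^ (m - 1)
        * (ζ₂ (2 * κ * r) * (ζ₂ (2 * κ * r) / lam) ^ (m - 1)) := by
    have hl := hlam.1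
    have : (ζ₂ ‖(2 * κ) • (x - xb)‖ / lam) ^ (m - 1) ≤ (ζ₂ (2 * κ * r) / lam) ^ (m - 1) :=
      Real.rpow_le_rpow (by positivity) (by gcongr) (by linarith)
    refine mul_le_mul_of_nonneg_left ?_ (by positivity)
    exact mul_le_mul hζq this (by positivity) (hζq0.trans hζq)
  have h4 : C₁ * (k * ‖x - y‖ ^ 2) ≤ C₁ * lam := mul_le_mul_of_nonneg_left hpen hC₁0
  have h5 : 2 * C₂ * (k * ‖x - y‖ ^ 2) ≤ 2 * C₂ * lam :=
    mul_le_mul_of_nonneg_left hpen (by positivity)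
  have h6 : 2 * κ * ‖x - xb‖ * Cj * (ν (Metric.ball (0 : Space N) δ)ᶜ).toReal
      ≤ 2 * κ * r * Cj * (ν (Metric.ball (0 : Space N) δ)ᶜ).toReal := by
    have := hA.pos
    gcongr
  -- The viscosity inequalities are used with an auxiliary radius `δ' → 0` while `k`, `κ` and `δ`
  -- stay fixed; the quadratic bound on the smallest jumps then disappears.
  have hl := (hA.tendsto_smallMass.const_mul (κ + 2 * k)).const_add
    (∫ z in (Metric.ball 0 δ)ᶜ, dblIncr j (1 - lam) (fun x => u x t) (fun x => v x s) x y z ∂ν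
      + C₁ * lam + κ * smallMass ν Cj 1 + 2 * C₂ * lam
      + 2 * κ * r * Cj * (ν (Metric.ball (0 : Space N) δ)ᶜ).toReal + lam * (A + 1) + ζ₂ (2 * κ * r)
      + (2 / (b₀ * (m - 1))) ^ (m - 1)
        * (ζ₂ (2 * κ * r) * (ζ₂ (2 * κ * r) / lam) ^ (m - 1)))
  rw [mul_zero, add_zero] at hl
  refine ge_of_tendsto hl ?_
  filter_upwards [Ioc_mem_nhdsGT hδ] with δ' hδ'
  have hδ'r : Cj * δ' ≤ r / 2 / 2 := by
    have := mul_le_mul_of_nonneg_left hδ'.2 hA.pos.le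
    linarith
  have h1 := doubled_viscosity hu hv hCθ hθ hμ0 hk hκ (half_pos hr) ht hs hPhi hδ'.1
    (hδ'.2.trans hδ1) hδ'r
  have h3 := doubled_levyIto_le hA huc hvc hUu hUv hμ0 hk.le hκ.le hδ'.1 hδ'.2 hδ1 hδr hmaxx
    hC₁ hC₂
  linarith

-- The order of choice is `λ`, then `κ` proportional to `λ`, then `k`. Localisation at `(xb, tb)`
-- needs only `κ` of order `λ`, so the extra gradient `q` has size `O(λ)`, small enough for
-- `tendsto_young_term`.
set_option maxHeartbeats 400000 in
theorem doubling_step {m A b₀ : ℝ} {ζ₁ ζ₂ : ℝ → ℝ} (hA : Admissible ν j Cj α)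
    (hH : HamCond H m A b₀ ζ₁ ζ₂) {u v : Space N → ℝ → ℝ} (hu : Sol ν j Cj H u)
    (hv : Sol ν j Cj H v) {θ θ' : ℝ → ℝ} {Cθ : ℝ} (hCθ : 0 ≤ Cθ) (hθc : Continuous θ)
    (hθ : ∀ s t, θ t ≤ θ s + θ' s * (t - s) + Cθ * (t - s) ^ 2)
    {xb : Space N} {tb r : ℝ} (hr : 0 < r) (hrt : 4 * r ≤ tb)
    (hmax : ∀ x t, |t - tb| ≤ 2 * r → u x t - v x t - θ t ≤ u xb tb - v xb tb - θ tb)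
    {δ : ℝ} (hδ : 0 < δ) (hδ1 : δ ≤ 1) (hδr : Cj * δ ≤ r / 4) {η : ℝ} (hη : 0 < η) :
    ∃ (μ : ℝ) (x y : Space N) (t s : ℝ), |μ - 1| ≤ η ∧ 0 ≤ s ∧ ‖x - xb‖ ≤ r ∧ |t - tb| ≤ r ∧
      ‖x - y‖ ≤ η ∧ |t - s| ≤ η ∧ u xb tb - v xb tb - θ tb - η ≤ u x t - v x t - θ t ∧
      θ' t - η ≤ ∫ z in (Metric.ball 0 δ)ᶜ,
        dblIncr j μ (fun x => u x t) (fun x => v x s) x y z ∂ν := by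
  have hm := hH.one_lt
  obtain ⟨U₁, hU₁0, hU₁⟩ := hu.bounded (tb + 2 * r)
  obtain ⟨U₂, hU₂0, hU₂⟩ := hv.bounded (tb + 2 * r)
  set U := max U₁ U₂
  have hU0 : 0 ≤ U := hU₁0.trans (le_max_left _ _)
  have hU1 : U₁ ≤ U := le_max_left _ _
  have hU2 : U₂ ≤ U := le_max_right _ _
  clear_value U
  have hUu : ∀ x, ∀ t ∈ Icc 0 (tb + 2 * r), |u x t| ≤ U := fun x t ht =>
    (hU₁ x t ht).trans hU1
  have hUv : ∀ x, ∀ t ∈ Icc 0 (tb + 2 * r), |v x t| ≤ U := fun x t ht =>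
    (hU₂ x t ht).trans hU2
  obtain ⟨C₁, hC₁0, hC₁⟩ := hA.jump_sub_sq
  obtain ⟨C₂, hC₂0, hC₂⟩ := hA.jump_sub hδ
  -- With `κ = R λ`, the localising term at distance `r` costs `λ (2U + 1)`. This matches the loss
  -- from replacing `u` by `(1 - λ) u` at two points, at most `2 λ U`, plus `λ` from `v x t - v y
  -- s`.
  set R := (2 * U + 1) / r ^ 2 with hR
  have hR0 : 0 < R := by positivity
  have hRr : R * r ^ 2 = 2 * U + 1 := by rw [hR]; field_simp
  set c := 2 * R * r with hc
  have hc0 : 0 < c := by positivity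
  set B := (2 / (b₀ * (m - 1))) ^ (m - 1) with hB
  set S := smallMass ν Cj 1
  set V := (ν (Metric.ball (0 : Space N) δ)ᶜ).toReal
  have hb : 0 < b₀ * (m - 1) := mul_pos hH.b_pos (by linarith)
  have hB0 : 0 ≤ B := by positivity
  have hS0 : 0 ≤ S := smallMass_nonneg _ _ _
  have hV0 : 0 ≤ V := ENNReal.toReal_nonneg
  clear_value R c
  -- All errors, as a function of `λ` alone; it tends to `0`.
  let E : ℝ → ℝ := fun lam => lam * (2 * R * r + (A + 1) + C₁ + R * S + 2 * C₂ + 2 * R * r * Cj * V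
    + 2 * U + 1) + ζ₂ (c * lam) + B * (ζ₂ (c * lam) * (ζ₂ (c * lam) / lam) ^ (m - 1))
  have hE : Tendsto E (𝓝[>] 0) (𝓝 0) := by
    have l1 : Tendsto (fun lam : ℝ => lam * (2 * R * r + (A + 1) + C₁ + R * S + 2 * C₂
        + 2 * R * r * Cj * V + 2 * U + 1)) (𝓝[>] 0) (𝓝 0) := by
      have l0 : Tendsto (fun lam : ℝ => lam) (𝓝[>] 0) (𝓝 0) := nhdsWithin_le_nhds
      simpa using l0.mul_const
        (2 * R * r + (A + 1) + C₁ + R * S + 2 * C₂ + 2 * R * r * Cj * V + 2 * U + 1)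
    simpa using (l1.add (hH.mod₂.tendsto_mul hc0.le)).add
      ((tendsto_young_term hm hc0 hH.mod₂ hH.mod₂').const_mul B)
  obtain ⟨lam, hEη, hlam0, hlam1⟩ : ∃ lam, E lam ≤ η ∧ 0 < lam ∧ lam < min 1 η := by
    have := (hE.eventually_le_const hη).and (Ioo_mem_nhdsGT (lt_min one_pos hη))
    obtain ⟨lam, h1, h2⟩ := this.exists
    exact ⟨lam, h1, h2.1, h2.2⟩
  have hlam1' : lam < 1 := hlam1.trans_le (min_le_left _ _)
  have hlamη : lam < η := hlam1.trans_le (min_le_right _ _)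
  have hμ0 : 0 < 1 - lam := by linarith
  obtain ⟨κ, hκ⟩ : ∃ κ, κ = R * lam := ⟨_, rfl⟩
  have hκ0 : 0 < κ := by rw [hκ]; positivity
  obtain ⟨d, hd0, hd⟩ : ∃ d > 0, ∀ e ∈ Ico (0 : ℝ) d, ζ₁ e ≤ lam ∧ ζ₁ e ≤ lam * (b₀ * (m - 1) / 2) := by
    have hpos : 0 < min lam (lam * (b₀ * (m - 1) / 2)) := lt_min hlam0 (by positivity)
    have := hH.mod₁.2.2.eventually_le_const hpos
    obtain ⟨d, hd, hd'⟩ := mem_nhdsGE_iff_exists_Ico_subset.1 this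
    exact ⟨d, hd, fun e he => ⟨(hd' he).trans (min_le_left _ _), (hd' he).trans (min_le_right _ _)⟩⟩
  set K := Metric.closedBall xb (2 * r) ×ˢ Icc (tb - 2 * r) (tb + 2 * r) with hK
  have hKc : IsCompact K := (isCompact_closedBall _ _).prod isCompact_Icc
  have hKne : K.Nonempty :=
    ⟨(xb, tb), Metric.mem_closedBall_self (by linarith), by constructor <;> linarith⟩
  have hKt : ∀ X ∈ K, X.2 ∈ Icc 0 (tb + 2 * r) := fun X hX => ⟨by linarith [hX.2.1], hX.2.2⟩
  have hKsub : K ⊆ univ ×ˢ Ici 0 := fun X hX => ⟨mem_univ _, (hKt X hX).1⟩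
  have hKmem : ∀ x t, ‖x - xb‖ ≤ 2 * r → |t - tb| ≤ 2 * r → (x, t) ∈ K := fun x t hx ht =>
    ⟨by simpa [dist_eq_norm] using hx, by
      have := abs_le.1 ht; constructor <;> simp only <;> linarith⟩
  let g : Space N × ℝ → ℝ := fun X =>
    (1 - lam) * u X.1 X.2 - θ X.2 - κ * (‖X.1 - xb‖ ^ 2 + (X.2 - tb) ^ 2)
  have hg : ContinuousOn g K := by
    refine (((hu.cont.mono hKsub).const_mul (1 - lam)).sub (hθc.comp continuous_snd).continuousOn).sub
      (Continuous.continuousOn ?_)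
    fun_prop
  -- The tolerance makes the penalty at most `λ`, puts `|x - y|` in the range where `ζ₁` is
  -- controlled by `λ`, and keeps the maximum away from the boundary of `K`.
  obtain ⟨k, hk, ⟨x, t⟩, hX, ⟨y, s⟩, hY, hPhi, hxy, hts, hpen, hvv⟩ :=
    exists_doubling_max hKc hKne hg (hv.cont.mono hKsub)
      (lt_min (lt_min hlam0 (half_pos hd0)) (half_pos hr))
  simp only at hxy hts hpen hvv
  have hxy1 : ‖x - y‖ ≤ lam := hxy.trans ((min_le_left _ _).trans (min_le_left _ _))
  have hxy2 : ‖x - y‖ < d := by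
    have : ‖x - y‖ ≤ d / 2 := hxy.trans ((min_le_left _ _).trans (min_le_right _ _))
    linarith
  have hxy3 : ‖x - y‖ ≤ r / 2 := hxy.trans (min_le_right _ _)
  have hts1 : |t - s| ≤ lam := hts.trans ((min_le_left _ _).trans (min_le_left _ _))
  have hts3 : |t - s| ≤ r / 2 := hts.trans (min_le_right _ _)
  have hvv1 : v x t - v y s ≤ lam := hvv.trans ((min_le_left _ _).trans (min_le_left _ _))
  have htI := hKt _ hX
  have hsI := hKt _ hY
  simp only at htI hsI
  have hXt : |t - tb| ≤ 2 * r := by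
    have := hX.2; rw [abs_le]; constructor <;> linarith [this.1, this.2]
  have hkpen : 0 ≤ k * (‖x - y‖ ^ 2 + (t - s) ^ 2) := by positivity
  have hlow : u xb tb - v xb tb - θ tb - lam * U
      ≤ g (x, t) - v y s - k * (‖x - y‖ ^ 2 + (t - s) ^ 2) := by
    have h1 := hPhi (xb, tb) (hKmem _ _ (by simp; linarith) (by simp; linarith))
      (xb, tb) (hKmem _ _ (by simp; linarith) (by simp; linarith))
    simp only [g, sub_self, norm_zero] at h1 ⊢
    have h2 := (abs_le.1 (hUu xb tb ⟨by linarith, by linarith⟩)).2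
    have h3 : lam * u xb tb ≤ lam * U := mul_le_mul_of_nonneg_left h2 hlam0.le
    have h4 : (1 - lam) * u xb tb = u xb tb - lam * u xb tb := by ring
    linarith
  have hup : g (x, t) ≤ u x t - θ t + lam * U - κ * (‖x - xb‖ ^ 2 + (t - tb) ^ 2) := by
    have h2 := (abs_le.1 (hUu x t htI)).1
    have h3 : lam * (-U) ≤ lam * u x t := mul_le_mul_of_nonneg_left h2 hlam0.le
    have h4 : (1 - lam) * u x t = u x t - lam * u x t := by ring
    simp only [g]
    linarith
  have hnear : ‖x - xb‖ ^ 2 + (t - tb) ^ 2 ≤ r ^ 2 := by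
    have h1 := hmax x t hXt
    have h2 : κ * (‖x - xb‖ ^ 2 + (t - tb) ^ 2) ≤ κ * r ^ 2 := by
      have : κ * r ^ 2 = lam * (2 * U + 1) := by rw [hκ, ← hRr]; ring
      rw [this]
      linarith
    exact le_of_mul_le_mul_left h2 hκ0
  have hxr : ‖x - xb‖ ≤ r := (abs_le_of_sq_le_sq' (by linarith [sq_nonneg (t - tb)]) hr.le).2
  have htr : |t - tb| ≤ r := abs_le_of_sq_le_sq (by linarith [sq_nonneg ‖x - xb‖]) hr.le
  have hyr : ‖y - xb‖ ≤ 3 * r / 2 := by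
    calc ‖y - xb‖ = ‖(x - xb) - (x - y)‖ := by congr 1; abel
      _ ≤ ‖x - xb‖ + ‖x - y‖ := norm_sub_le _ _
      _ ≤ _ := by linarith
  have hsr : |s - tb| ≤ 3 * r / 2 := by
    have h1 := abs_le.1 htr
    have h2 := abs_le.1 hts3
    rw [abs_le]; constructor <;> linarith
  have hPhi' : ∀ x' y' t' s', ‖x' - x‖ ≤ r / 2 → ‖y' - y‖ ≤ r / 2 → |t' - t| ≤ r / 2 →
      |s' - s| ≤ r / 2 →
      (1 - lam) * u x' t' - θ t' - κ * (‖x' - xb‖ ^ 2 + (t' - tb) ^ 2) - v y' s'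
        - k * (‖x' - y'‖ ^ 2 + (t' - s') ^ 2) ≤
      (1 - lam) * u x t - θ t - κ * (‖x - xb‖ ^ 2 + (t - tb) ^ 2) - v y s
        - k * (‖x - y‖ ^ 2 + (t - s) ^ 2) := by
    intro x' y' t' s' hx' hy' ht' hs'
    refine hPhi (x', t') (hKmem _ _ ?_ ?_) (y', s') (hKmem _ _ ?_ ?_)
    · calc ‖x' - xb‖ = ‖(x' - x) + (x - xb)‖ := by congr 1; abel
        _ ≤ ‖x' - x‖ + ‖x - xb‖ := norm_add_le _ _
        _ ≤ _ := by linarith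
    · have h1 := abs_le.1 htr
      have h2 := abs_le.1 ht'
      rw [abs_le]; constructor <;> linarith
    · calc ‖y' - xb‖ = ‖(y' - y) + (y - xb)‖ := by congr 1; abel
        _ ≤ ‖y' - y‖ + ‖y - xb‖ := norm_add_le _ _
        _ ≤ _ := by linarith
    · have h1 := abs_le.1 hsr
      have h2 := abs_le.1 hs'
      rw [abs_le]; constructor <;> linarith
  have hr2 : 0 < r / 2 := half_pos hr
  have htb := (abs_le.1 htr).1
  have hsb := (abs_le.1 hsr).1
  have hpenlam : k * ‖x - y‖ ^ 2 ≤ lam := by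
    have : 0 ≤ k * (t - s) ^ 2 := by positivity
    linarith [mul_add k (‖x - y‖ ^ 2) ((t - s) ^ 2)]
  have hfin := doubled_estimate hA hH hu.sub hv.sup hCθ hθ ⟨hlam0, hlam1'⟩ hk hκ0 hr
    (show r / 2 < t by linarith) (show r / 2 < s by linarith) hPhi'
    (hu.cont_slice htI.1) (hv.cont_slice hsI.1) (fun x => hUu x t htI) (fun x => hUv x s hsI)
    hδ hδ1 hδr hC₁0 hC₂0 (hC₁ x y) (hC₂ x y) (hd _ ⟨norm_nonneg _, hxy2⟩).1
    (hd _ ⟨norm_nonneg _, hxy2⟩).2 hxr hpenlam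
  have hκr : 2 * κ * r = c * lam := by rw [hκ, hc]; ring
  have hκr' : κ * S = lam * (R * S) := by rw [hκ]; ring
  rw [hκr] at hfin
  have hpos : 0 ≤ lam * (2 * R * r + (A + 1) + C₁ + R * S + 2 * C₂ + 2 * R * r * Cj * V) := by
    have := hA.pos
    have := hH.A_pos
    refine mul_nonneg hlam0.le ?_
    positivity
  have hEdef : E lam = lam * (2 * R * r + (A + 1) + C₁ + R * S + 2 * C₂ + 2 * R * r * Cj * V
    + 2 * U + 1) + ζ₂ (c * lam) + B * (ζ₂ (c * lam) * (ζ₂ (c * lam) / lam) ^ (m - 1)) := rfl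
  have hz0 : 0 ≤ ζ₂ (c * lam) := hH.mod₂.nonneg (by positivity)
  have hY0 : 0 ≤ B * (ζ₂ (c * lam) * (ζ₂ (c * lam) / lam) ^ (m - 1)) := by positivity
  refine ⟨1 - lam, x, y, t, s, ?_, hsI.1, hxr, htr, hxy1.trans hlamη.le, hts1.trans hlamη.le, ?_, ?_⟩
  · rw [abs_le]; constructor <;> linarith
  · have h1 : 0 ≤ κ * (‖x - xb‖ ^ 2 + (t - tb) ^ 2) := by positivity
    have h2 : lam * (2 * U + 1) ≤ η := by
      refine le_trans ?_ hEη
      rw [hEdef]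
      linarith
    linarith
  · have h1 : -(2 * κ * (t - tb)) ≤ 2 * κ * r := by
      have : 2 * κ * (-r) ≤ 2 * κ * (t - tb) := mul_le_mul_of_nonneg_left htb (by positivity)
      linarith
    have h2 : 0 ≤ lam * (2 * U + 1) := by positivity
    rw [hEdef] at hEη
    rw [hκr] at h1
    have h3 : c * lam = lam * (2 * R * r) := by rw [hc]; ring
    have h4 : c * lam * Cj * V = lam * (2 * R * r * Cj * V) := by rw [hc]; ring
    change θ' t + 2 * κ * (t - tb) ≤ _ + C₁ * lam + κ * S + 2 * C₂ * lam + c * lam * Cj * V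
      + lam * (A + 1) + ζ₂ (c * lam) + B * _ at hfin
    linarith

/-! ### The linearised inequality and comparison -/

theorem Sol.continuousAt {u : Space N → ℝ → ℝ} (hu : Sol ν j Cj H u) {x : Space N} {t : ℝ}
    (ht : 0 < t) : ContinuousAt (fun q : Space N × ℝ => u q.1 q.2) (x, t) :=
  hu.cont.continuousAt (prod_mem_nhds univ_mem (Ici_mem_nhds ht))

theorem Sol.tendsto {u : Space N → ℝ → ℝ} (hu : Sol ν j Cj H u) {ι : Type*} {l : Filter ι}
    {X : ι → Space N} {T : ι → ℝ} {x : Space N} {t : ℝ} (ht : 0 < t) (hX : Tendsto X l (𝓝 x))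
    (hT : Tendsto T l (𝓝 t)) : Tendsto (fun n => u (X n) (T n)) l (𝓝 (u x t)) :=
  (hu.continuousAt ht).tendsto.comp (hX.prodMk_nhds hT)

theorem abs_dblIncr_le {u v : Space N → ℝ} {U μ : ℝ} (hU : ∀ x, |u x| ≤ U) (hV : ∀ x, |v x| ≤ U)
    (hμ : |μ| ≤ 2) (x y z : Space N) : |dblIncr j μ u v x y z| ≤ 6 * U := by
  have a1 := abs_le.1 (hU (x + j x z))
  have a2 := abs_le.1 (hU x)
  have a3 := abs_le.1 (hV (y + j y z))
  have a4 := abs_le.1 (hV y)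
  have a5 : |u (x + j x z) - u x| ≤ 2 * U := by rw [abs_le]; constructor <;> linarith
  have a6 : |v (y + j y z) - v y| ≤ 2 * U := by rw [abs_le]; constructor <;> linarith
  calc |dblIncr j μ u v x y z|
      ≤ |μ * (u (x + j x z) - u x)| + |v (y + j y z) - v y| := abs_sub _ _
    _ ≤ 2 * (2 * U) + 2 * U := by rw [abs_mul]; gcongr
    _ = 6 * U := by ring

theorem Admissible.measurable_dblIncr (hA : Admissible ν j Cj α) {u v : Space N → ℝ}
    (hu : Continuous u) (hv : Continuous v) (μ : ℝ) (x y : Space N) :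
    Measurable (dblIncr j μ u v x y) := by
  have := hA.meas x
  have := hA.meas y
  have := hu.measurable
  have := hv.measurable
  unfold dblIncr
  fun_prop

/-- At a maximum point of `u - v - θ`, the linearised inequality holds at arbitrarily close maximum
points. -/
theorem exists_near_max {m A b₀ : ℝ} {ζ₁ ζ₂ : ℝ → ℝ} (hA : Admissible ν j Cj α)
    (hH : HamCond H m A b₀ ζ₁ ζ₂) {u v : Space N → ℝ → ℝ} (hu : Sol ν j Cj H u)
    (hv : Sol ν j Cj H v) {θ θ' : ℝ → ℝ} {Cθ : ℝ} (hCθ : 0 ≤ Cθ) (hθc : Continuous θ)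
    (hθ'c : Continuous θ') (hθ : ∀ s t, θ t ≤ θ s + θ' s * (t - s) + Cθ * (t - s) ^ 2)
    {xb : Space N} {tb r : ℝ} (hr : 0 < r) (hrt : 4 * r ≤ tb)
    (hmax : ∀ x t, |t - tb| ≤ 2 * r → u x t - v x t - θ t ≤ u xb tb - v xb tb - θ tb)
    {δ : ℝ} (hδ : 0 < δ) (hδ1 : δ ≤ 1) (hδr : Cj * δ ≤ r / 4) :
    ∃ x t, ‖x - xb‖ ≤ r ∧ |t - tb| ≤ r ∧
      u x t - v x t - θ t = u xb tb - v xb tb - θ tb ∧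
      θ' t ≤ ∫ z in (Metric.ball 0 δ)ᶜ,
        dblIncr j 1 (fun x => u x t) (fun x => v x t) x x z ∂ν := by
  -- The errors tend to `0` with `r` and `δ` fixed. A limit of the doubling points is again a
  -- maximum point, within `r` of the original one though possibly different from it.
  have hstep := fun n : ℕ => doubling_step hA hH hu hv hCθ hθc hθ hr hrt hmax hδ hδ1 hδr
    (η := 1 / ((n : ℝ) + 1)) (by positivity)
  choose μ X Y T S hμ hS hX hT hXY hTS hval hint using hstep
  have hη : Tendsto (fun n : ℕ => 1 / ((n : ℝ) + 1)) atTop (𝓝 0) :=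
    tendsto_one_div_add_atTop_nhds_zero_nat
  obtain ⟨⟨x, t⟩, ⟨hx, ht⟩, φ, hφ, hlim⟩ :=
    ((isCompact_closedBall xb r).prod (isCompact_closedBall tb r)).tendsto_subseq
      (x := fun n => (X n, T n))
      fun n => ⟨by simpa [dist_eq_norm] using hX n, by simpa [Real.dist_eq] using hT n⟩
  have hx : ‖x - xb‖ ≤ r := by simpa [dist_eq_norm] using hx
  have ht : |t - tb| ≤ r := by simpa [Real.dist_eq] using ht
  have ht0 : 0 < t := by have := (abs_le.1 ht).1; linarith
  have hη' := hη.comp hφ.tendsto_atTop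
  have lX : Tendsto (fun n => X (φ n)) atTop (𝓝 x) :=
    (continuous_fst.tendsto _).comp hlim
  have lT : Tendsto (fun n => T (φ n)) atTop (𝓝 t) :=
    (continuous_snd.tendsto _).comp hlim
  have lμ : Tendsto (fun n => μ (φ n)) atTop (𝓝 1) := by
    rw [tendsto_iff_dist_tendsto_zero]
    exact squeeze_zero (fun _ => dist_nonneg) (fun n => hμ (φ n)) hη'
  have lY : Tendsto (fun n => Y (φ n)) atTop (𝓝 x) := by
    have h1 : Tendsto (fun n => X (φ n) - Y (φ n)) atTop (𝓝 0) :=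
      squeeze_zero_norm (fun n => hXY (φ n)) hη'
    simpa using lX.sub h1
  have lS : Tendsto (fun n => S (φ n)) atTop (𝓝 t) := by
    have h1 : Tendsto (fun n => T (φ n) - S (φ n)) atTop (𝓝 0) :=
      squeeze_zero_norm (fun n => hTS (φ n)) hη'
    simpa using lT.sub h1
  have hle : u xb tb - v xb tb - θ tb ≤ u x t - v x t - θ t := by
    have l1 : Tendsto (fun n => u (X (φ n)) (T (φ n)) - v (X (φ n)) (T (φ n)) - θ (T (φ n)))
        atTop (𝓝 (u x t - v x t - θ t)) :=
      ((hu.tendsto ht0 lX lT).sub (hv.tendsto ht0 lX lT)).sub ((hθc.tendsto t).comp lT)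
    have l2 : Tendsto (fun n => u xb tb - v xb tb - θ tb - 1 / ((φ n : ℝ) + 1)) atTop
        (𝓝 (u xb tb - v xb tb - θ tb - 0)) := tendsto_const_nhds.sub hη'
    rw [sub_zero] at l2
    exact le_of_tendsto_of_tendsto' l2 l1 fun n => hval (φ n)
  refine ⟨x, t, hx, ht, le_antisymm (hmax x t (by linarith)) hle, ?_⟩
  obtain ⟨U₁, hU₁0, hU₁⟩ := hu.bounded (tb + r + 1)
  obtain ⟨U₂, hU₂0, hU₂⟩ := hv.bounded (tb + r + 1)
  -- Dominated convergence with a constant bound applies because `ν` is finite off `B_δ`.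
  have l3 : Tendsto (fun n => ∫ z in (Metric.ball 0 δ)ᶜ, dblIncr j (μ (φ n))
      (fun x => u x (T (φ n))) (fun x => v x (S (φ n))) (X (φ n)) (Y (φ n)) z ∂ν) atTop
      (𝓝 (∫ z in (Metric.ball 0 δ)ᶜ,
        dblIncr j 1 (fun x => u x t) (fun x => v x t) x x z ∂ν)) := by
    have hη1 : ∀ n : ℕ, 1 / ((n : ℝ) + 1) ≤ 1 := fun n => by
      rw [div_le_one (by positivity)]; linarith [(Nat.cast_nonneg n : (0 : ℝ) ≤ n)]
    have hT0 : ∀ n, 0 ≤ T n ∧ T n ≤ tb + r := fun n => by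
      have := abs_le.1 (hT n)
      constructor <;> linarith
    have hS1 : ∀ n, S n ≤ tb + r + 1 := fun n => by
      have := abs_le.1 ((hTS n).trans (hη1 n))
      linarith [(hT0 n).2]
    refine tendsto_integral_of_dominated_convergence (fun _ => 6 * max U₁ U₂) ?_ ?_ ?_ ?_
    · intro n
      exact (hA.measurable_dblIncr (hu.cont_slice (hT0 _).1) (hv.cont_slice (hS _)) _ _
        _).aestronglyMeasurable
    · exact integrableOn_const (hA.tail δ hδ).ne
    · intro n
      refine Eventually.of_forall fun z => ?_
      refine abs_dblIncr_le (fun x => (hU₁ x _ ⟨(hT0 _).1, by linarith [(hT0 (φ n)).2]⟩).trans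
        (le_max_left _ _)) (fun x => (hU₂ x _ ⟨hS _, hS1 _⟩).trans (le_max_right _ _)) ?_ _ _ _
      have := abs_le.1 ((hμ (φ n)).trans (hη1 _))
      rw [abs_le]; constructor <;> linarith
    · refine Eventually.of_forall fun z => ?_
      have c1 : Tendsto (fun n => X (φ n) + j (X (φ n)) z) atTop (𝓝 (x + j x z)) :=
        lX.add (((hA.cont z).tendsto x).comp lX)
      have c2 : Tendsto (fun n => Y (φ n) + j (Y (φ n)) z) atTop (𝓝 (x + j x z)) :=
        lY.add (((hA.cont z).tendsto x).comp lY)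
      exact (lμ.mul ((hu.tendsto ht0 c1 lT).sub (hu.tendsto ht0 lX lT))).sub
        ((hv.tendsto ht0 c2 lS).sub (hv.tendsto ht0 lY lS))
  have l4 : Tendsto (fun n => θ' (T (φ n)) - 1 / ((φ n : ℝ) + 1)) atTop (𝓝 (θ' t - 0)) :=
    ((hθ'c.tendsto t).comp lT).sub hη'
  rw [sub_zero] at l4
  exact le_of_tendsto_of_tendsto' l4 l3 fun n => hint (φ n)

theorem Sol.exists_isMax {u v : Space N → ℝ → ℝ} (hu : Sol ν j Cj H u) (hv : Sol ν j Cj H v)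
    {θ : ℝ → ℝ} (hθ : Continuous θ) {T : ℝ} (hT : 0 ≤ T) :
    ∃ xb, ∃ tb ∈ Icc 0 T, ∀ x, ∀ t ∈ Icc 0 T,
      u x t - v x t - θ t ≤ u xb tb - v xb tb - θ tb := by
  obtain ⟨D, hD, hlat⟩ := exists_lattice_norm_le N
  obtain ⟨⟨xb, tb⟩, ⟨-, htb⟩, hmax⟩ := ((isCompact_closedBall (0 : Space N) D).prod
    (isCompact_Icc (a := (0 : ℝ)) (b := T))).exists_isMaxOn
    ⟨(0, 0), Metric.mem_closedBall_self hD.le, ⟨le_rfl, hT⟩⟩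
    (f := fun q : Space N × ℝ => u q.1 q.2 - v q.1 q.2 - θ q.2)
    (((hu.cont.sub hv.cont).mono fun q hq => ⟨mem_univ _, hq.2.1⟩).sub
      (hθ.comp continuous_snd).continuousOn)
  refine ⟨xb, tb, htb, fun x t ht => ?_⟩
  obtain ⟨k, hk⟩ := hlat 0 x
  have h1 := hmax (show (x + lattice k, t) ∈ Metric.closedBall (0 : Space N) D ×ˢ Icc 0 T from
    ⟨by simpa using hk, ht⟩)
  have h2 := hu.periodic t ht.1 k x
  have h3 := hv.periodic t ht.1 k x
  simp only [mem_ofPred_eq] at h1 h2 h3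
  rwa [h2, h3] at h1

theorem exists_delta (hA : Admissible ν j Cj α) {r e : ℝ} (hr : 0 < r) (he : 0 < e) :
    ∃ δ, 0 < δ ∧ δ ≤ 1 ∧ Cj * δ ≤ r / 4 ∧ δ ≤ e := by
  have := hA.pos
  refine ⟨min 1 (min (r / (4 * Cj)) e), by positivity, min_le_left _ _, ?_,
    (min_le_right _ _).trans (min_le_right _ _)⟩
  calc Cj * min 1 (min (r / (4 * Cj)) e) ≤ Cj * (r / (4 * Cj)) := by
        gcongr; exact (min_le_right _ _).trans (min_le_left _ _)
    _ = r / 4 := by field_simp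

/-- The comparison principle. -/
theorem comparison {m A b₀ : ℝ} {ζ₁ ζ₂ : ℝ → ℝ} (hA : Admissible ν j Cj α)
    (hH : HamCond H m A b₀ ζ₁ ζ₂) {u v : Space N → ℝ → ℝ} (hu : Sol ν j Cj H u)
    (hv : Sol ν j Cj H v) {M : ℝ} (h0 : ∀ x, u x 0 - v x 0 ≤ M) {t : ℝ} (ht : 0 ≤ t)
    (x : Space N) : u x t - v x t ≤ M := by
  rcases ht.eq_or_lt with rfl | ht1
  · exact h0 x
  by_contra hcon
  rw [not_le] at hcon
  set gap := u x t - v x t - M with hgap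
  have hgap0 : 0 < gap := by linarith
  obtain ⟨U₁, hU₁0, hU₁⟩ := hu.bounded (t + 1)
  obtain ⟨U₂, hU₂0, hU₂⟩ := hv.bounded (t + 1)
  -- This slope uses up half of the gap by time `t`, which leaves a value above `M` and so excludes
  -- a maximum at time `0`.
  set a := gap / (2 * t) with ha
  have ha0 : 0 < a := by positivity
  have hat : a * t = gap / 2 := by rw [ha]; field_simp
  set K := U₁ + U₂ + |M| with hK
  have hK0 : 0 ≤ K := by positivity
  -- The quadratic penalty after time `t` excludes a maximum at the end time `t + 1`, so the maximum
  -- is interior in time. The squared positive part is not `C²`, but the one-sided quadratic bound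
  -- below suffices.
  let θ : ℝ → ℝ := fun s => a * s + K * (max (s - t) 0) ^ 2
  let θ' : ℝ → ℝ := fun s => a + 2 * K * max (s - t) 0
  have hθc : Continuous θ := by fun_prop
  have hθ'c : Continuous θ' := by fun_prop
  have hθ : ∀ s s', θ s' ≤ θ s + θ' s * (s' - s) + K * (s' - s) ^ 2 := by
    intro s s'
    have key : (max (s' - t) 0) ^ 2
        ≤ (max (s - t) 0) ^ 2 + 2 * max (s - t) 0 * (s' - s) + (s' - s) ^ 2 := by
      rcases le_total (s - t) 0 with h1 | h1 <;> rcases le_total (s' - t) 0 with h2 | h2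
      · rw [max_eq_right h1, max_eq_right h2]; nlinarith [sq_nonneg (s' - s)]
      · rw [max_eq_right h1, max_eq_left h2]; nlinarith
      · rw [max_eq_left h1, max_eq_right h2]; nlinarith [sq_nonneg (s' - t)]
      · rw [max_eq_left h1, max_eq_left h2]; nlinarith
    have := mul_le_mul_of_nonneg_left key hK0
    simp only [θ, θ']
    linarith
  obtain ⟨xb, tb, htb, hmax⟩ := hu.exists_isMax hv hθc (show (0 : ℝ) ≤ t + 1 by linarith)
  have hval : M + gap / 2 ≤ u xb tb - v xb tb - θ tb := by
    have h1 := hmax x t ⟨ht, by linarith⟩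
    have h2 : θ t = gap / 2 := by simp [θ, hat]
    linarith
  have htb0 : 0 < tb := by
    rcases htb.1.eq_or_lt with h | h
    · exfalso
      have h1 := h0 xb
      have h2 : θ 0 = 0 := by simp [θ, max_eq_right (show -t ≤ 0 by linarith)]
      rw [← h, h2] at hval
      linarith
    · exact h
  have htb1 : tb < t + 1 := by
    rcases htb.2.eq_or_lt with h | h
    · exfalso
      have h1 := (abs_le.1 (hU₁ xb tb htb)).2
      have h2 := (abs_le.1 (hU₂ xb tb htb)).1
      have h3 : θ tb = a * (t + 1) + K := by simp [θ, h]
      have h4 : 0 < a * (t + 1) := by positivity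
      have h5 := neg_abs_le M
      linarith
    · exact h
  obtain ⟨r, hr0, hr1, hr2⟩ : ∃ r, 0 < r ∧ 4 * r ≤ tb ∧ 2 * r ≤ t + 1 - tb := by
    refine ⟨min (tb / 4) ((t + 1 - tb) / 2), lt_min (by linarith) (by linarith), ?_, ?_⟩
    · linarith [min_le_left (tb / 4) ((t + 1 - tb) / 2)]
    · linarith [min_le_right (tb / 4) ((t + 1 - tb) / 2)]
  have hloc : ∀ s, |s - tb| ≤ 2 * r → s ∈ Icc 0 (t + 1) := fun s hs => by
    have := abs_le.1 hs
    constructor <;> linarith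
  obtain ⟨δ, hδ0, hδ1, hδr, -⟩ := exists_delta hA hr0 one_pos
  obtain ⟨y, s, -, hs, heq, hle⟩ := exists_near_max hA hH hu hv hK0 hθc hθ'c hθ hr0 hr1
    (fun x s hs => hmax x s (hloc s hs)) hδ0 hδ1 hδr
  -- `(y, s)` is also a maximum point, so no jump increases `u - v`; this contradicts `θ' ≥ a > 0`.
  have hneg : ∫ z in (Metric.ball 0 δ)ᶜ,
      dblIncr j 1 (fun x => u x s) (fun x => v x s) y y z ∂ν ≤ 0 := by
    refine integral_nonpos fun z => ?_
    have := hmax (y + j y z) s (hloc s (by linarith))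
    simp only [dblIncr, Pi.zero_apply]
    linarith
  have hpos : 0 < θ' s := by
    have : 0 ≤ 2 * K * max (s - t) 0 := by positivity
    simp only [θ']
    linarith
  linarith

/-! ### The strong maximum principle -/

/-- A continuous function on the support with nonnegative integral that is nonpositive vanishes. -/
theorem eq_zero_on_support {f : Space N → ℝ} {S : Set (Space N)}
    (hf : ContinuousOn f ν.support) (hS : MeasurableSet S) (hint : IntegrableOn f S ν)
    (hneg : ∀ z, f z ≤ 0) (h0 : 0 ≤ ∫ z in S, f z ∂ν) {z : Space N} (hz : z ∈ ν.support)
    (hzS : S ∈ 𝓝 z) : f z = 0 := by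
  have hae : (fun z => -f z) =ᵐ[ν.restrict S] 0 := by
    have hi : Integrable (fun z => -f z) (ν.restrict S) := hint.neg
    rw [← integral_eq_zero_iff_of_nonneg (fun z => by simpa using hneg z) hi, integral_neg]
    have : ∫ z in S, f z ∂ν ≤ 0 := integral_nonpos hneg
    linarith
  by_contra hne
  have hlt : f z < 0 := lt_of_le_of_ne (hneg z) hne
  have hev : ∀ᶠ y in 𝓝 z, y ∈ ν.support → f y < 0 :=
    eventually_nhdsWithin_iff.1 ((hf z hz).eventually_lt_const hlt)
  -- This neighbourhood has positive mass, yet `f` vanishes almost everywhere on `S` and is negative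
  -- at its points of the support, which carries `ν`.
  have hpos := (Measure.mem_support_iff_forall z).1 hz _ (inter_mem hev hzS)
  refine hpos.ne' ?_
  have h1 : ∀ᵐ y ∂ν, y ∈ S → -f y = 0 := (ae_restrict_iff' hS).1 hae
  have h2 : ∀ᵐ y ∂ν, y ∈ ν.support := Measure.support_mem_ae
  refine measure_mono_null (t := {y | ¬((y ∈ S → -f y = 0) ∧ y ∈ ν.support)}) ?_
    (ae_iff.1 (h1.and h2))
  rintro y ⟨hy1, hy2⟩ ⟨h3, h4⟩
  have := h3 hy2
  have := hy1 h4
  linarith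

/-- With `θ = 0` the linearised inequality gives increments that are nonpositive with nonnegative
integral, hence zero at every `z` of the support beyond `δ`. It holds only at maximum points near
`(x, tb)`; these converge to `(x, tb)`, and continuity of `j(·, z)` carries the conclusion over. -/
theorem max_propagates {m A b₀ : ℝ} {ζ₁ ζ₂ : ℝ → ℝ} (hA : Admissible ν j Cj α)
    (hH : HamCond H m A b₀ ζ₁ ζ₂) (hj_supp : ∀ x, ContinuousOn (j x) ν.support)
    {u v : Space N → ℝ → ℝ} (hu : Sol ν j Cj H u) (hv : Sol ν j Cj H v) {L tb : ℝ} (htb : 0 < tb)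
    (hL : ∀ x t, 0 < t → u x t - v x t ≤ L) {x : Space N} (hx : u x tb - v x tb = L)
    {z : Space N} (hz : z ∈ ν.support) :
    u (x + j x z) tb - v (x + j x z) tb = L := by
  rcases eq_or_ne z 0 with rfl | hz0
  · rwa [hA.zero, add_zero]
  have hznorm : 0 < ‖z‖ := norm_pos_iff.2 hz0
  have hex : ∀ n : ℕ, ∃ y t, ‖y - x‖ ≤ tb / 4 * (1 / ((n : ℝ) + 1)) ∧
      |t - tb| ≤ tb / 4 * (1 / ((n : ℝ) + 1)) ∧ u (y + j y z) t - v (y + j y z) t = L := by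
    intro n
    have hn1 : 1 / ((n : ℝ) + 1) ≤ 1 := by
      rw [div_le_one (by positivity)]; linarith [(Nat.cast_nonneg n : (0 : ℝ) ≤ n)]
    obtain ⟨r, hr⟩ : ∃ r, r = tb / 4 * (1 / ((n : ℝ) + 1)) := ⟨_, rfl⟩
    rw [← hr]
    have hr0 : 0 < r := by rw [hr]; positivity
    have hr1 : r ≤ tb / 4 := by
      have := mul_le_mul_of_nonneg_left hn1 (show 0 ≤ tb / 4 by linarith)
      linarith
    -- Taking `δ ≤ |z| / 2` makes the complement of `B_δ` a neighbourhood of `z`.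
    obtain ⟨δ, hδ0, hδ1, hδr, hδz⟩ := exists_delta hA hr0 (half_pos hznorm)
    have hloc : ∀ s, |s - tb| ≤ 2 * r → 0 < s := fun s hs => by
      have := (abs_le.1 hs).1
      linarith
    obtain ⟨y, t, hy, ht, heq, hle⟩ := exists_near_max hA hH hu hv le_rfl
      (continuous_const (y := (0 : ℝ))) (continuous_const (y := (0 : ℝ))) (by simp) hr0
      (show 4 * r ≤ tb by linarith) (xb := x) (fun y s hs => by rw [hx]; simpa using hL y s (hloc s hs)) hδ0 hδ1 hδr
    rw [hx, sub_zero, sub_zero] at heq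
    refine ⟨y, t, hy, ht, ?_⟩
    have ht0 : 0 < t := hloc t (by linarith)
    obtain ⟨U₁, -, hU₁⟩ := hu.bounded t
    obtain ⟨U₂, -, hU₂⟩ := hv.bounded t
    have hz1 : dblIncr j 1 (fun x => u x t) (fun x => v x t) y y z = 0 := by
      refine eq_zero_on_support (S := (Metric.ball 0 δ)ᶜ) (ν := ν) ?_ measurableSet_ball.compl ?_
        (fun z => ?_) hle hz ?_
      · have c1 : ContinuousOn (fun z => y + j y z) ν.support := continuousOn_const.add (hj_supp y)
        have c2 := (hu.cont_slice ht0.le).comp_continuousOn c1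
        have c3 := (hv.cont_slice ht0.le).comp_continuousOn c1
        exact (continuousOn_const.mul (c2.sub continuousOn_const)).sub (c3.sub continuousOn_const)
      · exact Measure.integrableOn_of_bounded (M := 6 * max U₁ U₂) (hA.tail δ hδ0).ne
          (hA.measurable_dblIncr (hu.cont_slice ht0.le) (hv.cont_slice ht0.le) _ _
            _).aestronglyMeasurable
          (Eventually.of_forall fun z => abs_dblIncr_le
            (fun x => (hU₁ x t ⟨ht0.le, le_rfl⟩).trans (le_max_left _ _))
            (fun x => (hU₂ x t ⟨ht0.le, le_rfl⟩).trans (le_max_right _ _)) (by norm_num) _ _ _)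
      · have := hL (y + j y z) t ht0
        simp only [dblIncr]
        linarith
      · refine mem_of_superset ((Metric.isClosed_closedBall (x := (0 : Space N))
          (ε := δ)).isOpen_compl.mem_nhds ?_) (compl_subset_compl.2 Metric.ball_subset_closedBall)
        simp only [mem_compl_iff, mem_closedBall_zero_iff, not_le]
        linarith
    simp only [dblIncr] at hz1
    linarith
  choose Y T hY hT hYT using hex
  have hη : Tendsto (fun n : ℕ => tb / 4 * (1 / ((n : ℝ) + 1))) atTop (𝓝 0) := by
    simpa using tendsto_one_div_add_atTop_nhds_zero_nat.const_mul (tb / 4)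
  have lY : Tendsto Y atTop (𝓝 x) := by
    rw [tendsto_iff_norm_sub_tendsto_zero]
    exact squeeze_zero (fun _ => norm_nonneg _) hY hη
  have lT : Tendsto T atTop (𝓝 tb) := by
    rw [tendsto_iff_norm_sub_tendsto_zero]
    exact squeeze_zero (fun _ => norm_nonneg _) hT hη
  have lJ : Tendsto (fun n => Y n + j (Y n) z) atTop (𝓝 (x + j x z)) :=
    lY.add (((hA.cont z).tendsto x).comp lY)
  have l1 := (hu.tendsto htb lJ lT).sub (hv.tendsto htb lJ lT)
  simp only [hYT] at l1
  exact tendsto_nhds_unique l1 tendsto_const_nhds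

/-- The strong maximum principle. -/
theorem strong_maximum {m A b₀ : ℝ} {ζ₁ ζ₂ : ℝ → ℝ} (hA : Admissible ν j Cj α)
    (hH : HamCond H m A b₀ ζ₁ ζ₂) (hj_supp : ∀ x, ContinuousOn (j x) ν.support)
    (hcov : IterativeCovering ν j)
    {u v : Space N → ℝ → ℝ} (hu : Sol ν j Cj H u) (hv : Sol ν j Cj H v) {L tb : ℝ} (htb : 0 < tb)
    (hL : ∀ x t, 0 < t → u x t - v x t ≤ L) {xb : Space N} (hxb : u xb tb - v xb tb = L)
    (x : Space N) : u x tb - v x tb = L := by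
  have hreach : ∀ n, ∀ y ∈ reach ν j xb n, u y tb - v y tb = L := by
    intro n
    induction n with
    | zero => intro y hy; rw [mem_singleton_iff.1 hy]; exact hxb
    | succ n ih =>
      intro y hy
      simp only [reach, mem_iUnion] at hy
      obtain ⟨ξ, hξ, z, hz, rfl⟩ := hy
      exact max_propagates hA hH hj_supp hu hv htb hL (ih ξ hξ) hz
  have hclosed : IsClosed {y | u y tb - v y tb = L} :=
    isClosed_eq ((hu.cont_slice htb.le).sub (hv.cont_slice htb.le)) continuous_const
  have hsub : closure {y : Space N | ∃ (n : ℕ) (k : Fin N → ℤ), y + lattice k ∈ reach ν j xb n}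
      ⊆ {y | u y tb - v y tb = L} := by
    refine closure_minimal ?_ hclosed
    rintro y ⟨n, k, hy⟩
    have h1 := hreach n _ hy
    have h2 := hu.periodic tb htb.le k y
    have h3 := hv.periodic tb htb.le k y
    simp only at h2 h3
    rwa [h2, h3] at h1
  rw [hcov xb] at hsub
  exact hsub (mem_univ x)

/-! ### Coercivity and Hölder estimates -/

theorem exists_mul_le_rpow {m B C : ℝ} (hm : 1 < m) (hB : 0 < B) (hC : 0 ≤ C) :
    ∃ K, 0 ≤ K ∧ ∀ X : ℝ, 0 ≤ X → C * X ≤ B * X ^ m + K := by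
  refine ⟨C * (C / B) ^ (1 / (m - 1)), by positivity, fun X hX => ?_⟩
  have hm1 : 0 < m - 1 := by linarith
  have h0 : 0 ≤ B * X ^ m := by positivity
  rcases le_total X ((C / B) ^ (1 / (m - 1))) with h | h
  · linarith [mul_le_mul_of_nonneg_left h hC]
  · have h1 : C / B ≤ X ^ (m - 1) := by
      have := Real.rpow_le_rpow (by positivity) h hm1.le
      rwa [← Real.rpow_mul (by positivity), one_div_mul_cancel hm1.ne', Real.rpow_one] at this
    have h2 : X ^ m = X ^ (m - 1) * X := by
      rw [← Real.rpow_add_one' hX (by linarith)]; ring_nf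
    have h3 : C ≤ B * X ^ (m - 1) := by
      rw [div_le_iff₀ hB] at h1; linarith
    have h4 := mul_le_mul_of_nonneg_right h3 hX
    have h5 : 0 ≤ C * (C / B) ^ (1 / (m - 1)) := by positivity
    rw [h2]
    linarith

/-- The Hamiltonian is superlinearly coercive. -/
theorem HamCond.coercive {m A b₀ : ℝ} {ζ₁ ζ₂ : ℝ → ℝ} (hH : HamCond H m A b₀ ζ₁ ζ₂) :
    ∃ c C : ℝ, 0 < c ∧ 0 ≤ C ∧ ∀ x p, c * ‖p‖ ^ m - C ≤ H x p := by
  have hm := hH.one_lt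
  obtain ⟨H₀, hH₀, hb0⟩ := hH.h0
  set C₁ := H₀ + ζ₂ 1 * 2
  have hz1 : 0 ≤ ζ₂ 1 := hH.mod₂.nonneg zero_le_one
  have hC₁ : 0 ≤ C₁ := by positivity
  have hb : 0 < b₀ * (m - 1) := mul_pos hH.b_pos (by linarith)
  have hApos := hH.A_pos
  -- Near the origin, (H1) compares `H x p` with `H x 0`, which (H0) bounds.
  have hsmall : ∀ x p : Space N, ‖p‖ ≤ 1 → -C₁ ≤ H x p := by
    intro x p hp
    have h1 := hH.h1 x x p (-p)
    rw [add_neg_cancel, sub_self, norm_zero, hH.mod₁.1, zero_mul, zero_add, norm_neg] at h1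
    have h2 := (abs_le.1 (hb0 x)).1
    have h3 : ζ₂ ‖p‖ * (1 + ‖p‖ ^ (m - 1)) ≤ ζ₂ 1 * 2 := by
      have h4 := hH.mod₂.mono (norm_nonneg p) hp
      have h5 := Real.rpow_le_one (norm_nonneg p) hp (show 0 ≤ m - 1 by linarith)
      exact mul_le_mul h4 (by linarith) (by positivity) hz1
    simp only [C₁]
    linarith
  have hlin : ∀ x p : Space N, -(C₁ + A) * (1 + ‖p‖) ≤ H x p := by
    intro x p
    rcases le_or_gt ‖p‖ 1 with hp | hp
    · have := hsmall x p hp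
      have h2 : 0 ≤ (C₁ + A) * ‖p‖ := by positivity
      linarith
    · have hp0 : 0 < ‖p‖ := by linarith
      have hinv : ‖p‖⁻¹ < 1 := inv_lt_one_of_one_lt₀ hp
      -- (H2) at the unit vector `p / |p|` with `μ = 1 / |p|` yields a lower bound of linear growth.
      have h1 := hH.h2 ‖p‖⁻¹ ⟨inv_pos.2 hp0, hinv⟩ x (‖p‖⁻¹ • p)
      have e1 : ‖‖p‖⁻¹ • p‖ = 1 := by
        rw [norm_smul, norm_inv, norm_norm, inv_mul_cancel₀ hp0.ne']
      rw [inv_inv, smul_smul, mul_inv_cancel₀ hp0.ne', one_smul, e1, Real.one_rpow, mul_one] at h1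
      have h2 := hsmall x (‖p‖⁻¹ • p) e1.le
      have h3 : (1 - ‖p‖⁻¹) * (b₀ * (1 - m) + A) ≤ A := by
        have h4 : b₀ * (1 - m) + A ≤ A := by linarith
        have h5 : 0 < ‖p‖⁻¹ := inv_pos.2 hp0
        calc (1 - ‖p‖⁻¹) * (b₀ * (1 - m) + A) ≤ (1 - ‖p‖⁻¹) * A :=
              mul_le_mul_of_nonneg_left h4 (by linarith)
          _ ≤ 1 * A := mul_le_mul_of_nonneg_right (by linarith) hApos.le
          _ = A := one_mul A
      have h6 : -(C₁ + A) ≤ ‖p‖⁻¹ * H x p := by linarith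
      have h7 := mul_le_mul_of_nonneg_left h6 hp0.le
      rw [← mul_assoc, mul_inv_cancel₀ hp0.ne', one_mul] at h7
      linarith
  set B := b₀ * (m - 1) * (1 / 2) ^ m
  have hB : 0 < B := by positivity
  obtain ⟨K, hK0, hK⟩ := exists_mul_le_rpow hm (half_pos hB) (show 0 ≤ C₁ + A by positivity)
  refine ⟨B / 2, 2 * (C₁ + A) + A + K, half_pos hB, by positivity, fun x p => ?_⟩
  -- (H2) at `p / 2` with `μ = 1/2` bounds `H x p` below by `B |p|^m - A + 2 H x (p/2)`. The linear
  -- bound on the last term is dominated by the power.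
  have h1 := hH.h2 (1 / 2) ⟨by norm_num, by norm_num⟩ x ((1 / 2 : ℝ) • p)
  have e1 : ((1 / 2 : ℝ)⁻¹ • (1 / 2 : ℝ) • p) = p := by
    rw [smul_smul]; norm_num
  have e2 : ‖(1 / 2 : ℝ) • p‖ = 1 / 2 * ‖p‖ := by
    rw [norm_smul]; norm_num
  rw [e1, e2, Real.mul_rpow (by norm_num) (norm_nonneg _)] at h1
  have h2 := hlin x ((1 / 2 : ℝ) • p)
  rw [e2] at h2
  have h3 := hK ‖p‖ (norm_nonneg _)
  have e3 : b₀ * (1 - m) * ((1 / 2) ^ m * ‖p‖ ^ m) = -(B * ‖p‖ ^ m) := by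
    simp only [B]; ring
  rw [e3] at h1
  linarith

/-- The concave function `s ↦ s^{γ/2}` lies below its tangents. -/
theorem rpow_le_tangent {γ r X : ℝ} (hγ : 0 < γ) (hγ1 : γ < 1) (hr : 0 < r) (hX : 0 ≤ X) :
    X ^ γ ≤ r ^ γ + γ / 2 * r ^ (γ - 2) * (X ^ 2 - r ^ 2) := by
  have h1 := rpow_one_add_le_one_add_mul_self (s := (X / r) ^ 2 - 1)
    (by linarith [sq_nonneg (X / r)]) (show 0 ≤ γ / 2 by linarith) (by linarith)
  rw [add_sub_cancel, ← Real.rpow_natCast, ← Real.rpow_mul (by positivity)] at h1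
  have e : ((2 : ℕ) : ℝ) * (γ / 2) = γ := by push_cast; ring
  rw [e, Real.div_rpow hX hr.le] at h1
  have hrγ : 0 < r ^ γ := by positivity
  rw [div_le_iff₀ hrγ] at h1
  refine h1.trans (le_of_eq ?_)
  have e2 : r ^ (γ - 2) = r ^ γ / r ^ 2 := by
    rw [Real.rpow_sub hr]; norm_num
  rw [e2]
  push_cast
  rw [Real.rpow_ofNat]
  field_simp

theorem rpow_add_le_tangent {γ r X : ℝ} (hγ : 0 < γ) (hγ1 : γ < 1) (hr : 0 < r) (hX : 0 ≤ X) :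
    (r + X) ^ γ ≤ r ^ γ + γ * r ^ γ * (X / r) := by
  have h1 := rpow_one_add_le_one_add_mul_self (s := X / r)
    (by linarith [show 0 ≤ X / r by positivity]) hγ.le hγ1.le
  have h2 : r + X = r * (1 + X / r) := by field_simp
  rw [h2, Real.mul_rpow hr.le (by positivity)]
  have := mul_le_mul_of_nonneg_left h1 (Real.rpow_nonneg hr.le γ)
  linarith

/-- This allows a second-order bound for small increments and a first-order bound for large ones,
both measured by the same power `α`. -/
theorem min_sq_self_le_rpow {α X : ℝ} (h1 : 1 ≤ α) (h2 : α ≤ 2) (hX : 0 ≤ X) :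
    X ^ 2 ≤ X ^ α ∨ X ≤ X ^ α := by
  rcases le_total X 1 with h | h
  · left
    rcases hX.eq_or_lt with h0 | h0
    · rw [← h0, Real.zero_rpow (by linarith)]; norm_num
    · rw [← Real.rpow_two]
      exact Real.rpow_le_rpow_of_exponent_ge h0 h h2
  · right
    calc X = X ^ (1 : ℝ) := (Real.rpow_one X).symm
      _ ≤ X ^ α := Real.rpow_le_rpow_of_exponent_le h h1

/-- Compensated increments of `K |y - x|^γ`. -/
theorem holder_increment_le {γ K : ℝ} (hα1 : 1 < α) (hα2 : α < 2) (hγ : 0 < γ) (hγ1 : γ < 1)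
    (hK : 0 ≤ K) {e h : Space N} (he : 0 < ‖e‖) :
    K * (‖e + h‖ ^ γ - ‖e‖ ^ γ) - inner ℝ ((K * γ * ‖e‖ ^ (γ - 2)) • e) h
      ≤ 2 * K * ‖e‖ ^ (γ - α) * ‖h‖ ^ α := by
  set r := ‖e‖ with hr
  have hrγ : 0 < r ^ γ := by positivity
  have e2 : r ^ (γ - 2) = r ^ γ / r ^ 2 := by
    rw [Real.rpow_sub he]; norm_num
  have e3 : r ^ (γ - α) * ‖h‖ ^ α = r ^ γ * (‖h‖ / r) ^ α := by
    rw [Real.rpow_sub he, Real.div_rpow (norm_nonneg _) he.le]; ring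
  rw [inner_smul_left, conj_trivial]
  have hXα : 0 ≤ (‖h‖ / r) ^ α := by positivity
  have hKr : 0 ≤ K * r ^ γ := by positivity
  -- For a jump small relative to `|e|` concavity in the squared norm cancels the linear term.
  -- Otherwise the norm and the gradient term are bounded separately.
  rcases min_sq_self_le_rpow hα1.le hα2.le (show 0 ≤ ‖h‖ / r by positivity) with hX | hX
  · have h1 := rpow_le_tangent hγ hγ1 he (norm_nonneg (e + h))
    rw [norm_add_sq_real, ← hr] at h1
    have h2 := mul_le_mul_of_nonneg_left h1 hK
    have h3 : K * (γ / 2 * r ^ (γ - 2) * ‖h‖ ^ 2) ≤ K * r ^ γ * (‖h‖ / r) ^ α := by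
      have e4 : K * (γ / 2 * r ^ (γ - 2) * ‖h‖ ^ 2) = K * r ^ γ * (γ / 2 * (‖h‖ / r) ^ 2) := by
        rw [e2]; field_simp
      rw [e4]
      refine mul_le_mul_of_nonneg_left ?_ hKr
      have := sq_nonneg (‖h‖ / r)
      nlinarith
    have h4 : 0 ≤ K * r ^ γ * (‖h‖ / r) ^ α := by positivity
    have e5 : 2 * K * r ^ (γ - α) * ‖h‖ ^ α = 2 * (K * r ^ γ * (‖h‖ / r) ^ α) := by
      rw [mul_assoc, e3]; ring
    rw [e5]
    linarith
  · have h1 : ‖e + h‖ ^ γ ≤ r ^ γ + γ * r ^ γ * (‖h‖ / r) :=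
      (Real.rpow_le_rpow (norm_nonneg _) (norm_add_le e h) hγ.le).trans
        (rpow_add_le_tangent hγ hγ1 he (norm_nonneg _))
    have h2 := mul_le_mul_of_nonneg_left h1 hK
    have h3 := (abs_le.1 (abs_real_inner_le_norm e h)).1
    have h4 : -(K * γ * r ^ (γ - 2) * inner ℝ e h) ≤ K * γ * r ^ γ * (‖h‖ / r) := by
      have h5 := mul_le_mul_of_nonneg_left h3 (show 0 ≤ K * γ * r ^ (γ - 2) by positivity)
      have e6 : K * γ * r ^ (γ - 2) * -(‖e‖ * ‖h‖) = -(K * γ * r ^ γ * (‖h‖ / r)) := by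
        rw [e2, ← hr]; field_simp
      linarith
    have h6 : γ * (‖h‖ / r) ≤ (‖h‖ / r) ^ α := by
      have : 0 ≤ ‖h‖ / r := by positivity
      nlinarith
    have h7 := mul_le_mul_of_nonneg_left h6 hKr
    have e5 : 2 * K * r ^ (γ - α) * ‖h‖ ^ α = 2 * (K * r ^ γ * (‖h‖ / r) ^ α) := by
      rw [mul_assoc, e3]; ring
    rw [e5]
    linarith

/-- Subsolutions are Hölder continuous in space up to their oscillation in time. -/
theorem holder_up_to_time_shift {m A b₀ : ℝ} {ζ₁ ζ₂ : ℝ → ℝ} (hA : Admissible ν j Cj α)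
    (hαm : α < m) (hH : HamCond H m A b₀ ζ₁ ζ₂) {u : Space N → ℝ → ℝ} (hu : Sol ν j Cj H u)
    {W : ℝ} (hW : ∀ x t s, 0 ≤ t → 0 ≤ s → |t - s| ≤ 1 → |u x t - u x s| ≤ W)
    {e : ℝ} (he : 0 < e) (he2 : e ≤ 1 / 2) :
    ∃ K, 0 ≤ K ∧ ∀ x t, 2 ≤ t → ∃ s, |s - t| ≤ e ∧
      ∀ y, u y t ≤ u x s + K * ‖y - x‖ ^ ((m - α) / (m - 1)) := by
  have hm := hH.one_lt
  have hm1 : 0 < m - 1 := by linarith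
  have hα1 := hA.one_lt
  set γ := (m - α) / (m - 1) with hγdef
  have hγ : 0 < γ := div_pos (by linarith) hm1
  have hγ1 : γ < 1 := by rw [hγdef, div_lt_one hm1]; linarith
  -- This identity determines `γ`: the `m`-th power of the slope of `K r^γ` has the same singularity
  -- in `r` as its compensated jumps.
  have hγm : (γ - 1) * m = γ - α := by rw [hγdef]; field_simp; ring
  obtain ⟨c, C, hc, hC, hcoer⟩ := hH.coercive
  obtain ⟨D, hD, hlat⟩ := exists_lattice_norm_le N
  have hW0 : 0 ≤ W := (abs_nonneg _).trans (hW 0 0 0 le_rfl le_rfl (by simp))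
  -- A shift in time gains at most `W`, so this penalty keeps the optimal time within `e` of `t`.
  set Q := (W + 1) / e ^ 2 with hQ
  have hQ0 : 0 < Q := by positivity
  have hQe : Q * e ^ 2 = W + 1 := by rw [hQ]; field_simp
  set Iα := ∫ z in Metric.ball (0 : Space N) 1, ‖z‖ ^ α ∂ν
  have hIα : 0 ≤ Iα := integral_nonneg fun z => by positivity
  set V := (ν (Metric.ball (0 : Space N) 1)ᶜ).toReal
  have hV : 0 ≤ V := ENNReal.toReal_nonneg
  have hCj := hA.pos
  set d := D ^ (γ - α) with hd
  have hd0 : 0 < d := by positivity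
  set Z := (C + Q) / d + 2 * Cj ^ α * Iα + D ^ γ * V / d with hZ
  have hZ0 : 0 ≤ Z := by positivity
  -- Since `m > 1`, the coercive term of order `K^m` beats the remaining terms, of order `K`, once
  -- `K^(m-1)` exceeds `Z / (c γ^m)`.
  set K := max 1 ((Z / (c * γ ^ m) + 1) ^ (1 / (m - 1))) with hKdef
  have hK1 : 1 ≤ K := le_max_left _ _
  have hK0 : 0 < K := by linarith
  have hKlarge : Z * K < c * (K * γ) ^ m := by
    have hcg : 0 < c * γ ^ m := by positivity
    have h1 : Z / (c * γ ^ m) + 1 ≤ K ^ (m - 1) := by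
      have := Real.rpow_le_rpow (by positivity)
        (le_max_right 1 ((Z / (c * γ ^ m) + 1) ^ (1 / (m - 1)))) hm1.le
      rwa [← Real.rpow_mul (by positivity), one_div_mul_cancel hm1.ne', Real.rpow_one] at this
    have h2 : Z < c * γ ^ m * K ^ (m - 1) := by
      have : Z / (c * γ ^ m) < K ^ (m - 1) := by linarith
      rw [div_lt_iff₀ hcg] at this
      linarith
    have h3 : K ^ m = K ^ (m - 1) * K := by
      rw [← Real.rpow_add_one' hK0.le (by linarith)]; ring_nf
    rw [Real.mul_rpow hK0.le hγ.le, h3]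
    have := mul_lt_mul_of_pos_right h2 hK0
    linarith
  clear_value K Q d
  refine ⟨K, hK0.le, fun x t ht => ?_⟩
  obtain ⟨⟨y₀, s₀⟩, ⟨hy₀, hs₀⟩, hmax⟩ := ((isCompact_closedBall x D).prod
    (isCompact_Icc (a := t - 1) (b := t + 1))).exists_isMaxOn
    ⟨(x, t), Metric.mem_closedBall_self hD.le, by constructor <;> linarith⟩
    (f := fun q : Space N × ℝ => u q.1 q.2 - K * ‖q.1 - x‖ ^ γ - Q * (q.2 - t) ^ 2) (by
      refine ((hu.cont.mono fun q hq => ⟨mem_univ _, ?_⟩).sub (Continuous.continuousOn ?_)).sub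
        (Continuous.continuousOn (by fun_prop))
      · have := hq.2.1; exact mem_Ici.2 (by linarith)
      · exact continuous_const.mul (Continuous.rpow_const (by fun_prop) fun _ => Or.inr hγ.le))
  simp only at hs₀
  have hy₀D : ‖y₀ - x‖ ≤ D := by simpa [dist_eq_norm] using hy₀
  have hball : ∀ y, ∀ s ∈ Icc (t - 1) (t + 1), ‖y - x‖ ≤ D →
      u y s - K * ‖y - x‖ ^ γ - Q * (s - t) ^ 2
        ≤ u y₀ s₀ - K * ‖y₀ - x‖ ^ γ - Q * (s₀ - t) ^ 2 := fun y s hs hy =>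
    hmax (show (y, s) ∈ Metric.closedBall x D ×ˢ Icc (t - 1) (t + 1) from
      ⟨by simpa [dist_eq_norm] using hy, hs⟩)
  have hper : ∀ y, ∀ s ∈ Icc (t - 1) (t + 1), ∃ y', ‖y' - x‖ ≤ D ∧ u y s = u y' s := by
    intro y s hs
    obtain ⟨k, hk⟩ := hlat x y
    exact ⟨y + lattice k, hk, (hu.periodic s (by linarith [hs.1]) k y).symm⟩
  -- By periodicity the penalty never needs to exceed `K D^γ`; this makes the maximum global in
  -- space and bounds the large jumps.
  have hfar : ∀ y, ∀ s ∈ Icc (t - 1) (t + 1), u y s - K * D ^ γ - Q * (s - t) ^ 2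
        ≤ u y₀ s₀ - K * ‖y₀ - x‖ ^ γ - Q * (s₀ - t) ^ 2 := by
    intro y s hs
    obtain ⟨y', hy', hyy⟩ := hper y s hs
    rw [hyy]
    refine le_trans ?_ (hball y' s hs hy')
    have : ‖y' - x‖ ^ γ ≤ D ^ γ := Real.rpow_le_rpow (norm_nonneg _) hy' hγ.le
    have := mul_le_mul_of_nonneg_left this hK0.le
    linarith
  have hglob : ∀ y, ∀ s ∈ Icc (t - 1) (t + 1),
      u y s - K * ‖y - x‖ ^ γ - Q * (s - t) ^ 2
        ≤ u y₀ s₀ - K * ‖y₀ - x‖ ^ γ - Q * (s₀ - t) ^ 2 := by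
    intro y s hs
    rcases le_total ‖y - x‖ D with hy | hy
    · exact hball y s hs hy
    · refine le_trans ?_ (hfar y s hs)
      have : D ^ γ ≤ ‖y - x‖ ^ γ := Real.rpow_le_rpow hD.le hy hγ.le
      have := mul_le_mul_of_nonneg_left this hK0.le
      linarith
  have htI : t ∈ Icc (t - 1) (t + 1) := by constructor <;> linarith
  have hst : |s₀ - t| ≤ e := by
    have h1 := hglob y₀ t htI
    have h2 := (abs_le.1 (hW y₀ s₀ t (by linarith [hs₀.1]) (by linarith)
      (by rw [abs_le]; constructor <;> linarith [hs₀.1, hs₀.2]))).2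
    have h3 : Q * (s₀ - t) ^ 2 ≤ Q * e ^ 2 := by
      rw [sub_self] at h1
      norm_num at h1
      linarith
    exact abs_le_of_sq_le_sq (le_of_mul_le_mul_left h3 hQ0) he.le
  refine ⟨s₀, hst, fun y => ?_⟩
  rcases eq_or_ne y₀ x with hyx | hyx
  · have h1 := hglob y t htI
    rw [hyx, sub_self, sub_self, norm_zero, Real.zero_rpow hγ.ne'] at h1
    have h2 : 0 ≤ Q * (s₀ - t) ^ 2 := by positivity
    norm_num at h1
    linarith
  -- A maximum away from the vertex of the cone admits a quadratic expansion, and the equation there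
  -- contradicts the choice of `K`.
  exfalso
  have hr : 0 < ‖y₀ - x‖ := norm_pos_iff.2 (sub_ne_zero.2 hyx)
  set r := ‖y₀ - x‖ with hrdef
  have hst' := abs_le.1 hst
  have hjet := hu.sub y₀ ((K * γ * r ^ (γ - 2)) • (y₀ - x)) s₀ (2 * Q * (s₀ - t))
    (K * γ * r ^ (γ - 2) / 2) Q (1 / 2) (by positivity) hQ0.le (by norm_num)
    (by linarith) (by
      intro y s hy hs
      have hs' := abs_le.1 hs
      have h1 := hglob y s (by constructor <;> linarith)
      have h2 := rpow_le_tangent hγ hγ1 hr (norm_nonneg (y - x))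
      have e1 : y - x = (y₀ - x) + (y - y₀) := by abel
      have e2 : ‖y - x‖ ^ 2 = r ^ 2 + 2 * inner ℝ (y₀ - x) (y - y₀) + ‖y - y₀‖ ^ 2 := by
        rw [e1, norm_add_sq_real]
      rw [e2] at h2
      have h3 := mul_le_mul_of_nonneg_left h2 hK0.le
      have e3 : (s - t) ^ 2 = (s₀ - t) ^ 2 + 2 * (s₀ - t) * (s - s₀) + (s - s₀) ^ 2 := by ring
      rw [e3] at h1
      rw [inner_smul_left, conj_trivial]
      linarith)
  set p := (K * γ * r ^ (γ - 2)) • (y₀ - x) with hp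
  have hpn : ‖p‖ = K * γ * r ^ (γ - 1) := by
    rw [hp, norm_smul, Real.norm_of_nonneg (by positivity), ← hrdef, mul_assoc,
      ← Real.rpow_add_one hr.ne']
    ring_nf
  obtain ⟨U, -, hU⟩ := hu.bounded (t + 1)
  have hs0 : 0 ≤ s₀ := by linarith
  have hincr : ∀ z, incr j (fun x => u x s₀) y₀ p z ≤
      if ‖z‖ < 1 then 2 * K * r ^ (γ - α) * Cj ^ α * ‖z‖ ^ α else K * D ^ γ := by
    intro z
    split_ifs with hz
    · have h1 := hglob (y₀ + j y₀ z) s₀ hs₀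
      have h2 := holder_increment_le (e := y₀ - x) (h := j y₀ z) hα1 hA.lt_two hγ hγ1 hK0.le hr
      rw [← hrdef, ← hp] at h2
      have e1 : y₀ + j y₀ z - x = y₀ - x + j y₀ z := by abel
      rw [e1] at h1
      have h3 : 2 * K * r ^ (γ - α) * ‖j y₀ z‖ ^ α
          ≤ 2 * K * r ^ (γ - α) * Cj ^ α * ‖z‖ ^ α := by
        rw [mul_assoc _ (Cj ^ α), ← Real.mul_rpow hCj.le (norm_nonneg _)]
        refine mul_le_mul_of_nonneg_left ?_ (by positivity)
        exact Real.rpow_le_rpow (norm_nonneg _) (hA.bound _ _) (by linarith)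
      unfold incr
      rw [indicator_of_mem (by simpa using hz)]
      linarith
    · have h1 := hfar (y₀ + j y₀ z) s₀ hs₀
      have h2 : 0 ≤ K * r ^ γ := by positivity
      unfold incr
      rw [indicator_of_notMem (by simpa using hz)]
      linarith
  have hlev : ∀ δ ∈ Ioc (0 : ℝ) 1, levyIto ν j (Metric.ball 0 δ)ᶜ (fun x => u x s₀) y₀ p
      ≤ 2 * K * r ^ (γ - α) * Cj ^ α * Iα + K * D ^ γ * V := by
    intro δ hδ
    have hi := hA.integrableOn_incr (hu.cont_slice hs0) (fun x => hU x s₀ ⟨hs0, hs₀.2⟩) y₀ p hδ.1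
    rw [levyIto_eq_incr, Admissible.integral_compl_ball_split hδ.2 hi]
    refine add_le_add ?_ ?_
    · have i1 : IntegrableOn (fun z : Space N => 2 * K * r ^ (γ - α) * Cj ^ α * ‖z‖ ^ α)
          (Metric.ball 0 1) ν := hA.core.const_mul _
      calc ∫ z in Metric.ball 0 1 \ Metric.ball 0 δ, incr j (fun x => u x s₀) y₀ p z ∂ν
          ≤ ∫ z in Metric.ball 0 1 \ Metric.ball 0 δ,
              2 * K * r ^ (γ - α) * Cj ^ α * ‖z‖ ^ α ∂ν := by
            refine setIntegral_mono_on (hi.mono_set fun z hz => hz.2) (i1.mono_set sdiff_subset)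
              (measurableSet_ball.diff measurableSet_ball) fun z hz => ?_
            have := hincr z
            rwa [if_pos (by simpa using hz.1)] at this
        _ ≤ ∫ z in Metric.ball 0 1, 2 * K * r ^ (γ - α) * Cj ^ α * ‖z‖ ^ α ∂ν :=
            setIntegral_mono_set i1 (Eventually.of_forall fun z => by positivity)
              sdiff_subset.eventuallyLE
        _ = _ := integral_const_mul _ _
    · calc ∫ z in (Metric.ball 0 1)ᶜ, incr j (fun x => u x s₀) y₀ p z ∂ν
          ≤ ∫ z in (Metric.ball (0 : Space N) 1)ᶜ, K * D ^ γ ∂ν := by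
            refine setIntegral_mono_on
              (hi.mono_set (compl_subset_compl.2 (Metric.ball_subset_ball hδ.2)))
              (integrableOn_const (hA.tail 1 one_pos).ne) measurableSet_ball.compl fun z hz => ?_
            have := hincr z
            rwa [if_neg (by simpa using hz)] at this
        _ = _ := by rw [setIntegral_const, smul_eq_mul, mul_comm]; rfl
  have hineq : 2 * Q * (s₀ - t) + H y₀ p
      ≤ 2 * K * r ^ (γ - α) * Cj ^ α * Iα + K * D ^ γ * V := by
    have hl := (hA.tendsto_smallMass.const_mul (K * γ * r ^ (γ - 2) / 2)).const_add
      (2 * K * r ^ (γ - α) * Cj ^ α * Iα + K * D ^ γ * V)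
    rw [mul_zero, add_zero] at hl
    refine ge_of_tendsto hl ?_
    obtain ⟨δ₀, h1, h2, h3, -⟩ := exists_delta hA one_pos one_pos
    filter_upwards [Ioc_mem_nhdsGT h1] with δ hδ
    have h4 := mul_le_mul_of_nonneg_left hδ.2 hCj.le
    have h5 := hjet δ hδ.1 (hδ.2.trans h2) (by linarith)
    have h6 := hlev δ ⟨hδ.1, hδ.2.trans h2⟩
    linarith
  have h1 := hcoer y₀ p
  have h2 : ‖p‖ ^ m = (K * γ) ^ m * r ^ (γ - α) := by
    rw [hpn, Real.mul_rpow (by positivity) (by positivity), ← Real.rpow_mul hr.le, hγm]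
  rw [h2] at h1
  -- The exponent is negative and `r ≤ D`, so the bounded terms can also be written as multiples of
  -- `r^(γ-α)`.
  have h3 : d ≤ r ^ (γ - α) := by
    rw [hd]
    exact Real.rpow_le_rpow_of_nonpos hr hy₀D (by linarith)
  set Rr := r ^ (γ - α)
  have hR0 : 0 < Rr := hd0.trans_le h3
  have h4 : -Q ≤ 2 * Q * (s₀ - t) := by
    have := mul_le_mul_of_nonneg_left (show -(1 / 2) ≤ s₀ - t by linarith)
      (show 0 ≤ 2 * Q by positivity)
    linarith
  have h5 : C + Q ≤ K * ((C + Q) / d) * Rr := by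
    have e1 : 0 ≤ (C + Q) / d := by positivity
    calc C + Q = (C + Q) / d * d := by field_simp
      _ ≤ (C + Q) / d * Rr := by gcongr
      _ = 1 * ((C + Q) / d) * Rr := by ring
      _ ≤ K * ((C + Q) / d) * Rr := by gcongr
  have h6 : K * D ^ γ * V ≤ K * (D ^ γ * V / d) * Rr := by
    calc K * D ^ γ * V = K * (D ^ γ * V / d) * d := by field_simp
      _ ≤ K * (D ^ γ * V / d) * Rr := by gcongr
  have h7 := mul_lt_mul_of_pos_right hKlarge hR0
  have h8 : Z * K * Rr = K * ((C + Q) / d) * Rr + 2 * K * Rr * Cj ^ α * Iα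
      + K * (D ^ γ * V / d) * Rr := by rw [hZ]; ring
  linarith

/-! ### Time shifts and stability under uniform limits -/

theorem JetSub.shift {u : Space N → ℝ → ℝ} (hu : JetSub ν j Cj H u) {h : ℝ} (hh : 0 ≤ h) :
    JetSub ν j Cj H (fun x t => u x (t + h)) := by
  intro x₀ p t₀ a C D ρ hC hD hρ hρt hjet
  refine hu x₀ p (t₀ + h) a C D ρ hC hD hρ (by linarith) fun x t hx ht => ?_
  have := hjet x (t - h) hx (by rwa [show t - h - t₀ = t - (t₀ + h) by ring])
  beta_reduce at this
  rwa [sub_add_cancel, show t - h - t₀ = t - (t₀ + h) by ring] at this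

theorem JetSub.add_const {u : Space N → ℝ → ℝ} (hu : JetSub ν j Cj H u) (b : ℝ) :
    JetSub ν j Cj H (fun x t => u x t + b) := by
  intro x₀ p t₀ a C D ρ hC hD hρ hρt hjet δ hδ hδ1 hδρ
  have := hu x₀ p t₀ a C D ρ hC hD hρ hρt (fun x t hx ht => by linarith [hjet x t hx ht])
    δ hδ hδ1 hδρ
  simpa only [levyIto, add_sub_add_right_eq_sub] using this

theorem Sol.shift {u : Space N → ℝ → ℝ} (hu : Sol ν j Cj H u) {h : ℝ} (hh : 0 ≤ h) :
    Sol ν j Cj H (fun x t => u x (t + h)) where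
  periodic t ht := hu.periodic (t + h) (by linarith)
  cont := hu.cont.comp (f := fun q : Space N × ℝ => (q.1, q.2 + h)) (by fun_prop)
    fun q hq => ⟨mem_univ _, by have := mem_Ici.1 hq.2; exact mem_Ici.2 (by simpa using by linarith)⟩
  sub := hu.sub.shift hh
  sup := hu.sup.shift hh

theorem Sol.add_const {u : Space N → ℝ → ℝ} (hu : Sol ν j Cj H u) (b : ℝ) :
    Sol ν j Cj H (fun x t => u x t + b) where
  periodic t ht k x := congrArg (· + b) (hu.periodic t ht k x)
  cont := hu.cont.add continuousOn_const
  sub := hu.sub.add_const b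
  sup := by simpa only [neg_add] using hu.sup.add_const (-b)

/-- Jumps in the region of a quadratic bound contribute at most the quadratic term. -/
theorem levyIto_compl_ball_le (hA : Admissible ν j Cj α) {w : Space N → ℝ} (hw : Continuous w)
    {U : ℝ} (hU : ∀ x, |w x| ≤ U) {x₀ p : Space N} {C ρ δ δ' : ℝ} (hC : 0 ≤ C)
    (hjet : ∀ x, ‖x - x₀‖ ≤ ρ → w x ≤ w x₀ + inner ℝ p (x - x₀) + C * ‖x - x₀‖ ^ 2)
    (hδ' : 0 < δ') (hδ : δ' ≤ δ) (hδ1 : δ ≤ 1) (hδρ : Cj * δ ≤ ρ) :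
    levyIto ν j (Metric.ball 0 δ')ᶜ w x₀ p
      ≤ levyIto ν j (Metric.ball 0 δ)ᶜ w x₀ p + C * smallMass ν Cj δ := by
  have hi := hA.integrableOn_incr hw hU x₀ p hδ'
  rw [levyIto_eq_incr, Admissible.integral_compl_ball_split hδ hi, levyIto_eq_incr, add_comm]
  gcongr
  calc ∫ z in Metric.ball 0 δ \ Metric.ball 0 δ', incr j w x₀ p z ∂ν
      ≤ ∫ z in Metric.ball 0 δ \ Metric.ball 0 δ', C * ‖j x₀ z‖ ^ 2 ∂ν := by
        refine setIntegral_mono_on (hi.mono_set fun z hz => hz.2)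
          (((hA.integrableOn_jump_sq x₀ hδ1).mono_set sdiff_subset).const_mul C)
          (measurableSet_ball.diff measurableSet_ball) fun z hz => ?_
        have h1 := hjet (x₀ + j x₀ z) (by
          rw [add_sub_cancel_left]; exact (hA.norm_lt hz.1 x₀).trans hδρ)
        rw [add_sub_cancel_left] at h1
        unfold incr
        rw [indicator_of_mem (Metric.ball_subset_ball hδ1 hz.1)]
        linarith
    _ = C * ∫ z in Metric.ball 0 δ \ Metric.ball 0 δ', ‖j x₀ z‖ ^ 2 ∂ν := integral_const_mul _ _
    _ ≤ C * smallMass ν Cj δ :=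
        mul_le_mul_of_nonneg_left (hA.integral_jump_sq_le x₀ hδ1 sdiff_subset) hC

theorem tendsto_incr {ι : Type*} {l : Filter ι} (hA : Admissible ν j Cj α)
    {w : ι → Space N → ℝ} {w₀ : Space N → ℝ} {X P : ι → Space N} {x p : Space N}
    (hw : ∀ (Y : ι → Space N) (y : Space N), Tendsto Y l (𝓝 y) →
      Tendsto (fun n => w n (Y n)) l (𝓝 (w₀ y)))
    (hX : Tendsto X l (𝓝 x)) (hP : Tendsto P l (𝓝 p)) (z : Space N) :
    Tendsto (fun n => incr j (w n) (X n) (P n) z) l (𝓝 (incr j w₀ x p z)) := by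
  have hJ : Tendsto (fun n => j (X n) z) l (𝓝 (j x z)) := ((hA.cont z).tendsto x).comp hX
  have h1 := (hw _ _ (hX.add hJ)).sub (hw _ _ hX)
  unfold incr
  by_cases hz : z ∈ Metric.ball (0 : Space N) 1
  · simp only [indicator_of_mem hz]
    exact h1.sub (hP.inner hJ)
  · simp only [indicator_of_notMem hz]
    exact h1.sub tendsto_const_nhds

/-- Stability of subsolutions under uniform convergence. -/
theorem JetSub.of_uniform_limit (hA : Admissible ν j Cj α)
    (hH : Continuous (fun q : Space N × Space N => H q.1 q.2))
    {v : ℕ → Space N → ℝ → ℝ} {u : Space N → ℝ → ℝ} (hv : ∀ n, JetSub ν j Cj H (v n))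
    (hvc : ∀ n, ContinuousOn (fun q : Space N × ℝ => v n q.1 q.2) (univ ×ˢ Ici 0))
    (huc : ContinuousOn (fun q : Space N × ℝ => u q.1 q.2) (univ ×ˢ Ici 0))
    (hub : ∀ T, ∃ U, ∀ x, ∀ t ∈ Icc 0 T, |u x t| ≤ U)
    (hlim : ∀ ε > 0, ∃ n, ∀ x t, 0 ≤ t → |v n x t - u x t| ≤ ε) :
    JetSub ν j Cj H u := by
  intro x₀ p t₀ a C D ρ hC hD hρ hρt hjet δ hδ hδ1 hδρ
  have ht₀ : 0 < t₀ := hρ.trans hρt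
  have slice : ∀ {f : Space N → ℝ → ℝ},
      ContinuousOn (fun q : Space N × ℝ => f q.1 q.2) (univ ×ˢ Ici 0) →
      ∀ {t : ℝ}, 0 ≤ t → Continuous fun x => f x t := by
    intro f hf t ht
    rw [← continuousOn_univ]
    exact hf.comp (f := fun x : Space N => (x, t)) (by fun_prop) fun x _ => ⟨mem_univ _, ht⟩
  -- maximum points of the perturbed problem
  have hstep : ∀ ε, 0 < ε → 2 * ε ≤ (ρ / 2) ^ 2 → ∃ n x t,
      (∀ x t, 0 ≤ t → |v n x t - u x t| ≤ ε) ∧ ‖x - x₀‖ ^ 2 + (t - t₀) ^ 2 ≤ 2 * ε ∧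
      ∀ δ', 0 < δ' → δ' ≤ 1 → Cj * δ' ≤ ρ / 4 →
        a + 2 * (D + 1) * (t - t₀) + H x (p + (2 * (C + 1)) • (x - x₀))
          ≤ levyIto ν j (Metric.ball 0 δ')ᶜ (fun x => v n x t) x (p + (2 * (C + 1)) • (x - x₀))
            + (C + 1) * smallMass ν Cj δ' := by
    intro ε hε hερ
    obtain ⟨n, hn⟩ := hlim ε hε
    -- Raising both curvatures by `1` makes the maximum of `u - q` strict, so an `ε`-perturbation
    -- moves it by at most `sqrt (2 ε)`.
    let q : Space N × ℝ → ℝ := fun X => u x₀ t₀ + inner ℝ p (X.1 - x₀) + a * (X.2 - t₀)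
      + (C + 1) * ‖X.1 - x₀‖ ^ 2 + (D + 1) * (X.2 - t₀) ^ 2
    have hqc : Continuous q := by fun_prop
    obtain ⟨⟨x, t⟩, ⟨hx, ht⟩, hmax⟩ := ((isCompact_closedBall x₀ ρ).prod
      (isCompact_Icc (a := t₀ - ρ) (b := t₀ + ρ))).exists_isMaxOn
      ⟨(x₀, t₀), Metric.mem_closedBall_self hρ.le, by constructor <;> linarith⟩
      (f := fun X : Space N × ℝ => v n X.1 X.2 - q X)
      (((hvc n).mono fun X hX => ⟨mem_univ _, by
        have := hX.2.1; exact mem_Ici.2 (by linarith)⟩).sub hqc.continuousOn)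
    simp only at ht
    have hx' : ‖x - x₀‖ ≤ ρ := by simpa [dist_eq_norm] using hx
    have hmax' : ∀ x' t', ‖x' - x₀‖ ≤ ρ → |t' - t₀| ≤ ρ →
        v n x' t' - q (x', t') ≤ v n x t - q (x, t) := fun x' t' hx' ht' =>
      hmax (show (x', t') ∈ Metric.closedBall x₀ ρ ×ˢ Icc (t₀ - ρ) (t₀ + ρ) from
        ⟨by simpa [dist_eq_norm] using hx', by
          have := abs_le.1 ht'; constructor <;> simp only <;> linarith⟩)
    have hclose : ‖x - x₀‖ ^ 2 + (t - t₀) ^ 2 ≤ 2 * ε := by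
      have h1 := hmax' x₀ t₀ (by simpa using hρ.le) (by simpa using hρ.le)
      have h2 := (abs_le.1 (hn x₀ t₀ ht₀.le)).1
      have h3 := (abs_le.1 (hn x t (by linarith [ht.1]))).2
      have h4 := hjet x t hx' (by rw [abs_le]; constructor <;> linarith [ht.1, ht.2])
      simp only [q, sub_self, inner_zero_right, norm_zero] at h1
      norm_num at h1
      linarith
    have hxr : ‖x - x₀‖ ≤ ρ / 2 :=
      (abs_le_of_sq_le_sq' (by linarith [sq_nonneg (t - t₀)]) (by linarith)).2
    have htr : |t - t₀| ≤ ρ / 2 :=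
      abs_le_of_sq_le_sq (by linarith [sq_nonneg ‖x - x₀‖]) (by linarith)
    refine ⟨n, x, t, hn, hclose, fun δ' h1 h2 h3 => ?_⟩
    have htr' := abs_le.1 htr
    refine hv n x (p + (2 * (C + 1)) • (x - x₀)) t (a + 2 * (D + 1) * (t - t₀)) (C + 1) (D + 1)
      (ρ / 2) (by linarith) (by linarith) (by linarith) (by linarith) (fun x' t' hx' ht' => ?_)
      δ' h1 h2 (by linarith)
    have ht'' := abs_le.1 ht'
    have h4 := hmax' x' t' (by
      calc ‖x' - x₀‖ = ‖(x' - x) + (x - x₀)‖ := by congr 1; abel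
        _ ≤ ‖x' - x‖ + ‖x - x₀‖ := norm_add_le _ _
        _ ≤ ρ := by linarith) (by rw [abs_le]; constructor <;> linarith)
    have e1 : x' - x₀ = (x - x₀) + (x' - x) := by abel
    have e2 : ‖x' - x₀‖ ^ 2
        = ‖x - x₀‖ ^ 2 + 2 * inner ℝ (x - x₀) (x' - x) + ‖x' - x‖ ^ 2 := by
      rw [e1, norm_add_sq_real]
    have e3 : (inner ℝ p (x' - x₀) : ℝ) = inner ℝ p (x - x₀) + inner ℝ p (x' - x) := by
      rw [e1, inner_add_right]
    have e4 : (t' - t₀) ^ 2 = (t - t₀) ^ 2 + 2 * (t - t₀) * (t' - t) + (t' - t) ^ 2 := by ring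
    simp only [q, e2, e3, e4] at h4
    rw [inner_add_left, inner_smul_left, conj_trivial]
    linarith
  -- the limit for fixed small `δ'`
  have hsmall : ∀ δ', 0 < δ' → δ' ≤ 1 → Cj * δ' ≤ ρ / 4 →
      a + H x₀ p ≤ levyIto ν j (Metric.ball 0 δ')ᶜ (fun x => u x t₀) x₀ p
        + (C + 1) * smallMass ν Cj δ' := by
    intro δ' h1 h2 h3
    obtain ⟨U, hU⟩ := hub (t₀ + ρ)
    set ε : ℕ → ℝ := fun k => min 1 ((ρ / 2) ^ 2 / 2) * (1 / ((k : ℝ) + 1)) with hε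
    have hm0 : 0 < min 1 ((ρ / 2) ^ 2 / 2) := lt_min one_pos (by positivity)
    have hεlim : Tendsto ε atTop (𝓝 0) := by
      have := (tendsto_one_div_add_atTop_nhds_zero_nat (𝕜 := ℝ)).const_mul
        (min 1 ((ρ / 2) ^ 2 / 2))
      rwa [mul_zero] at this
    have hεle : ∀ k, ε k ≤ min 1 ((ρ / 2) ^ 2 / 2) := fun k => by
      have : 1 / ((k : ℝ) + 1) ≤ 1 := by
        rw [div_le_one (by positivity)]; linarith [(Nat.cast_nonneg k : (0 : ℝ) ≤ k)]
      simpa [hε] using mul_le_mul_of_nonneg_left this hm0.le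
    have hε0 : ∀ k, 0 < ε k := fun k => by positivity
    have hερ : ∀ k, 2 * ε k ≤ (ρ / 2) ^ 2 := fun k => by
      have := (hεle k).trans (min_le_right _ _); linarith
    choose n X T hn hXT hineq using fun k => hstep (ε k) (hε0 k) (hερ k)
    have hsq : Tendsto (fun k => Real.sqrt (2 * ε k)) atTop (𝓝 0) := by
      have := (hεlim.const_mul 2).sqrt
      simpa using this
    have hXle : ∀ k, ‖X k - x₀‖ ≤ Real.sqrt (2 * ε k) := fun k =>
      Real.le_sqrt_of_sq_le (by linarith [hXT k, sq_nonneg (T k - t₀)])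
    have hTle : ∀ k, |T k - t₀| ≤ Real.sqrt (2 * ε k) := fun k =>
      Real.abs_le_sqrt (by linarith [hXT k, sq_nonneg ‖X k - x₀‖])
    have hsqle : ∀ k, Real.sqrt (2 * ε k) ≤ ρ / 2 := fun k =>
      (Real.sqrt_le_left (by linarith)).2 (hερ k)
    have lX : Tendsto X atTop (𝓝 x₀) := by
      rw [tendsto_iff_norm_sub_tendsto_zero]
      exact squeeze_zero (fun _ => norm_nonneg _) hXle hsq
    have lT : Tendsto T atTop (𝓝 t₀) := by
      rw [tendsto_iff_norm_sub_tendsto_zero]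
      exact squeeze_zero (fun _ => norm_nonneg _) hTle hsq
    have hTI : ∀ k, T k ∈ Icc 0 (t₀ + ρ) := fun k => by
      have := abs_le.1 ((hTle k).trans (hsqle k)); constructor <;> linarith
    have lP : Tendsto (fun k => p + (2 * (C + 1)) • (X k - x₀)) atTop (𝓝 p) := by
      have := ((lX.sub_const x₀).const_smul (2 * (C + 1))).const_add p
      simpa using this
    have lw : ∀ (Y : ℕ → Space N) (y : Space N), Tendsto Y atTop (𝓝 y) →
        Tendsto (fun k => v (n k) (Y k) (T k)) atTop (𝓝 (u y t₀)) := by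
      intro Y y hY
      have h4 : Tendsto (fun k => u (Y k) (T k)) atTop (𝓝 (u y t₀)) :=
        ((huc.continuousAt (prod_mem_nhds univ_mem (Ici_mem_nhds ht₀))).tendsto (x := (y, t₀))).comp
          (hY.prodMk_nhds lT)
      have h5 : Tendsto (fun k => v (n k) (Y k) (T k) - u (Y k) (T k)) atTop (𝓝 0) :=
        squeeze_zero_norm (fun k => hn k (Y k) (T k) (hTI k).1) hεlim
      simpa using h5.add h4
    have hvU : ∀ k x, |v (n k) x (T k)| ≤ U + 1 := fun k x => by
      have h4 := abs_le.1 (hU x (T k) (hTI k))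
      have h5 := abs_le.1 ((hn k x (T k) (hTI k).1).trans ((hεle k).trans (min_le_left _ _)))
      rw [abs_le]; constructor <;> linarith
    have hPle : ∀ k, ‖p + (2 * (C + 1)) • (X k - x₀)‖ ≤ ‖p‖ + 2 * (C + 1) * ρ := fun k => by
      refine (norm_add_le _ _).trans ?_
      rw [norm_smul, Real.norm_of_nonneg (by positivity)]
      have := (hXle k).trans (hsqle k)
      gcongr
      linarith
    have lI : Tendsto (fun k => levyIto ν j (Metric.ball 0 δ')ᶜ (fun x => v (n k) x (T k)) (X k)
        (p + (2 * (C + 1)) • (X k - x₀))) atTop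
        (𝓝 (levyIto ν j (Metric.ball 0 δ')ᶜ (fun x => u x t₀) x₀ p)) := by
      simp only [levyIto_eq_incr]
      refine tendsto_integral_of_dominated_convergence
        (fun _ => 2 * (U + 1) + (‖p‖ + 2 * (C + 1) * ρ) * Cj) ?_ ?_ ?_ ?_
      · intro k
        exact (hA.measurable_incr (slice (hvc _) (hTI k).1) _ _).aestronglyMeasurable
      · exact integrableOn_const (hA.tail δ' h1).ne
      · intro k
        refine Eventually.of_forall fun z => (hA.abs_incr_le (hvU k) _ _ z).trans ?_
        have := hA.pos
        gcongr
        exact hPle k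
      · exact Eventually.of_forall fun z => tendsto_incr hA lw lX lP z
    have lH : Tendsto (fun k => H (X k) (p + (2 * (C + 1)) • (X k - x₀))) atTop (𝓝 (H x₀ p)) :=
      (hH.tendsto (x₀, p)).comp (lX.prodMk_nhds lP)
    have la : Tendsto (fun k => a + 2 * (D + 1) * (T k - t₀)) atTop (𝓝 a) := by
      have := ((lT.sub_const t₀).const_mul (2 * (D + 1))).const_add a
      simpa using this
    exact le_of_tendsto_of_tendsto' (la.add lH) (lI.add_const _)
      fun k => hineq k δ' h1 h2 h3
  -- It remains to recover `C` and the radius `δ`: the original expansion bounds the jumps between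
  -- `δ'` and `δ` by `C`, and the term in `C + 1` vanishes as `δ' → 0`.
  obtain ⟨U, hU⟩ := hub t₀
  have hl := (hA.tendsto_smallMass.const_mul (C + 1)).const_add
    (levyIto ν j (Metric.ball 0 δ)ᶜ (fun x => u x t₀) x₀ p + C * smallMass ν Cj δ)
  rw [mul_zero, add_zero] at hl
  refine ge_of_tendsto hl ?_
  obtain ⟨δ₀, d1, d2, d3, d4⟩ := exists_delta hA hρ hδ
  filter_upwards [Ioc_mem_nhdsGT d1] with δ' hδ'
  have h4 := mul_le_mul_of_nonneg_left hδ'.2 hA.pos.le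
  have h5 := hsmall δ' hδ'.1 (hδ'.2.trans d2) (by linarith)
  have h6 := levyIto_compl_ball_le hA (slice huc ht₀.le) (fun x => hU x t₀ ⟨ht₀.le, le_rfl⟩)
    (x₀ := x₀) (p := p) hC (ρ := ρ) (fun x hx => by
      have := hjet x t₀ hx (by simpa using hρ.le)
      simpa using this) hδ'.1 (hδ'.2.trans d4) hδ1 (by linarith)
  linarith

theorem Sol.of_uniform_limit (hA : Admissible ν j Cj α)
    (hH : Continuous (fun q : Space N × Space N => H q.1 q.2))
    {v : ℕ → Space N → ℝ → ℝ} {u : Space N → ℝ → ℝ} (hv : ∀ n, Sol ν j Cj H (v n))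
    (hlim : ∀ ε > 0, ∀ᶠ n in atTop, ∀ x t, 0 ≤ t → |v n x t - u x t| ≤ ε) :
    Sol ν j Cj H u := by
  have hper : ∀ t : ℝ, 0 ≤ t → Periodic (fun x => u x t) := by
    intro t ht k x
    have hpt : ∀ x, Tendsto (fun n => v n x t) atTop (𝓝 (u x t)) := fun x =>
      Metric.tendsto_atTop'.2 fun ε hε => by
        obtain ⟨n₀, hn₀⟩ := eventually_atTop.1 (hlim (ε / 2) (half_pos hε))
        exact ⟨n₀, fun n hn => by
          rw [Real.dist_eq]; linarith [hn₀ n hn.le x t ht]⟩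
    refine tendsto_nhds_unique (hpt (x + lattice k)) ?_
    have e : ∀ n, v n (x + lattice k) t = v n x t := fun n => (hv n).periodic t ht k x
    simpa only [e] using hpt x
  have hc : ContinuousOn (fun q : Space N × ℝ => u q.1 q.2) (univ ×ˢ Ici 0) := by
    refine TendstoUniformlyOn.continuousOn (F := fun n (q : Space N × ℝ) => v n q.1 q.2)
      (p := atTop) ?_ (Frequently.of_forall fun n => (hv n).cont)
    rw [Metric.tendstoUniformlyOn_iff]
    intro ε hε
    filter_upwards [hlim (ε / 2) (half_pos hε)] with n hn q hq
    rw [dist_comm, Real.dist_eq]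
    linarith [hn q.1 q.2 hq.2]
  have hb : ∀ T, ∃ U, ∀ x, ∀ t ∈ Icc 0 T, |u x t| ≤ U := by
    intro T
    obtain ⟨n, hn⟩ := (hlim 1 one_pos).exists
    obtain ⟨U, -, hU⟩ := (hv n).bounded T
    refine ⟨U + 1, fun x t ht => ?_⟩
    have h1 := abs_le.1 (hn x t ht.1)
    have h2 := abs_le.1 (hU x t ht)
    rw [abs_le]; constructor <;> linarith
  refine ⟨hper, hc, ?_, ?_⟩
  · exact JetSub.of_uniform_limit hA hH (fun n => (hv n).sub) (fun n => (hv n).cont) hc hb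
      fun ε hε => (hlim ε hε).exists
  · refine JetSub.of_uniform_limit hA ?_ (fun n => (hv n).sup) (fun n => (hv n).cont.neg) hc.neg
      (fun T => ?_) fun ε hε => ?_
    · unfold negHam
      have : Continuous fun q : Space N × Space N => (q.1, -q.2) := by fun_prop
      exact (hH.comp this).neg
    · obtain ⟨U, hU⟩ := hb T
      exact ⟨U, fun x t ht => by rw [abs_neg]; exact hU x t ht⟩
    · obtain ⟨n, hn⟩ := (hlim ε hε).exists
      refine ⟨n, fun x t ht => ?_⟩
      rw [show -v n x t - -u x t = -(v n x t - u x t) by ring, abs_neg]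
      exact hn x t ht

/-! ### From the evolution equation to the ergodic problem -/

/-- Second order Taylor bound at a point. -/
theorem exists_taylor_bound {φ : Space N → ℝ} (hφ : ContDiff ℝ 2 φ) (x₀ : Space N) :
    ∃ C ρ : ℝ, 0 ≤ C ∧ 0 < ρ ∧ ∀ x, ‖x - x₀‖ ≤ ρ →
      |φ x - φ x₀ - inner ℝ (gradient φ x₀) (x - x₀)| ≤ C * ‖x - x₀‖ ^ 2 := by
  have hd : Differentiable ℝ φ := hφ.differentiable (by norm_num)
  have hfd : ContDiff ℝ 1 (fderiv ℝ φ) := hφ.fderiv_right (by norm_num)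
  obtain ⟨K, s, hs, hK⟩ := hfd.contDiffAt.exists_lipschitzOnWith (x := x₀)
  obtain ⟨ρ, hρ, hρs⟩ := Metric.nhds_basis_closedBall.mem_iff.1 hs
  refine ⟨K, ρ, K.2, hρ, fun x hx => ?_⟩
  have h1 := (convex_closedBall x₀ ‖x - x₀‖).norm_image_sub_le_of_norm_hasFDerivWithin_le'
    (f := φ) (f' := fderiv ℝ φ) (φ := fderiv ℝ φ x₀) (C := K * ‖x - x₀‖) (x := x₀) (y := x)
    (fun y _ => (hd y).hasFDerivAt.hasFDerivWithinAt) (fun y hy => by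
      have hy' : ‖y - x₀‖ ≤ ‖x - x₀‖ := by simpa [dist_eq_norm] using hy
      have := hK.dist_le_mul y (hρs (by simpa [dist_eq_norm] using hy'.trans hx)) x₀
        (hρs (Metric.mem_closedBall_self hρ.le))
      rw [dist_eq_norm, dist_eq_norm] at this
      exact this.trans (mul_le_mul_of_nonneg_left hy' K.2))
    (Metric.mem_closedBall_self (norm_nonneg _)) (by simp [dist_eq_norm])
  rw [← toDual_gradient, InnerProductSpace.toDual_apply_apply, Real.norm_eq_abs] at h1
  refine h1.trans (le_of_eq ?_)
  ring

/-- The Taylor bound turns a test function into an expansion with a worse quadratic constant. This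
costs only a multiple of the mass of the jumps in `B_δ'`, which vanishes as `δ' → 0`; between `δ'`
and `δ` the maximum property allows `w` to be replaced by `φ`. -/
theorem IsErgodicSubsolution.of_jetSub (hA : Admissible ν j Cj α) {w : Space N → ℝ} {c : ℝ}
    (hwc : Continuous w) (hwb : ∃ U, ∀ x, |w x| ≤ U)
    (hw : JetSub ν j Cj H (fun x t => w x + c * t)) : IsErgodicSubsolution ν j H w c := by
  refine ⟨hwb, hwc.upperSemicontinuous, fun φ hφ x₀ hmax δ hδ => ?_⟩
  obtain ⟨U, hU⟩ := hwb
  obtain ⟨C, ρ, hC, hρ, hT⟩ := exists_taylor_bound hφ x₀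
  set p := gradient φ x₀
  have hφm : Measurable (incr j φ x₀ p) := hA.measurable_incr hφ.continuous x₀ p
  obtain ⟨δ₀, d1, d2, d3, d4⟩ := exists_delta hA (lt_min hρ one_pos) hδ
  have hmin1 : min ρ 1 ≤ ρ := min_le_left _ _
  have hmin2 : min ρ 1 ≤ 1 := min_le_right _ _
  have hmin0 : 0 < min ρ 1 := lt_min hρ one_pos
  have hsmallφ : ∀ δ' ≤ δ₀, ∀ z ∈ Metric.ball (0 : Space N) δ',
      |incr j φ x₀ p z| ≤ C * ‖j x₀ z‖ ^ 2 := by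
    intro δ' hδ' z hz
    have hz0 := Metric.ball_subset_ball hδ' hz
    have h1 := hT (x₀ + j x₀ z) (by
      rw [add_sub_cancel_left]; linarith [hA.norm_lt hz0 x₀])
    rw [add_sub_cancel_left] at h1
    unfold incr
    rwa [indicator_of_mem (Metric.ball_subset_ball d2 hz0)]
  have hφi0 : ∀ δ' ≤ δ₀, IntegrableOn (incr j φ x₀ p) (Metric.ball 0 δ') ν := by
    intro δ' hδ'
    refine Integrable.mono' ((hA.integrableOn_jump_sq x₀ (hδ'.trans d2)).const_mul C)
      hφm.aestronglyMeasurable ?_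
    filter_upwards [ae_restrict_mem measurableSet_ball] with z hz using hsmallφ δ' hδ' z hz
  have hφi1 : ∀ δ', 0 < δ' → IntegrableOn (incr j φ x₀ p)
      (Metric.ball 0 δ \ Metric.ball 0 δ') ν := by
    intro δ' hδ'
    obtain ⟨B, hB⟩ := (isCompact_closedBall x₀ (Cj * δ)).exists_bound_of_continuousOn
      hφ.continuous.continuousOn
    refine Measure.integrableOn_of_bounded (M := 2 * B + ‖p‖ * (Cj * δ))
      ((measure_mono fun z hz => hz.2).trans_lt (hA.tail δ' hδ')).ne hφm.aestronglyMeasurable ?_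
    filter_upwards [ae_restrict_mem (measurableSet_ball.diff measurableSet_ball)] with z hz
    have hjz := hA.norm_lt hz.1 x₀
    have h1 := abs_le.1 (hB (x₀ + j x₀ z) (by simpa [dist_eq_norm] using hjz))
    have h2 := abs_le.1 (hB x₀ (Metric.mem_closedBall_self
      (mul_nonneg hA.pos.le hδ.le)))
    have h3 : |(Metric.ball (0 : Space N) 1).indicator (fun z => inner ℝ p (j x₀ z)) z|
        ≤ ‖p‖ * (Cj * δ) := by
      by_cases hz1 : z ∈ Metric.ball (0 : Space N) 1
      · rw [indicator_of_mem hz1]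
        exact (abs_real_inner_le_norm _ _).trans (mul_le_mul_of_nonneg_left hjz (norm_nonneg _))
      · rw [indicator_of_notMem hz1, abs_zero]
        exact mul_nonneg (norm_nonneg _) (mul_nonneg hA.pos.le hδ.le)
    have h3 := abs_le.1 h3
    unfold incr
    rw [Real.norm_eq_abs, abs_le]
    constructor <;> linarith
  have hkey : ∀ δ' ∈ Ioc 0 δ₀, c - levyItoSplit ν j δ φ w x₀ + H x₀ p
      ≤ 2 * (C * smallMass ν Cj δ') := by
    intro δ' hδ'
    have hδ'δ : δ' ≤ δ := hδ'.2.trans d4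
    have h4 := mul_le_mul_of_nonneg_left hδ'.2 hA.pos.le
    -- The time `1` is arbitrary, as `w + ct` has slope `c` at every time; the radius is below `1`
    -- to remain in positive times.
    have h1 := hw x₀ p 1 c C 0 (min ρ 1 / 2) hC le_rfl (by linarith) (by linarith) (by
      intro x t hx _
      have h2 := (abs_le.1 (hT x (by linarith))).2
      have h3 := hmax x
      linarith) δ' hδ'.1 (hδ'.2.trans d2) (by linarith)
    have e0 : levyIto ν j (Metric.ball 0 δ')ᶜ (fun x => w x + c * 1) x₀ p
        = levyIto ν j (Metric.ball 0 δ')ᶜ w x₀ p := by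
      simp only [levyIto, add_sub_add_right_eq_sub]
    simp only [e0] at h1
    have hwi := hA.integrableOn_incr hwc hU x₀ p hδ'.1
    have h2 : levyIto ν j (Metric.ball 0 δ')ᶜ w x₀ p
        = ∫ z in Metric.ball 0 δ \ Metric.ball 0 δ', incr j w x₀ p z ∂ν
          + levyIto ν j (Metric.ball 0 δ)ᶜ w x₀ p :=
      Admissible.integral_compl_ball_split hδ'δ hwi
    have h3 : ∫ z in Metric.ball 0 δ \ Metric.ball 0 δ', incr j w x₀ p z ∂ν
        ≤ ∫ z in Metric.ball 0 δ \ Metric.ball 0 δ', incr j φ x₀ p z ∂ν := by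
      refine setIntegral_mono (hwi.mono_set fun z hz => hz.2) (hφi1 δ' hδ'.1) fun z => ?_
      have := hmax (x₀ + j x₀ z)
      simp only [incr]
      linarith
    have h5 : levyIto ν j (Metric.ball 0 δ) φ x₀ p
        = ∫ z in Metric.ball 0 δ', incr j φ x₀ p z ∂ν
          + ∫ z in Metric.ball 0 δ \ Metric.ball 0 δ', incr j φ x₀ p z ∂ν := by
      rw [levyIto_eq_incr, ← setIntegral_union disjoint_sdiff_right
        (measurableSet_ball.diff measurableSet_ball) (hφi0 δ' hδ'.2) (hφi1 δ' hδ'.1),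
        union_sdiff_cancel (Metric.ball_subset_ball hδ'δ)]
    have h6 : -(C * smallMass ν Cj δ') ≤ ∫ z in Metric.ball 0 δ', incr j φ x₀ p z ∂ν := by
      have i1 := (hA.integrableOn_jump_sq x₀ (hδ'.2.trans d2)).const_mul C
      calc -(C * smallMass ν Cj δ') ≤ -(C * ∫ z in Metric.ball 0 δ', ‖j x₀ z‖ ^ 2 ∂ν) :=
            neg_le_neg (mul_le_mul_of_nonneg_left
              (hA.integral_jump_sq_le x₀ (hδ'.2.trans d2) Subset.rfl) hC)
        _ = ∫ z in Metric.ball 0 δ', -(C * ‖j x₀ z‖ ^ 2) ∂ν := by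
            rw [integral_neg, integral_const_mul]
        _ ≤ _ := setIntegral_mono_on i1.neg (hφi0 δ' hδ'.2) measurableSet_ball
            fun z hz => (abs_le.1 (hsmallφ δ' hδ'.2 z hz)).1
    unfold levyItoSplit
    linarith
  have hl := ((hA.tendsto_smallMass.const_mul C).const_mul 2)
  rw [mul_zero, mul_zero] at hl
  have := ge_of_tendsto hl (by
    filter_upwards [Ioc_mem_nhdsGT d1] with δ' hδ' using hkey δ' hδ')
  linarith

theorem IsErgodicSolution.of_sol (hA : Admissible ν j Cj α) {w : Space N → ℝ} {c : ℝ}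
    (hw : Sol ν j Cj H (fun x t => w x + c * t)) : IsErgodicSolution ν j H w c := by
  have hwc : Continuous w := by simpa using hw.cont_slice le_rfl
  have hwb : ∃ U, ∀ x, |w x| ≤ U := by
    obtain ⟨U, -, hU⟩ := hw.bounded 0
    exact ⟨U, fun x => by simpa using hU x 0 ⟨le_rfl, le_rfl⟩⟩
  have hsup : IsErgodicSubsolution ν j (negHam H) (fun x => -w x) (-c) := by
    refine IsErgodicSubsolution.of_jetSub hA hwc.neg ?_ ?_
    · obtain ⟨U, hU⟩ := hwb
      exact ⟨U, fun x => by rw [abs_neg]; exact hU x⟩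
    · simpa only [neg_add, neg_mul] using hw.sup
  refine ⟨fun k x => by simpa using hw.periodic 0 le_rfl k x, hwc,
    IsErgodicSubsolution.of_jetSub hA hwc hwb hw.sub, hwb, hwc.lowerSemicontinuous,
    fun φ hφ x₀ hmin δ hδ => ?_⟩
  have h1 := hsup.2.2 (fun x => -φ x) hφ.neg x₀ (fun x => by linarith [hmin x]) δ hδ
  rw [levyItoSplit_neg, gradient_fun_neg, negHam] at h1
  simp only [neg_neg] at h1
  linarith

/-! ### Estimates uniform in time and the ergodic constant -/

variable {m A b₀ : ℝ} {ζ₁ ζ₂ : ℝ → ℝ}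

theorem JetSub.congr {u v : Space N → ℝ → ℝ} (hu : JetSub ν j Cj H u)
    (h : ∀ x t, 0 ≤ t → u x t = v x t) : JetSub ν j Cj H v := by
  intro x₀ p t₀ a C D ρ hC hD hρ hρt hjet δ hδ hδ1 hδρ
  have ht₀ : 0 ≤ t₀ := by linarith
  have := hu x₀ p t₀ a C D ρ hC hD hρ hρt (fun x t hx ht => by
    have := abs_le.1 ht
    rw [h x t (by linarith), h x₀ t₀ ht₀]
    exact hjet x t hx ht) δ hδ hδ1 hδρ
  simpa only [h _ t₀ ht₀] using this

theorem Sol.congr {u v : Space N → ℝ → ℝ} (hu : Sol ν j Cj H u)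
    (h : ∀ x t, 0 ≤ t → u x t = v x t) : Sol ν j Cj H v where
  periodic t ht := by simpa only [h _ t ht] using hu.periodic t ht
  cont := hu.cont.congr fun q hq => (h q.1 q.2 hq.2).symm
  sub := hu.sub.congr h
  sup := hu.sup.congr fun x t ht => by rw [h x t ht]

theorem abs_comparison (hA : Admissible ν j Cj α) (hH : HamCond H m A b₀ ζ₁ ζ₂)
    {u v : Space N → ℝ → ℝ} (hu : Sol ν j Cj H u) (hv : Sol ν j Cj H v) {M : ℝ}
    (h0 : ∀ x, |u x 0 - v x 0| ≤ M) {t : ℝ} (ht : 0 ≤ t) (x : Space N) :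
    |u x t - v x t| ≤ M := by
  have h1 := comparison hA hH hu hv (fun x => (abs_le.1 (h0 x)).2) ht x
  have h2 := comparison hA hH hv hu (M := M) (fun x => by linarith [(abs_le.1 (h0 x)).1]) ht x
  rw [abs_le]; constructor <;> linarith

/-- A time shift of a solution is a solution, so contraction controls time increments by those at
the initial time. Continuity on `[0, 1]` thus gives a modulus in time on all of `[0, ∞)`. -/
theorem Sol.time_shift_le (hA : Admissible ν j Cj α) (hH : HamCond H m A b₀ ζ₁ ζ₂)
    {u : Space N → ℝ → ℝ} (hu : Sol ν j Cj H u) {h M : ℝ} (hh : 0 ≤ h)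
    (h0 : ∀ x, |u x h - u x 0| ≤ M) (x : Space N) {t : ℝ} (ht : 0 ≤ t) :
    |u x (t + h) - u x t| ≤ M :=
  abs_comparison hA hH (hu.shift hh) hu (fun x => by simpa using h0 x) ht x

theorem Sol.time_shift_abs (hA : Admissible ν j Cj α) (hH : HamCond H m A b₀ ζ₁ ζ₂)
    {u : Space N → ℝ → ℝ} (hu : Sol ν j Cj H u) {d M : ℝ}
    (h0 : ∀ x, ∀ h ∈ Icc 0 d, |u x h - u x 0| ≤ M) (x : Space N) {t s : ℝ} (ht : 0 ≤ t)
    (hs : 0 ≤ s) (hts : |t - s| ≤ d) : |u x t - u x s| ≤ M := by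
  have := abs_le.1 hts
  rcases le_total s t with h | h
  · have := hu.time_shift_le hA hH (h := t - s) (M := M) (by linarith)
      (fun x => h0 x _ ⟨by linarith, by linarith⟩) x hs
    rwa [add_sub_cancel] at this
  · have := hu.time_shift_le hA hH (h := s - t) (M := M) (by linarith)
      (fun x => h0 x _ ⟨by linarith, by linarith⟩) x ht
    rw [add_sub_cancel] at this
    rwa [abs_sub_comm]

theorem Sol.exists_time_bound (hA : Admissible ν j Cj α) (hH : HamCond H m A b₀ ζ₁ ζ₂)
    {u : Space N → ℝ → ℝ} (hu : Sol ν j Cj H u) :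
    ∃ W, ∀ x t s, 0 ≤ t → 0 ≤ s → |t - s| ≤ 1 → |u x t - u x s| ≤ W := by
  obtain ⟨U, hU0, hU⟩ := hu.bounded 1
  refine ⟨2 * U, fun x t s ht hs hts => hu.time_shift_abs hA hH (d := 1) (fun x h hh => ?_) x ht
    hs hts⟩
  have h1 := abs_le.1 (hU x h hh)
  have h2 := abs_le.1 (hU x 0 ⟨le_rfl, zero_le_one⟩)
  rw [abs_le]; constructor <;> linarith

theorem Sol.exists_time_modulus (hA : Admissible ν j Cj α) (hH : HamCond H m A b₀ ζ₁ ζ₂)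
    {u : Space N → ℝ → ℝ} (hu : Sol ν j Cj H u) {ε : ℝ} (hε : 0 < ε) :
    ∃ d, 0 < d ∧ ∀ x t s, 0 ≤ t → 0 ≤ s → |t - s| ≤ d → |u x t - u x s| ≤ ε := by
  obtain ⟨D, hD, hlat⟩ := exists_lattice_norm_le N
  have huc := ((isCompact_closedBall (0 : Space N) D).prod
    (isCompact_Icc (a := (0 : ℝ)) (b := 1))).uniformContinuousOn_of_continuous
    (hu.cont.mono fun q hq => ⟨mem_univ _, hq.2.1⟩)
  obtain ⟨d, hd, hd'⟩ := Metric.uniformContinuousOn_iff.1 huc ε hε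
  refine ⟨min (d / 2) 1, by positivity, fun x t s ht hs hts =>
    hu.time_shift_abs hA hH (fun x h hh => ?_) x ht hs hts⟩
  obtain ⟨k, hk⟩ := hlat 0 x
  have hxk : x + lattice k ∈ Metric.closedBall (0 : Space N) D := by simpa using hk
  have h1 : h ≤ 1 := hh.2.trans (min_le_right _ _)
  have h2 := hd' (x + lattice k, h) ⟨hxk, hh.1, h1⟩ (x + lattice k, 0)
    ⟨hxk, le_rfl, zero_le_one⟩ (by
      rw [Prod.dist_eq, dist_self, Real.dist_eq, sub_zero, abs_of_nonneg hh.1]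
      have := hh.2.trans (min_le_left _ _)
      exact max_lt hd (by linarith))
  have e1 := hu.periodic h hh.1 k x
  have e2 := hu.periodic 0 le_rfl k x
  simp only at e1 e2 h2
  rw [e1, e2, Real.dist_eq] at h2
  exact h2.le

/-- After time `2` the Hölder estimate applies with a time shift that costs at most `W`; before
that, `u` is bounded. -/
theorem Sol.exists_osc_bound (hA : Admissible ν j Cj α) (hαm : α < m)
    (hH : HamCond H m A b₀ ζ₁ ζ₂) {u : Space N → ℝ → ℝ} (hu : Sol ν j Cj H u) :
    ∃ B, ∀ x y t, 0 ≤ t → u y t - u x t ≤ B := by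
  obtain ⟨W, hW⟩ := hu.exists_time_bound hA hH
  obtain ⟨K, hK, hKu⟩ := holder_up_to_time_shift hA hαm hH hu hW (e := 1 / 2) (by norm_num) le_rfl
  obtain ⟨U, hU0, hU⟩ := hu.bounded 2
  obtain ⟨D, hD, hlat⟩ := exists_lattice_norm_le N
  have hγ : 0 ≤ (m - α) / (m - 1) := div_nonneg (by linarith) (by linarith [hH.one_lt])
  refine ⟨max (2 * U) (W + K * D ^ ((m - α) / (m - 1))), fun x y t ht => ?_⟩
  rcases le_total t 2 with h | h
  · have h1 := abs_le.1 (hU x t ⟨ht, h⟩)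
    have h2 := abs_le.1 (hU y t ⟨ht, h⟩)
    exact le_trans (by linarith) (le_max_left _ _)
  · refine le_trans ?_ (le_max_right _ _)
    obtain ⟨s, hs, hsy⟩ := hKu x t h
    obtain ⟨k, hk⟩ := hlat x y
    have h1 := hsy (y + lattice k)
    have h2 := hu.periodic t ht k y
    simp only at h2
    rw [h2] at h1
    have hs' := abs_le.1 hs
    have h3 := (abs_le.1 (hW x s t (by linarith) ht (by linarith))).2
    have h4 : K * ‖y + lattice k - x‖ ^ ((m - α) / (m - 1)) ≤ K * D ^ ((m - α) / (m - 1)) :=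
      mul_le_mul_of_nonneg_left (Real.rpow_le_rpow (norm_nonneg _) hk hγ) hK
    linarith

/-- The time modulus is fixed first, so that the shift in the Hölder estimate costs at most `ε / 2`;
only then is `K` determined and `d` chosen. -/
theorem Sol.exists_space_modulus (hA : Admissible ν j Cj α) (hαm : α < m)
    (hH : HamCond H m A b₀ ζ₁ ζ₂) {u : Space N → ℝ → ℝ} (hu : Sol ν j Cj H u) {ε : ℝ}
    (hε : 0 < ε) :
    ∃ d, 0 < d ∧ ∀ x y t, 2 ≤ t → ‖y - x‖ ≤ d → |u y t - u x t| ≤ ε := by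
  obtain ⟨W, hW⟩ := hu.exists_time_bound hA hH
  obtain ⟨e, he, heu⟩ := hu.exists_time_modulus hA hH (half_pos hε)
  obtain ⟨K, hK, hKu⟩ := holder_up_to_time_shift hA hαm hH hu hW (e := min e (1 / 2))
    (by positivity) (min_le_right _ _)
  set γ := (m - α) / (m - 1)
  have hγ : 0 < γ := div_pos (by linarith) (by linarith [hH.one_lt])
  have hl : Tendsto (fun d : ℝ => K * d ^ γ) (𝓝[>] 0) (𝓝 0) := by
    have h1 : Tendsto (fun d : ℝ => d ^ γ) (𝓝[>] 0) (𝓝 (0 ^ γ)) :=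
      ((Real.continuousAt_rpow_const 0 γ (Or.inr hγ.le)).tendsto).mono_left nhdsWithin_le_nhds
    rw [Real.zero_rpow hγ.ne'] at h1
    simpa using h1.const_mul K
  obtain ⟨d, hd1, hd0⟩ := ((hl.eventually_le_const (half_pos hε)).and self_mem_nhdsWithin).exists
  have key : ∀ x y t, 2 ≤ t → ‖y - x‖ ≤ d → u y t - u x t ≤ ε := by
    intro x y t ht hxy
    obtain ⟨s, hs, hsy⟩ := hKu x t ht
    have h1 := hsy y
    have hs1 := hs.trans (min_le_left _ _)
    have hs2 := abs_le.1 (hs.trans (min_le_right _ _))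
    have h2 := (abs_le.1 (heu x s t (by linarith) (by linarith) hs1)).2
    have h3 : K * ‖y - x‖ ^ γ ≤ K * d ^ γ :=
      mul_le_mul_of_nonneg_left (Real.rpow_le_rpow (norm_nonneg _) hxy hγ.le) hK
    linarith
  refine ⟨d, hd0, fun x y t ht hxy => ?_⟩
  have h1 := key x y t ht hxy
  have h2 := key y x t ht (by rwa [norm_sub_rev])
  rw [abs_le]; constructor <;> linarith

/-- Quasi-additive functions with bounded increments are at bounded distance from a linear one. -/
theorem exists_slope {f : ℝ → ℝ} {C W : ℝ} (hC : 0 ≤ C)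
    (hadd : ∀ t s, 0 ≤ t → 0 ≤ s → |f (t + s) - f t - f s| ≤ C)
    (hW : ∀ t s, 0 ≤ t → 0 ≤ s → |t - s| ≤ 1 → |f t - f s| ≤ W) :
    ∃ c B : ℝ, ∀ t, 0 ≤ t → |f t - c * t| ≤ B := by
  have hW0 : 0 ≤ W := (abs_nonneg _).trans (hW 0 0 le_rfl le_rfl (by simp))
  -- Adding `C` makes both `f` and `-f` subadditive on the integers, so Fekete's lemma bounds `f n -
  -- c n` from both sides.
  have hsub₁ : Subadditive (fun n : ℕ => f n + C) := fun a b => by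
    have := (abs_le.1 (hadd a b (Nat.cast_nonneg _) (Nat.cast_nonneg _))).2
    push_cast
    linarith
  have hsub₂ : Subadditive (fun n : ℕ => -f n + C) := fun a b => by
    have := (abs_le.1 (hadd a b (Nat.cast_nonneg _) (Nat.cast_nonneg _))).1
    push_cast
    linarith
  have hgrow : ∀ n : ℕ, |f n| ≤ |f 0| + n * W := by
    intro n
    induction n with
    | zero => simp
    | succ n ih =>
      have h1 := abs_le.1 (hW (n + 1) n (by positivity) (Nat.cast_nonneg _) (by simp))
      have h2 := abs_le.1 ih
      push_cast
      rw [abs_le]; constructor <;> linarith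
  have hbdd : ∀ g : ℕ → ℝ, (∀ n, |g n| ≤ |f 0| + n * W + C) →
      BddBelow (range fun n => g n / n) := by
    intro g hg
    refine ⟨-(|f 0| + W + C), ?_⟩
    rintro _ ⟨n, rfl⟩
    rcases n.eq_zero_or_pos with rfl | hn
    · simp only [Nat.cast_zero, div_zero]
      linarith [abs_nonneg (f 0)]
    · have hn1 : (1 : ℝ) ≤ n := by exact_mod_cast hn
      simp only
      rw [le_div_iff₀ (by linarith)]
      have h1 := (abs_le.1 (hg n)).1
      have h2 : |f 0| + C ≤ (|f 0| + C) * n := le_mul_of_one_le_right (by positivity) hn1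
      linarith
  have hb₁ := hbdd (fun n => f n + C) fun n => by
    refine (abs_add_le _ _).trans ?_
    rw [abs_of_nonneg hC]; linarith [hgrow n]
  have hb₂ := hbdd (fun n => -f n + C) fun n => by
    refine (abs_add_le _ _).trans ?_
    rw [abs_of_nonneg hC, abs_neg]; linarith [hgrow n]
  set c := hsub₁.lim
  have hlim₂ : hsub₂.lim = -c := by
    have h1 := hsub₁.tendsto_lim hb₁
    have h2 := hsub₂.tendsto_lim hb₂
    have h3 : Tendsto (fun n : ℕ => 2 * C / (n : ℝ)) atTop (𝓝 0) :=
      tendsto_const_div_atTop_nhds_zero_nat _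
    have h4 := h3.sub h1
    rw [zero_sub] at h4
    refine tendsto_nhds_unique h2 (h4.congr fun n => ?_)
    ring
  have hnat : ∀ n : ℕ, |f n - c * n| ≤ C + |f 0| := by
    intro n
    rcases n.eq_zero_or_pos with rfl | hn
    · simp; linarith
    · have hn0 : (0 : ℝ) < n := by exact_mod_cast hn
      have h1 := hsub₁.lim_le_div hb₁ hn.ne'
      have h2 := hsub₂.lim_le_div hb₂ hn.ne'
      rw [hlim₂] at h2
      rw [le_div_iff₀ hn0] at h1 h2
      have := abs_nonneg (f 0)
      rw [abs_le]; constructor <;> linarith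
  refine ⟨c, W + (C + |f 0|) + |c|, fun t ht => ?_⟩
  have h1 := Nat.floor_le ht
  have h2 := Nat.lt_floor_add_one t
  have h3 := abs_le.1 (hW t ⌊t⌋₊ ht (Nat.cast_nonneg _)
    (by rw [abs_le]; constructor <;> linarith))
  have h4 := abs_le.1 (hnat ⌊t⌋₊)
  have h5 : |c * ((⌊t⌋₊ : ℝ) - t)| ≤ |c| := by
    rw [abs_mul]
    refine mul_le_of_le_one_right (abs_nonneg _) ?_
    rw [abs_le]; constructor <;> linarith
  have h5 := abs_le.1 h5
  rw [abs_le]; constructor <;> linarith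

/-- The shift of `u` by `s` and the solution `u + u(0, s)` differ at time `0` by at most the
oscillation plus the bound on the initial data. Contraction makes `t ↦ u(0, t)` additive up to that
constant. -/
theorem Sol.exists_ergodic_constant (hA : Admissible ν j Cj α) (hαm : α < m)
    (hH : HamCond H m A b₀ ζ₁ ζ₂) {u : Space N → ℝ → ℝ} (hu : Sol ν j Cj H u) :
    ∃ c B : ℝ, ∀ x t, 0 ≤ t → |u x t - c * t| ≤ B := by
  obtain ⟨W, hW⟩ := hu.exists_time_bound hA hH
  obtain ⟨B, hB⟩ := hu.exists_osc_bound hA hαm hH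
  obtain ⟨U, hU0, hU⟩ := hu.bounded 0
  have hB0 : 0 ≤ B := by simpa using hB 0 0 0 le_rfl
  have hosc : ∀ x t, 0 ≤ t → |u x t - u 0 t| ≤ B := fun x t ht => by
    have h1 := hB 0 x t ht
    have h2 := hB x 0 t ht
    rw [abs_le]; constructor <;> linarith
  obtain ⟨c, B', hc⟩ := exists_slope (f := fun t => u 0 t) (C := B + U) (by positivity)
    (fun t s ht hs => by
      have h1 := abs_comparison hA hH (hu.shift hs) (hu.add_const (u 0 s)) (M := B + U)
        (fun x => by
          have h2 := abs_le.1 (hosc x s hs)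
          have h3 := abs_le.1 (hU x 0 ⟨le_rfl, le_rfl⟩)
          rw [zero_add, abs_le]; constructor <;> linarith) ht 0
      rwa [← sub_sub] at h1) (hW 0)
  refine ⟨c, B + B', fun x t ht => ?_⟩
  have h1 := abs_le.1 (hc t ht)
  have h2 := abs_le.1 (hosc x t ht)
  rw [abs_le]; constructor <;> linarith

/-! ### Compactness and convergence -/

theorem Periodic.exists_forall_le {f : Space N → ℝ} (hf : Periodic f) (hc : Continuous f) :
    ∃ x₀, ∀ x, f x ≤ f x₀ := by
  obtain ⟨D, hD, hlat⟩ := exists_lattice_norm_le N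
  obtain ⟨x₀, -, hx₀⟩ := (isCompact_closedBall (0 : Space N) D).exists_isMaxOn
    ⟨0, Metric.mem_closedBall_self hD.le⟩ hc.continuousOn
  refine ⟨x₀, fun x => ?_⟩
  obtain ⟨k, hk⟩ := hlat 0 x
  rw [← hf k x]
  exact hx₀ (mem_closedBall_iff_norm.2 hk)

theorem exists_subseq_uniformCauchy {F : ℕ → Space N → ℝ} {B : ℝ} (hper : ∀ n, Periodic (F n))
    (hB : ∀ n x, |F n x| ≤ B)
    (heq : ∀ ε > 0, ∃ d, 0 < d ∧ ∀ n x y, ‖y - x‖ ≤ d → |F n y - F n x| ≤ ε) :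
    ∃ φ : ℕ → ℕ, StrictMono φ ∧ ∀ ε > 0, ∃ n₀, ∀ n ≥ n₀, ∀ k ≥ n₀, ∀ x,
      |F (φ n) x - F (φ k) x| ≤ ε := by
  have hcont : ∀ n, Continuous (F n) := fun n => Metric.continuous_iff.2 fun x ε hε => by
    obtain ⟨d, hd, hd'⟩ := heq (ε / 2) (half_pos hε)
    refine ⟨d, hd, fun y hy => ?_⟩
    rw [Real.dist_eq]
    exact (hd' n x y (by rw [← dist_eq_norm]; exact hy.le)).trans_lt (half_lt_self hε)
  obtain ⟨D, hD, hlat⟩ := exists_lattice_norm_le N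
  have : CompactSpace (Metric.closedBall (0 : Space N) D) :=
    isCompact_iff_compactSpace.1 (isCompact_closedBall _ _)
  let f : ℕ → BoundedContinuousFunction (Metric.closedBall (0 : Space N) D) ℝ := fun n =>
    BoundedContinuousFunction.mkOfCompact ⟨fun x => F n x, (hcont n).comp continuous_subtype_val⟩
  have hcomp : IsCompact (closure (range f)) := by
    refine BoundedContinuousFunction.arzela_ascoli (Icc (-B) B) isCompact_Icc _ ?_ ?_
    · rintro _ x ⟨n, rfl⟩
      exact abs_le.1 (hB n x)
    · intro x
      rw [Metric.equicontinuousAt_iff]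
      intro ε hε
      obtain ⟨d, hd, hd'⟩ := heq (ε / 2) (half_pos hε)
      refine ⟨d, hd, ?_⟩
      rintro y hy ⟨_, n, rfl⟩
      rw [dist_comm, Real.dist_eq]
      exact (hd' n x y (by rw [← dist_eq_norm]; exact hy.le)).trans_lt (half_lt_self hε)
  obtain ⟨g, -, φ, hφ, hlim⟩ := hcomp.tendsto_subseq fun n => subset_closure (mem_range_self n)
  refine ⟨φ, hφ, fun ε hε => ?_⟩
  obtain ⟨n₀, hn₀⟩ := Metric.cauchySeq_iff.1 hlim.cauchySeq ε hε
  refine ⟨n₀, fun n hn k hk x => ?_⟩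
  obtain ⟨l, hl⟩ := hlat 0 x
  rw [← hper _ l x, ← hper (φ k) l x]
  have h1 := BoundedContinuousFunction.dist_coe_le_dist (f := f (φ n)) (g := f (φ k))
    ⟨x + lattice l, mem_closedBall_iff_norm.2 hl⟩
  exact h1.trans (hn₀ n hn k hk).le

/-- Contraction makes a sequence that is uniformly Cauchy at time `0` uniformly Cauchy for all times
at once; stability then identifies the limit. -/
theorem Sol.exists_uniform_limit (hA : Admissible ν j Cj α) (hH : HamCond H m A b₀ ζ₁ ζ₂)
    {V : ℕ → Space N → ℝ → ℝ} (hV : ∀ n, Sol ν j Cj H (V n))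
    (hC : ∀ ε > 0, ∃ n₀, ∀ n ≥ n₀, ∀ k ≥ n₀, ∀ x, |V n x 0 - V k x 0| ≤ ε) :
    ∃ v, Sol ν j Cj H v ∧ ∀ ε > 0, ∀ᶠ n in atTop, ∀ x t, 0 ≤ t → |V n x t - v x t| ≤ ε := by
  have hC' : ∀ ε > 0, ∃ n₀, ∀ n ≥ n₀, ∀ k ≥ n₀, ∀ x t, 0 ≤ t → |V n x t - V k x t| ≤ ε := by
    intro ε hε
    obtain ⟨n₀, hn₀⟩ := hC ε hε
    exact ⟨n₀, fun n hn k hk x t ht => abs_comparison hA hH (hV n) (hV k) (hn₀ n hn k hk) ht x⟩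
  have hex : ∀ x t, ∃ l, 0 ≤ t → Tendsto (fun n => V n x t) atTop (𝓝 l) := by
    intro x t
    by_cases ht : 0 ≤ t
    · have : CauchySeq fun n => V n x t := Metric.cauchySeq_iff.2 fun ε hε => by
        obtain ⟨n₀, hn₀⟩ := hC' (ε / 2) (half_pos hε)
        exact ⟨n₀, fun n hn k hk => (hn₀ n hn k hk x t ht).trans_lt (half_lt_self hε)⟩
      obtain ⟨l, hl⟩ := cauchySeq_tendsto_of_complete this
      exact ⟨l, fun _ => hl⟩
    · exact ⟨0, fun h => absurd h ht⟩
  choose v hv using hex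
  have hlim : ∀ ε > 0, ∀ᶠ n in atTop, ∀ x t, 0 ≤ t → |V n x t - v x t| ≤ ε := by
    intro ε hε
    obtain ⟨n₀, hn₀⟩ := hC' ε hε
    filter_upwards [eventually_ge_atTop n₀] with n hn x t ht
    exact le_of_tendsto ((tendsto_const_nhds.sub (hv x t ht)).abs)
      ((eventually_ge_atTop n₀).mono fun k hk => hn₀ n hn k hk x t ht)
  exact ⟨v, Sol.of_uniform_limit hA hH.cont hV hlim, hlim⟩

/-- Time increments of a limit, as time tends to infinity, of a solution are constant in space and
time. -/
theorem Sol.exists_increment_eq (hA : Admissible ν j Cj α) (hH : HamCond H m A b₀ ζ₁ ζ₂)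
    (hj_supp : ∀ x, ContinuousOn (j x) ν.support) (hcov : IterativeCovering ν j)
    {u v : Space N → ℝ → ℝ} (hu : Sol ν j Cj H u) (hv : Sol ν j Cj H v) {c B : ℝ}
    (hc : ∀ x t, 0 ≤ t → |u x t - c * t| ≤ B) {s : ℕ → ℝ} (hs : Tendsto s atTop atTop)
    (hlim : ∀ ε > 0, ∀ᶠ n in atTop, ∀ x t, 0 ≤ t → |u x (t + s n) + -(c * s n) - v x t| ≤ ε)
    {h : ℝ} (hh : 0 ≤ h) : ∃ L, ∀ x t, 0 < t → v x (t + h) - v x t = L := by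
  -- By comparison the supremum over `x` of `u(x, t + h) - u(x, t)` is nonincreasing in `t`, and
  -- `sInf S` is its limit.
  set S : Set ℝ := {M | ∃ t, 0 ≤ t ∧ ∀ x, u x (t + h) - u x t ≤ M} with hS
  have hSne : S.Nonempty := ⟨c * h + 2 * B, 0, le_rfl, fun x => by
    have h1 := abs_le.1 (hc x (0 + h) (by linarith))
    have h2 := abs_le.1 (hc x 0 le_rfl)
    linarith⟩
  have hSb : BddBelow S := ⟨c * h - 2 * B, by
    rintro M ⟨t, ht, hM⟩
    have h1 := abs_le.1 (hc 0 (t + h) (by linarith))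
    have h2 := abs_le.1 (hc 0 t ht)
    linarith [hM 0]⟩
  have hle : ∀ x t, 0 < t → v x (t + h) - v x t ≤ sInf S := by
    intro x t ht
    refine le_csInf hSne ?_
    rintro M ⟨t₀, ht₀, hM⟩
    refine le_of_forall_pos_le_add fun ε hε => ?_
    obtain ⟨n, hn, hsn⟩ := ((hlim (ε / 2) (half_pos hε)).and (hs.eventually_ge_atTop t₀)).exists
    have h1 := abs_le.1 (hn x (t + h) (by linarith))
    have h2 := abs_le.1 (hn x t ht.le)
    have h3 := comparison hA hH (hu.shift (h := t₀ + h) (by linarith)) (hu.shift ht₀) (M := M)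
      (fun x => by simpa only [zero_add] using hM x) (t := t + s n - t₀) (by linarith) x
    rw [sub_add_cancel, show t + s n - t₀ + (t₀ + h) = t + h + s n by ring] at h3
    linarith
  refine ⟨sInf S, fun x t ht => ?_⟩
  obtain ⟨xb, hxb⟩ := Periodic.exists_forall_le (f := fun x => v x (t + h) - v x t)
    (fun k x => by
      have h1 := hv.periodic (t + h) (by linarith) k x
      have h2 := hv.periodic t ht.le k x
      simp only at h1 h2 ⊢
      rw [h1, h2])
    ((hv.cont_slice (by linarith)).sub (hv.cont_slice ht.le))
  refine strong_maximum hA hH hj_supp hcov (hv.shift hh) hv ht hle (xb := xb) ?_ x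
  -- If the maximum at time `t` were smaller, the increments of `u` at time `t + s n` would lie
  -- uniformly below `sInf S` for a suitable `n`.
  refine le_antisymm (hle xb t ht) (le_of_forall_pos_le_add fun ε hε => ?_)
  obtain ⟨n, hn, hsn⟩ := ((hlim (ε / 2) (half_pos hε)).and (hs.eventually_ge_atTop 0)).exists
  refine csInf_le hSb ⟨t + s n, by linarith, fun y => ?_⟩
  have h1 := abs_le.1 (hn y (t + h) (by linarith))
  have h2 := abs_le.1 (hn y t ht.le)
  have h3 := hxb y
  rw [show t + s n + h = t + h + s n by ring]
  linarith

/-- Iteration gives `f (t + n h) = f t + n L`; a deviation of `L` from `c h` would grow linearly in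
`n`. -/
theorem eq_mul_of_increment_eq {f : ℝ → ℝ} {c B h L t : ℝ} (hh : 0 ≤ h) (ht : 0 < t)
    (hf : ∀ t, 0 < t → |f t - c * t| ≤ B) (hL : ∀ t, 0 < t → f (t + h) - f t = L) :
    L = c * h := by
  have hn : ∀ n : ℕ, f (t + n * h) = f t + n * L := by
    intro n
    induction n with
    | zero => simp
    | succ n ih =>
      have := hL (t + n * h) (by positivity)
      push_cast
      rw [show t + (n + 1) * h = t + n * h + h by ring]
      linarith
  by_contra hne
  have hpos : 0 < |L - c * h| := abs_pos.2 (sub_ne_zero.2 hne)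
  obtain ⟨n, hn'⟩ := exists_nat_gt (2 * B / |L - c * h|)
  rw [div_lt_iff₀ hpos] at hn'
  have h1 := abs_le.1 (hf (t + n * h) (by positivity))
  have h2 := abs_le.1 (hf t ht)
  rw [hn] at h1
  have h3 : |(n : ℝ) * (L - c * h)| ≤ 2 * B := by
    rw [abs_le]; constructor <;> linarith
  rw [abs_mul, Nat.abs_cast] at h3
  linarith

theorem Sol.tendsto_ergodic (hA : Admissible ν j Cj α) (hαm : α < m)
    (hH : HamCond H m A b₀ ζ₁ ζ₂) (hj_supp : ∀ x, ContinuousOn (j x) ν.support)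
    (hcov : IterativeCovering ν j) {u : Space N → ℝ → ℝ} (hu : Sol ν j Cj H u) :
    ∃ (w : Space N → ℝ) (c : ℝ), IsErgodicSolution ν j H w c ∧
      TendstoUniformly (fun (t : ℝ) (x : Space N) => u x t - c * t - w x) (fun _ => 0) atTop := by
  obtain ⟨c, B, hc⟩ := hu.exists_ergodic_constant hA hαm hH
  -- The times start at `2`, where the spatial modulus becomes available.
  obtain ⟨φ, hφ, hcau⟩ := exists_subseq_uniformCauchy (B := B)
    (F := fun (n : ℕ) x => u x (n + 2) - c * (n + 2))
    (fun n k x => congrArg (· - c * ((n : ℝ) + 2)) (hu.periodic (n + 2) (by positivity) k x))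
    (fun n x => hc x _ (by positivity))
    (fun ε hε => by
      obtain ⟨d, hd, hd'⟩ := hu.exists_space_modulus hA hαm hH hε
      refine ⟨d, hd, fun n x y hxy => ?_⟩
      rw [sub_sub_sub_cancel_right]
      exact hd' x y _ (by simp) hxy)
  set s : ℕ → ℝ := fun n => φ n + 2
  have hs0 : ∀ n, 0 ≤ s n := fun n => by positivity
  have hs : Tendsto s atTop atTop :=
    tendsto_atTop_add_const_right _ _ (tendsto_natCast_atTop_atTop.comp hφ.tendsto_atTop)
  obtain ⟨v, hv, hlim⟩ := Sol.exists_uniform_limit hA hH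
    (fun n => (hu.shift (hs0 n)).add_const (-(c * s n))) (by
      simpa only [zero_add, ← sub_eq_add_neg] using hcau)
  have hvc : ∀ x t, 0 < t → |v x t - c * t| ≤ B + 1 := by
    intro x t ht
    obtain ⟨n, hn⟩ := (hlim 1 one_pos).exists
    have h1 := abs_le.1 (hn x t ht.le)
    have h2 := abs_le.1 (hc x (t + s n) (by linarith [hs0 n]))
    rw [abs_le]; constructor <;> linarith
  have hinc : ∀ h, 0 ≤ h → ∀ x t, 0 < t → v x (t + h) - v x t = c * h := by
    intro h hh x t ht
    obtain ⟨L, hL⟩ := hu.exists_increment_eq hA hH hj_supp hcov hv hc hs hlim hh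
    rw [hL x t ht]
    exact eq_mul_of_increment_eq (f := v 0) hh one_pos (hvc 0) (hL 0)
  -- The profile is read off at time `1` because the increments are known at positive times only.
  have hw : Sol ν j Cj H (fun x t => v x 1 - c + c * t) := by
    refine ((hv.shift zero_le_one).add_const (-c)).congr fun x t ht => ?_
    have := hinc t ht x 1 one_pos
    rw [add_comm t 1]
    linarith
  refine ⟨fun x => v x 1 - c, c, IsErgodicSolution.of_sol hA hw, ?_⟩
  rw [Metric.tendstoUniformly_iff]
  intro ε hε
  obtain ⟨n, hn⟩ := (hlim (ε / 2) (half_pos hε)).exists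
  filter_upwards [eventually_ge_atTop (1 + s n)] with t ht x
  -- Closeness at the single time `1 + s n` persists at all later times, so convergence along the
  -- sequence is enough.
  have h1 := abs_comparison hA hH (hu.shift (h := 1 + s n) (by linarith [hs0 n]))
    (hw.add_const (c * (1 + s n))) (M := ε / 2) (fun x => by
      rw [show u x (0 + (1 + s n)) - (v x 1 - c + c * 0 + c * (1 + s n))
        = u x (1 + s n) + -(c * s n) - v x 1 by rw [zero_add]; ring]
      exact hn x 1 zero_le_one) (t := t - (1 + s n)) (by linarith) x
  rw [sub_add_cancel] at h1
  rw [dist_comm, Real.dist_eq, sub_zero]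
  refine lt_of_eq_of_lt (congrArg _ ?_) (h1.trans_lt (half_lt_self hε))
  ring

end LevyIto

end

theorem mainTheorem1 (N : ℕ) (σ m : ℝ) (hσ : σ ∈ Set.Ioo (0 : ℝ) 2) (hm : max 1 σ < m)
    (ν : MeasureTheory.Measure (LevyIto.Space N))
    (hM1 : LevyIto.CondM1 σ ν) (hM2 : LevyIto.CondM2 σ ν)
    (j : LevyIto.Space N → LevyIto.Space N → LevyIto.Space N)
    (hj_meas : ∀ x, Measurable (j x))
    (hj_supp : ∀ x, ContinuousOn (j x) ν.support)
    (hj_cont : ∀ z, Continuous (fun x => j x z))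
    (hj_per : ∀ z, LevyIto.Periodic (fun x => j x z))
    (hJ1 : LevyIto.CondJ1 j) (hJ2 : LevyIto.CondJ2 ν j)
    (hcov : LevyIto.IterativeCovering ν j)
    (H : LevyIto.Space N → LevyIto.Space N → ℝ)
    (hH_cont : Continuous (fun q : LevyIto.Space N × LevyIto.Space N => H q.1 q.2))
    (hH_per : ∀ p, LevyIto.Periodic (fun x => H x p))
    (ζ₁ ζ₂ : ℝ → ℝ) (hζ₁ : LevyIto.IsModulus ζ₁) (hζ₂ : LevyIto.IsModulus ζ₂)
    (hζ₂' : Filter.Tendsto (fun s : ℝ => ζ₂ s * s ^ ((1 - m) / m)) (nhdsWithin 0 (Set.Ioi 0)) (nhds 0))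
    (hH0 : LevyIto.CondH0 H) (hH1 : LevyIto.CondH1 m ζ₁ ζ₂ H) (hH2 : LevyIto.CondH2 m H)
    (u₀ : LevyIto.Space N → ℝ) (hu₀_cont : Continuous u₀) (hu₀_per : LevyIto.Periodic u₀)
    (u : LevyIto.Space N → ℝ → ℝ) (hu : LevyIto.IsCauchySolution ν j H u₀ u) :
    ∃ (w : LevyIto.Space N → ℝ) (c : ℝ),
      LevyIto.IsErgodicSolution ν j H w c ∧
      TendstoUniformly (fun (t : ℝ) (x : LevyIto.Space N) => u x t - c * t - w x)
        (fun _ => 0) Filter.atTop := by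
  obtain ⟨Cj, α, hA, hαm⟩ :=
    LevyIto.admissible_of_cond hσ hm hM1 hM2 hj_meas hj_cont hJ1 hJ2
  obtain ⟨A, b₀, hA0, hb₀, h2⟩ := hH2
  have hH : LevyIto.HamCond H m A b₀ ζ₁ ζ₂ :=
    ⟨(le_max_left _ _).trans_lt hm, hA0, hb₀, hζ₁, hζ₂, hζ₂', hH_cont, hH0, hH1, h2⟩
  have hsol : LevyIto.Sol ν j Cj H u :=
    ⟨hu.periodic, hu.continuousOn, hu.subsolution.jetSub hA, hu.supersolution.neg.jetSub hA⟩
  exact hsol.tendsto_ergodic hA hαm hH hj_supp hcov
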